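/- Let $a,b,d,e\in\mathbb R$ and consider, on $x>0,\ y>0,\ t\in\mathbb R$, the equation $$\Delta:=(a-bx)u_x+(d-ey)u_y+\tfrac x2u_{xx}+\tfrac y2u_{yy}+u_t=0 .$$ An infinitesimal (Lie point) symmetry is a $C^\infty$ vector field $v=\xi\partial_x+\gamma\partial_y+\tau\partial_t+\phi\partial_u$, with coefficients depending on $(x,y,t,u)$, on $\{x>0,y>0\}$, whose second prolongation satisfies $\mathrm{pr}^{(2)}v(\Delta)=0$ at every point of the second order jet space (over $x,y>0$) at which $\Delta=0$. At the two exceptional parameter values we moreover require regularity at the boundary: if $a=\frac34$, that $\sqrt x\,\phi_u\to0$ as $x\to0^+$ (for fixed $y>0,t,u$), and if $d=\frac34$, that $\sqrt y\,\phi_u\to0$ as $y\to0^+$ (for fixed $x>0,t,u$). Let $\mathcal V$ be the set of these fields and $\mathcal L=\{v\in\mathcal V:\ \phi(x,y,t,0)=0\}$. **(1) General form.** $v\in\mathcal V$ if and only if $$\xi=\tau'x+\sqrt x(\sqrt y\,h+l),\qquad \gamma=\tau'y+\sqrt y(-\sqrt x\,h+k),\qquad \tau=\tau(t),\qquad \phi=\lambda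 u+\mu,$$ $$\lambda=(\tau''+b\tau')x+h(b-e)\sqrt{x}\sqrt y+2\bigl(l'+\tfrac b2l\bigr)\sqrt x+(\tau''+e\tau')y+2\bigl(k'+\tfrac e2k\bigr)\sqrt y+s,$$ where $\mu=\mu(x,y,t)$ is a $C^\infty$ solution of the equation on $x,y>0$ and $\tau,h,l,k,s$ are $C^\infty$ functions of $t\in\mathbb R$ with $$h(\tfrac14-a)=h(\tfrac14-d)=l(\tfrac14-a)=k(\tfrac14-d)=0,\quad h'=0,\quad \tau'''=b^2\tau',\quad (b^2-e^2)\tau'=0,\quad (b^2-e^2)h=0,$$ $$l''=\tfrac{b^2}4l,\qquad k''=\tfrac{e^2}4k,\qquad (a+d)\tau''+(ab+de)\tau'+s'=0 .$$ **(2) Structure.** $\mathcal V$ consists exactly of the fields $w+\mu\partial_u$ with $w\in\mathcal L$ and $\mu$ a $C^\infty$ solution of the equation, and $\mathcal L$ is closed under the Lie bracket of vector fields. **(3) Bases.** $\mathcal L$ is a finite-dimensional real vector space. Put $U=u\partial_u$, $T_c=\partial_t+c\,u\partial_u$, $R_c=\sqrt{x}\sqrt y(\partial_x-\partial_y)+c\sqrt{x}\sqrt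 y\,u\partial_u$, $$X_1^b=\sqrt x\,e^{bt/2}\partial_x+2b\sqrt x\,e^{bt/2}u\partial_u\ \ (b\ne0),\qquad X_1^0=t\sqrt x\,\partial_x+2\sqrt x\,u\partial_u,\qquad X_2^b=\sqrt x\,e^{-bt/2}\partial_x,$$ $Y_1^e,Y_2^e$ the same fields with $(y,e)$ in place of $(x,b)$, and $$P_1=e^{bt}\bigl(bx\partial_x+by\partial_y+\partial_t\bigr)+2be^{bt}\bigl(b(x+y)-(a+d)\bigr)u\partial_u,\qquad P_2=e^{-bt}\bigl(-bx\partial_x-by\partial_y+\partial_t\bigr),$$ $$N_1=e^{bt}\bigl(bx\partial_x+by\partial_y+\partial_t\bigr)+2be^{bt}(bx-a)u\partial_u,\qquad N_2=e^{-bt}\bigl(-bx\partial_x-by\partial_y+\partial_t\bigr)+2be^{-bt}(by+d)u\partial_u,$$ $$Z_1=2tx\partial_x+2ty\partial_y+t^2\partial_t+\bigl(2(x+y)-2(a+d)t\bigr)u\partial_u,\qquad Z_2=x\partial_x+y\partial_y+t\partial_t .$$ Then a basis of $\mathcal L$ is: * $a=d=\frac14$: for $b\neq\pm e$: $T_0,U,X_1^b,X_2^b,Y_1^e,Y_2^e$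 (dimension 6); for $b=e\ne0$: $P_1,P_2,T_{-b/2},R_0,X_1^b,X_2^b,Y_1^b,Y_2^b,U$; for $b=-e\neq0$: $N_1,N_2,T_0,R_{2b},X_1^b,X_2^b,Y_1^{-b},Y_2^{-b},U$; for $b=e=0$: $Z_1,Z_2,T_0,R_0,X_1^0,X_2^0,Y_1^0,Y_2^0,U$ (dimension 9 in these three cases). * $a\ne\frac14$, $d\neq\frac14$: for $b\ne\pm e$: $T_0,U$ (dimension 2); for $b=e\ne0$: $P_1,P_2,T_{-b(a+d)},U$; for $b=-e\ne0$: $N_1,N_2,T_{b(d-a)},U$; for $b=e=0$: $Z_1,Z_2,T_0,U$ (dimension 4). * $a=\frac14$, $d\ne\frac14$: for $b\ne\pm e$: $T_0,U,X_1^b,X_2^b$ (dimension 4); for $b=e\neq0$: $P_1,P_2,T_{-b(1/4+d)},X_1^b,X_2^b,U$; for $b=-e\ne0$: $N_1,N_2,T_{-b(1/4-d)},X_1^b,X_2^b,U$; for $b=e=0$: $Z_1,Z_2,T_0,X_1^0,X_2^0,U$ (dimension 6). * $a\ne\frac14$, $d=\frac14$: for $b\ne\pm e$: $T_0,U,Y_1^e,Y_2^e$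 (dimension 4); for $b=e\neq0$: $P_1,P_2,T_{-b(1/4+a)},Y_1^b,Y_2^b,U$; for $b=-e\ne0$: $N_1,N_2,T_{b(1/4-a)},Y_1^{-b},Y_2^{-b},U$; for $b=e=0$: $Z_1,Z_2,T_0,Y_1^0,Y_2^0,U$ (dimension 6). **(4) Dimensions.** Always $\dim\mathcal L\in\{2,4,6,9\}$; the largest value $9$ occurs if and only if $a=d=\frac14$ and $b=\pm e$ (including $b=e=0$), the smallest value $2$ if and only if $a\neq\frac14$, $d\ne\frac14$ and $b\ne\pm e$. -/

import Mathlib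

open Set Filter Topology
open scoped ContDiff

noncomputable section

namespace LongstaffSchwartz

/-- The space `X × U` of the variables `(x, y, t, u)`. -/
abbrev Pt : Type := ℝ × ℝ × ℝ × ℝ

/-- The domain `x > 0, y > 0` (`t` and `u` are arbitrary). -/
def domain : Set Pt := {p | 0 < p.1 ∧ 0 < p.2.1}

/-- A vector field `ξ ∂_x + γ ∂_y + τ ∂_t + φ ∂_u`, given by its four coefficients.
Only the values on `domain` matter; fields on `domain` are represented by their extension by `0`. -/
abbrev Field : Type := Pt → Pt

/-- Coordinates on the third order jet space of one function `u` of `(x, y, t)`. -/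
@[ext] structure Jet where
  (x y t u : ℝ)
  (ux uy ut : ℝ)
  (uxx uxy uxt uyy uyt utt : ℝ)
  (uxxx uxxy uxxt uxyy uxyt uxtt uyyy uyyt uytt uttt : ℝ)

namespace Jet

/-- The point `(x, y, t, u)` under a jet. -/
def pt (j : Jet) : Pt := (j.x, j.y, j.t, j.u)

/-! Partial derivatives of a function of the jet coordinates (those of order at most two). -/

def pdx (P : Jet → ℝ) (j : Jet) : ℝ := deriv (fun r => P { j with x := r }) j.x
def pdy (P : Jet → ℝ) (j : Jet) : ℝ := deriv (fun r => P { j with y := r }) j.y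
def pdt (P : Jet → ℝ) (j : Jet) : ℝ := deriv (fun r => P { j with t := r }) j.t
def pdu (P : Jet → ℝ) (j : Jet) : ℝ := deriv (fun r => P { j with u := r }) j.u
def pdux (P : Jet → ℝ) (j : Jet) : ℝ := deriv (fun r => P { j with ux := r }) j.ux
def pduy (P : Jet → ℝ) (j : Jet) : ℝ := deriv (fun r => P { j with uy := r }) j.uy
def pdut (P : Jet → ℝ) (j : Jet) : ℝ := deriv (fun r => P { j with ut := r }) j.ut
def pduxx (P : Jet → ℝ) (j : Jet) : ℝ := deriv (fun r => P { j with uxx := r }) j.uxx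
def pduxy (P : Jet → ℝ) (j : Jet) : ℝ := deriv (fun r => P { j with uxy := r }) j.uxy
def pduxt (P : Jet → ℝ) (j : Jet) : ℝ := deriv (fun r => P { j with uxt := r }) j.uxt
def pduyy (P : Jet → ℝ) (j : Jet) : ℝ := deriv (fun r => P { j with uyy := r }) j.uyy
def pduyt (P : Jet → ℝ) (j : Jet) : ℝ := deriv (fun r => P { j with uyt := r }) j.uyt
def pdutt (P : Jet → ℝ) (j : Jet) : ℝ := deriv (fun r => P { j with utt := r }) j.utt

/-- The total derivative `D_x` of a function of the jets of order at most two. -/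
def totalX (P : Jet → ℝ) (j : Jet) : ℝ :=
  pdx P j + j.ux * pdu P j
    + j.uxx * pdux P j + j.uxy * pduy P j + j.uxt * pdut P j
    + j.uxxx * pduxx P j + j.uxxy * pduxy P j + j.uxxt * pduxt P j
    + j.uxyy * pduyy P j + j.uxyt * pduyt P j + j.uxtt * pdutt P j

/-- The total derivative `D_y` of a function of the jets of order at most two. -/
def totalY (P : Jet → ℝ) (j : Jet) : ℝ :=
  pdy P j + j.uy * pdu P j
    + j.uxy * pdux P j + j.uyy * pduy P j + j.uyt * pdut P j
    + j.uxxy * pduxx P j + j.uxyy * pduxy P j + j.uxyt * pduxt P j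
    + j.uyyy * pduyy P j + j.uyyt * pduyt P j + j.uytt * pdutt P j

/-- The total derivative `D_t` of a function of the jets of order at most two. -/
def totalT (P : Jet → ℝ) (j : Jet) : ℝ :=
  pdt P j + j.ut * pdu P j
    + j.uxt * pdux P j + j.uyt * pduy P j + j.utt * pdut P j
    + j.uxxt * pduxx P j + j.uxyt * pduxy P j + j.uxtt * pduxt P j
    + j.uyyt * pduyy P j + j.uytt * pduyt P j + j.uttt * pdutt P j

end Jet

open Jet

/-! The coefficients of a vector field, as functions of the jets. -/

def xi (v : Field) (j : Jet) : ℝ := (v j.pt).1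
def gam (v : Field) (j : Jet) : ℝ := (v j.pt).2.1
def tau (v : Field) (j : Jet) : ℝ := (v j.pt).2.2.1
def phi (v : Field) (j : Jet) : ℝ := (v j.pt).2.2.2

/-- The characteristic `φ - ξ u_x - γ u_y - τ u_t`. -/
def charac (v : Field) (j : Jet) : ℝ :=
  phi v j - xi v j * j.ux - gam v j * j.uy - tau v j * j.ut

/-! The coefficients `φ^J = D_J (φ - ξ u_x - γ u_y - τ u_t) + ξ u_{J,x} + γ u_{J,y} + τ u_{J,t}`
of the second prolongation. -/

def phiX (v : Field) (j : Jet) : ℝ :=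
  totalX (charac v) j + xi v j * j.uxx + gam v j * j.uxy + tau v j * j.uxt
def phiY (v : Field) (j : Jet) : ℝ :=
  totalY (charac v) j + xi v j * j.uxy + gam v j * j.uyy + tau v j * j.uyt
def phiT (v : Field) (j : Jet) : ℝ :=
  totalT (charac v) j + xi v j * j.uxt + gam v j * j.uyt + tau v j * j.utt
def phiXX (v : Field) (j : Jet) : ℝ :=
  totalX (totalX (charac v)) j + xi v j * j.uxxx + gam v j * j.uxxy + tau v j * j.uxxt
def phiXY (v : Field) (j : Jet) : ℝ :=
  totalX (totalY (charac v)) j + xi v j * j.uxxy + gam v j * j.uxyy + tau v j * j.uxyt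
def phiXT (v : Field) (j : Jet) : ℝ :=
  totalX (totalT (charac v)) j + xi v j * j.uxxt + gam v j * j.uxyt + tau v j * j.uxtt
def phiYY (v : Field) (j : Jet) : ℝ :=
  totalY (totalY (charac v)) j + xi v j * j.uxyy + gam v j * j.uyyy + tau v j * j.uyyt
def phiYT (v : Field) (j : Jet) : ℝ :=
  totalY (totalT (charac v)) j + xi v j * j.uxyt + gam v j * j.uyyt + tau v j * j.uytt
def phiTT (v : Field) (j : Jet) : ℝ :=
  totalT (totalT (charac v)) j + xi v j * j.uxtt + gam v j * j.uytt + tau v j * j.uttt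

/-- The second prolongation of the vector field `v`, acting on a function `P` of the second order
jets. -/
def prolong (v : Field) (P : Jet → ℝ) (j : Jet) : ℝ :=
  xi v j * pdx P j + gam v j * pdy P j + tau v j * pdt P j + phi v j * pdu P j
    + phiX v j * pdux P j + phiY v j * pduy P j + phiT v j * pdut P j
    + phiXX v j * pduxx P j + phiXY v j * pduxy P j + phiXT v j * pduxt P j
    + phiYY v j * pduyy P j + phiYT v j * pduyt P j + phiTT v j * pdutt P j

/-- `Δ = (a - b x) u_x + (d - e y) u_y + (x/2) u_xx + (y/2) u_yy + u_t`. -/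
def Delta (a b d e : ℝ) (j : Jet) : ℝ :=
  (a - b * j.x) * j.ux + (d - e * j.y) * j.uy + j.x / 2 * j.uxx + j.y / 2 * j.uyy + j.ut

/-- `v` is an infinitesimal (Lie point) symmetry of the equation `Δ = 0` on `x, y > 0`: it is a
smooth vector field there, and its second prolongation annihilates `Δ` wherever `Δ = 0`. -/
structure IsInfinitesimalSymmetry (a b d e : ℝ) (v : Field) : Prop where
  zero_off : ∀ p, p ∉ domain → v p = 0
  smooth : ContDiffOn ℝ ∞ v domain
  invariant : ∀ j : Jet, j.pt ∈ domain → Delta a b d e j = 0 → prolong v (Delta a b d e) j = 0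

/-- The coefficient `λ = ∂φ/∂u` at the point `(x, y, t, u)`. -/
def phiU (v : Field) (x y t u : ℝ) : ℝ := deriv (fun w => (v (x, y, t, w)).2.2.2) u

/-- Regularity of `λ = ∂φ/∂u` at the boundary of the quadrant. It is asked for only at the
exceptional values `a = 3/4` (on the side `x = 0`) and `d = 3/4` (on the side `y = 0`), and is
weaker than boundedness of `λ` near that side. -/
def BoundaryRegular (a d : ℝ) (v : Field) : Prop :=
  (a = 3 / 4 → ∀ y t u : ℝ, 0 < y →
    Tendsto (fun x => √x * phiU v x y t u) (𝓝[>] 0) (𝓝 0)) ∧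
  (d = 3 / 4 → ∀ x t u : ℝ, 0 < x →
    Tendsto (fun y => √y * phiU v x y t u) (𝓝[>] 0) (𝓝 0))

/-- The set `𝒱` of all infinitesimal symmetries. -/
def symmetries (a b d e : ℝ) : Set Field :=
  {v | IsInfinitesimalSymmetry a b d e v ∧ BoundaryRegular a d v}

/-- The part `ℒ` of `𝒱` with `μ = 0`, where `μ` is the value of `φ` at `u = 0`. -/
def linearSymmetries (a b d e : ℝ) : Set Field :=
  {v ∈ symmetries a b d e | ∀ x y t : ℝ, (v (x, y, t, 0)).2.2.2 = 0}

/-- `μ` is a smooth solution on `x, y > 0` of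
`(a - b x) μ_x + (d - e y) μ_y + (x/2) μ_xx + (y/2) μ_yy + μ_t = 0`. -/
structure IsSolution (a b d e : ℝ) (μ : ℝ → ℝ → ℝ → ℝ) : Prop where
  smooth : ContDiffOn ℝ ∞ (fun q : ℝ × ℝ × ℝ => μ q.1 q.2.1 q.2.2) {q | 0 < q.1 ∧ 0 < q.2.1}
  eqn : ∀ x y t : ℝ, 0 < x → 0 < y →
    (a - b * x) * deriv (fun r => μ r y t) x + (d - e * y) * deriv (fun r => μ x r t) y
      + x / 2 * iteratedDeriv 2 (fun r => μ r y t) x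
      + y / 2 * iteratedDeriv 2 (fun r => μ x r t) y
      + deriv (fun r => μ x y r) t = 0

/-- The system of ordinary differential equations for `τ, h, l, k, s`. -/
structure IsAdmissible (a b d e : ℝ) (τ h l k s : ℝ → ℝ) : Prop where
  smooth_tau : ContDiff ℝ ∞ τ
  smooth_h : ContDiff ℝ ∞ h
  smooth_l : ContDiff ℝ ∞ l
  smooth_k : ContDiff ℝ ∞ k
  smooth_s : ContDiff ℝ ∞ s
  h_a : ∀ t, h t * (1 / 4 - a) = 0
  h_d : ∀ t, h t * (1 / 4 - d) = 0
  l_a : ∀ t, l t * (1 / 4 - a) = 0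
  k_d : ∀ t, k t * (1 / 4 - d) = 0
  h_eq : ∀ t, deriv h t = 0
  tau_eq : ∀ t, iteratedDeriv 3 τ t - b ^ 2 * deriv τ t = 0
  tau_be : ∀ t, (b ^ 2 - e ^ 2) * deriv τ t = 0
  h_be : ∀ t, (b ^ 2 - e ^ 2) * h t = 0
  l_eq : ∀ t, iteratedDeriv 2 l t - b ^ 2 / 4 * l t = 0
  k_eq : ∀ t, iteratedDeriv 2 k t - e ^ 2 / 4 * k t = 0
  s_eq : ∀ t, (a + d) * iteratedDeriv 2 τ t + (a * b + d * e) * deriv τ t + deriv s t = 0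

/-- The coefficient `λ(x, y, t)` of `u` in `φ`. -/
def lam (b e : ℝ) (τ h l k s : ℝ → ℝ) (x y t : ℝ) : ℝ :=
  (iteratedDeriv 2 τ t + b * deriv τ t) * x + h t * (b - e) * √x * √y
    + 2 * (deriv l t + b * l t / 2) * √x
    + (iteratedDeriv 2 τ t + e * deriv τ t) * y
    + 2 * (deriv k t + e * k t / 2) * √y + s t

/-- The field `ξ ∂_x + γ ∂_y + τ ∂_t + Λ u ∂_u`, with `ξ, γ, τ, Λ` functions of `(x, y, t)`. -/
def field (ξ γ τ Λ : ℝ → ℝ → ℝ → ℝ) : Field :=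
  domain.indicator fun p =>
    (ξ p.1 p.2.1 p.2.2.1, γ p.1 p.2.1 p.2.2.1, τ p.1 p.2.1 p.2.2.1,
      Λ p.1 p.2.1 p.2.2.1 * p.2.2.2)

/-- The field `μ ∂_u`. -/
def vMu (μ : ℝ → ℝ → ℝ → ℝ) : Field :=
  domain.indicator fun p => (0, 0, 0, μ p.1 p.2.1 p.2.2.1)

/-- `u ∂_u` -/
def vU : Field := field (fun _ _ _ => 0) (fun _ _ _ => 0) (fun _ _ _ => 0) (fun _ _ _ => 1)

/-- `∂_t + c u ∂_u` -/
def vT (c : ℝ) : Field :=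
  field (fun _ _ _ => 0) (fun _ _ _ => 0) (fun _ _ _ => 1) (fun _ _ _ => c)

/-- `√x e^{bt/2} ∂_x + 2b √x e^{bt/2} u ∂_u` for `b ≠ 0`, and `t √x ∂_x + 2 √x u ∂_u` for
`b = 0`. -/
def vX₁ (b : ℝ) : Field :=
  if b = 0 then
    field (fun x _ t => t * √x) (fun _ _ _ => 0) (fun _ _ _ => 0) (fun x _ _ => 2 * √x)
  else
    field (fun x _ t => √x * Real.exp (b / 2 * t)) (fun _ _ _ => 0) (fun _ _ _ => 0)
      (fun x _ t => 2 * b * √x * Real.exp (b / 2 * t))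

/-- `√x e^{-bt/2} ∂_x` -/
def vX₂ (b : ℝ) : Field :=
  field (fun x _ t => √x * Real.exp (-(b / 2) * t)) (fun _ _ _ => 0) (fun _ _ _ => 0)
    (fun _ _ _ => 0)

/-- `√y e^{et/2} ∂_y + 2e √y e^{et/2} u ∂_u` for `e ≠ 0`, and `t √y ∂_y + 2 √y u ∂_u` for
`e = 0`. -/
def vY₁ (e : ℝ) : Field :=
  if e = 0 then
    field (fun _ _ _ => 0) (fun _ y t => t * √y) (fun _ _ _ => 0) (fun _ y _ => 2 * √y)
  else
    field (fun _ _ _ => 0) (fun _ y t => √y * Real.exp (e / 2 * t)) (fun _ _ _ => 0)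
      (fun _ y t => 2 * e * √y * Real.exp (e / 2 * t))

/-- `√y e^{-et/2} ∂_y` -/
def vY₂ (e : ℝ) : Field :=
  field (fun _ _ _ => 0) (fun _ y t => √y * Real.exp (-(e / 2) * t)) (fun _ _ _ => 0)
    (fun _ _ _ => 0)

/-- `√x √y ∂_x - √x √y ∂_y + c √x √y u ∂_u` -/
def vR (c : ℝ) : Field :=
  field (fun x y _ => √x * √y) (fun x y _ => -(√x * √y)) (fun _ _ _ => 0)
    (fun x y _ => c * √x * √y)

/-- `b e^{bt} x ∂_x + b e^{bt} y ∂_y + e^{bt} ∂_t + 2b e^{bt} (b (x + y) - (a + d)) u ∂_u` -/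
def vP₁ (a b d : ℝ) : Field :=
  field (fun x _ t => b * Real.exp (b * t) * x) (fun _ y t => b * Real.exp (b * t) * y)
    (fun _ _ t => Real.exp (b * t))
    (fun x y t => 2 * b * Real.exp (b * t) * (b * (x + y) - (a + d)))

/-- `-b e^{-bt} x ∂_x - b e^{-bt} y ∂_y + e^{-bt} ∂_t` -/
def vP₂ (b : ℝ) : Field :=
  field (fun x _ t => -b * Real.exp (-b * t) * x) (fun _ y t => -b * Real.exp (-b * t) * y)
    (fun _ _ t => Real.exp (-b * t)) (fun _ _ _ => 0)

/-- `b e^{bt} x ∂_x + b e^{bt} y ∂_y + e^{bt} ∂_t + 2b e^{bt} (b x - a) u ∂_u` -/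
def vN₁ (a b : ℝ) : Field :=
  field (fun x _ t => b * Real.exp (b * t) * x) (fun _ y t => b * Real.exp (b * t) * y)
    (fun _ _ t => Real.exp (b * t)) (fun x _ t => 2 * b * Real.exp (b * t) * (b * x - a))

/-- `-b e^{-bt} x ∂_x - b e^{-bt} y ∂_y + e^{-bt} ∂_t + 2b e^{-bt} (b y + d) u ∂_u` -/
def vN₂ (b d : ℝ) : Field :=
  field (fun x _ t => -b * Real.exp (-b * t) * x) (fun _ y t => -b * Real.exp (-b * t) * y)
    (fun _ _ t => Real.exp (-b * t)) (fun _ y t => 2 * b * Real.exp (-b * t) * (b * y + d))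

/-- `2tx ∂_x + 2ty ∂_y + t² ∂_t + (2 (x + y) - 2 (a + d) t) u ∂_u` -/
def vZ₁ (a d : ℝ) : Field :=
  field (fun x _ t => 2 * t * x) (fun _ y t => 2 * t * y) (fun _ _ t => t ^ 2)
    (fun x y t => 2 * (x + y) - 2 * (a + d) * t)

/-- `x ∂_x + y ∂_y + t ∂_t` -/
def vZ₂ : Field :=
  field (fun x _ _ => x) (fun _ y _ => y) (fun _ _ t => t) (fun _ _ _ => 0)

/-- The finite family `w` is a basis of the set `S` of vector fields; in particular `S` is a
linear subspace. -/
def IsBasisOf {n : ℕ} (w : Fin n → Field) (S : Set Field) : Prop :=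
  LinearIndependent ℝ w ∧ (Submodule.span ℝ (range w) : Set Field) = S

end LongstaffSchwartz

end

/-!
The proof is the classical Lie symmetry computation, followed by the integration of the
determining equations.

*Splitting.* The second prolongation of `v` applied to `Δ` is a polynomial in the derivatives of `u`
whose coefficients are partial derivatives of `ξ, γ, τ, φ`; on `Δ = 0` the derivative `u_t` can be
eliminated and all other derivatives are free. Evaluating at suitable jets of the equation gives the
determining equations (`invariant_iff_determiningEquations`): `τ = τ(t)`, `ξ` and `γ` do not depend
on `u`, `φ = λ u + μ`, first order equations for `ξ` and `γ`, formulas for `∂_x λ` and `∂_y λ`, and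
`generator λ = generator μ = 0` for the operator `generator` of the equation.

*Integration.* The equations `ξ - 2x ξ_x + x τ' = 0` and its analogue for `γ` give
`ξ = τ' x + √x (…)`, and the equation `x γ_x + y ξ_y = 0` separates the variables and fixes the
brackets up to the functions `h, l, k` of `t` (`DeterminingEquations.exists_coefficientForm`). The
two formulas for the gradient of `λ` are compatible only if `h' = 0`, and then
`λ = lam + singularPart`, where the second term contains `1 / √x` and `1 / √y`
(`exists_eq_lam_add_singularPart`). In `generator λ = 0` the coefficient of `x^{-3/2}` is a multiple
of `(a - 1/4) (a - 3/4) (√y h + l)`, so the singular part vanishes unless `a = 3/4`, where the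
boundary condition removes it; likewise for `y` and `d` (`singularPart_vanishes`). What remains of
`generator λ = 0` is a polynomial in `√x` and `√y`, and its coefficients are the ordinary
differential equations for `τ, l, k, s` (`generator_lam`). All steps can be reversed
(`mem_symmetries_of_hasForm`).

*Structure.* A linear symmetry is thus a `Datum`: a solution of a first order system with constant
coefficients. Linearity of the system makes the linear symmetries a subspace, and an explicit
formula for the datum of a bracket (`Datum.bracket`) shows that they are closed under it.

*Bases.* `τ'` solves `f'' = b² f`, while `l` and `k` solve `f'' = (b²/4) f` and `f'' = (e²/4) f`,
and `τ' = 0` and `h = 0` unless `b = ± e`; this gives the generators. For the independence, the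
generators which move `t` are separated by their time components, and the others by their components
at a few values of `x` and `y` (`linearIndependent_nine`).
-/

noncomputable section

namespace LongstaffSchwartz

/-! ### Partial derivatives on the domain -/

/-- The partial derivative `∂/∂x` of a function of `(x, y, t, u)`. -/
def dX (f : Pt → ℝ) (p : Pt) : ℝ := deriv (fun r => f (r, p.2)) p.1

/-- The partial derivative `∂/∂y` of a function of `(x, y, t, u)`. -/
def dY (f : Pt → ℝ) (p : Pt) : ℝ := deriv (fun r => f (p.1, r, p.2.2)) p.2.1

/-- The partial derivative `∂/∂t` of a function of `(x, y, t, u)`. -/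
def dT (f : Pt → ℝ) (p : Pt) : ℝ := deriv (fun r => f (p.1, p.2.1, r, p.2.2.2)) p.2.2.1

/-- The partial derivative `∂/∂u` of a function of `(x, y, t, u)`. -/
def dU (f : Pt → ℝ) (p : Pt) : ℝ := deriv (fun r => f (p.1, p.2.1, p.2.2.1, r)) p.2.2.2

/-- Smoothness on the domain `x > 0, y > 0`. -/
abbrev Smooth (f : Pt → ℝ) : Prop := ContDiffOn ℝ ∞ f domain

lemma isOpen_domain : IsOpen domain :=
  (isOpen_lt continuous_const continuous_fst).inter
    (isOpen_lt continuous_const (continuous_fst.comp continuous_snd))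

lemma domain_mem_nhds {p : Pt} (hp : p ∈ domain) : domain ∈ 𝓝 p := isOpen_domain.mem_nhds hp

lemma Smooth.contDiffAt {f : Pt → ℝ} (hf : Smooth f) {p : Pt} (hp : p ∈ domain) :
    ContDiffAt ℝ ∞ f p := ContDiffOn.contDiffAt hf (domain_mem_nhds hp)

lemma Smooth.differentiableAt {f : Pt → ℝ} (hf : Smooth f) {p : Pt} (hp : p ∈ domain) :
    DifferentiableAt ℝ f p := (hf.contDiffAt hp).differentiableAt (by simp)

section lines

variable {f : Pt → ℝ} {p : Pt}

lemma hasDerivAt_lineX (hf : DifferentiableAt ℝ f p) :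
    HasDerivAt (fun r => f (r, p.2)) (fderiv ℝ f p (1, 0, 0, 0)) p.1 :=
  HasFDerivAt.comp_hasDerivAt p.1 (l := f) (f := fun r => (r, p.2)) hf.hasFDerivAt
    ((hasDerivAt_id p.1).prodMk (hasDerivAt_const p.1 p.2))

lemma hasDerivAt_lineY (hf : DifferentiableAt ℝ f p) :
    HasDerivAt (fun r => f (p.1, r, p.2.2)) (fderiv ℝ f p (0, 1, 0, 0)) p.2.1 :=
  HasFDerivAt.comp_hasDerivAt p.2.1 (l := f) (f := fun r => (p.1, r, p.2.2)) hf.hasFDerivAt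
    ((hasDerivAt_const p.2.1 p.1).prodMk
      ((hasDerivAt_id p.2.1).prodMk (hasDerivAt_const p.2.1 p.2.2)))

lemma hasDerivAt_lineT (hf : DifferentiableAt ℝ f p) :
    HasDerivAt (fun r => f (p.1, p.2.1, r, p.2.2.2)) (fderiv ℝ f p (0, 0, 1, 0)) p.2.2.1 :=
  HasFDerivAt.comp_hasDerivAt p.2.2.1 (l := f) (f := fun r => (p.1, p.2.1, r, p.2.2.2))
    hf.hasFDerivAt
    ((hasDerivAt_const p.2.2.1 p.1).prodMk ((hasDerivAt_const p.2.2.1 p.2.1).prodMk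
      ((hasDerivAt_id p.2.2.1).prodMk (hasDerivAt_const p.2.2.1 p.2.2.2))))

lemma hasDerivAt_lineU (hf : DifferentiableAt ℝ f p) :
    HasDerivAt (fun r => f (p.1, p.2.1, p.2.2.1, r)) (fderiv ℝ f p (0, 0, 0, 1)) p.2.2.2 :=
  HasFDerivAt.comp_hasDerivAt p.2.2.2 (l := f) (f := fun r => (p.1, p.2.1, p.2.2.1, r))
    hf.hasFDerivAt
    ((hasDerivAt_const p.2.2.2 p.1).prodMk ((hasDerivAt_const p.2.2.2 p.2.1).prodMk
      ((hasDerivAt_const p.2.2.2 p.2.2.1).prodMk (hasDerivAt_id p.2.2.2))))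

lemma dX_eq_fderiv (hf : DifferentiableAt ℝ f p) : dX f p = fderiv ℝ f p (1, 0, 0, 0) :=
  (hasDerivAt_lineX hf).deriv

lemma dY_eq_fderiv (hf : DifferentiableAt ℝ f p) : dY f p = fderiv ℝ f p (0, 1, 0, 0) :=
  (hasDerivAt_lineY hf).deriv

lemma dT_eq_fderiv (hf : DifferentiableAt ℝ f p) : dT f p = fderiv ℝ f p (0, 0, 1, 0) :=
  (hasDerivAt_lineT hf).deriv

lemma dU_eq_fderiv (hf : DifferentiableAt ℝ f p) : dU f p = fderiv ℝ f p (0, 0, 0, 1) :=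
  (hasDerivAt_lineU hf).deriv

lemma hasDerivAt_dX (hf : DifferentiableAt ℝ f p) :
    HasDerivAt (fun r => f (r, p.2)) (dX f p) p.1 := dX_eq_fderiv hf ▸ hasDerivAt_lineX hf

lemma hasDerivAt_dY (hf : DifferentiableAt ℝ f p) :
    HasDerivAt (fun r => f (p.1, r, p.2.2)) (dY f p) p.2.1 := dY_eq_fderiv hf ▸ hasDerivAt_lineY hf

lemma hasDerivAt_dT (hf : DifferentiableAt ℝ f p) :
    HasDerivAt (fun r => f (p.1, p.2.1, r, p.2.2.2)) (dT f p) p.2.2.1 :=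
  dT_eq_fderiv hf ▸ hasDerivAt_lineT hf

lemma hasDerivAt_dU (hf : DifferentiableAt ℝ f p) :
    HasDerivAt (fun r => f (p.1, p.2.1, p.2.2.1, r)) (dU f p) p.2.2.2 :=
  dU_eq_fderiv hf ▸ hasDerivAt_lineU hf

lemma fderiv_apply_eq_partials (hf : DifferentiableAt ℝ f p) (w : Pt) :
    fderiv ℝ f p w = w.1 * dX f p + w.2.1 * dY f p + w.2.2.1 * dT f p + w.2.2.2 * dU f p := by
  have hw : w = w.1 • ((1, 0, 0, 0) : Pt) + w.2.1 • ((0, 1, 0, 0) : Pt)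
      + w.2.2.1 • ((0, 0, 1, 0) : Pt) + w.2.2.2 • ((0, 0, 0, 1) : Pt) := by
    ext <;> simp
  rw [dX_eq_fderiv hf, dY_eq_fderiv hf, dT_eq_fderiv hf, dU_eq_fderiv hf]
  conv_lhs => rw [hw]
  simp only [map_add, map_smul, smul_eq_mul]

end lines

lemma Smooth.fderiv_apply {f : Pt → ℝ} (hf : Smooth f) (w : Pt) :
    Smooth fun p => fderiv ℝ f p w :=
  (ContDiffOn.fderiv_of_isOpen hf isOpen_domain (m := ∞) (by simp)).clm_apply contDiffOn_const

lemma Smooth.partialX {f : Pt → ℝ} (hf : Smooth f) : Smooth (dX f) :=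
  (hf.fderiv_apply _).congr fun _ hp => dX_eq_fderiv (hf.differentiableAt hp)

lemma Smooth.partialY {f : Pt → ℝ} (hf : Smooth f) : Smooth (dY f) :=
  (hf.fderiv_apply _).congr fun _ hp => dY_eq_fderiv (hf.differentiableAt hp)

lemma Smooth.partialU {f : Pt → ℝ} (hf : Smooth f) : Smooth (dU f) :=
  (hf.fderiv_apply _).congr fun _ hp => dU_eq_fderiv (hf.differentiableAt hp)

lemma dX_congr {f g : Pt → ℝ} (hfg : EqOn f g domain) : EqOn (dX f) (dX g) domain := by
  intro p hp
  refine EventuallyEq.deriv_eq ?_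
  have hc : ContinuousAt (fun r : ℝ => ((r, p.2) : Pt)) p.1 := by fun_prop
  filter_upwards [hc.preimage_mem_nhds (domain_mem_nhds hp)] with r hr using hfg hr

lemma dY_congr {f g : Pt → ℝ} (hfg : EqOn f g domain) : EqOn (dY f) (dY g) domain := by
  intro p hp
  refine EventuallyEq.deriv_eq ?_
  have hc : ContinuousAt (fun r : ℝ => ((p.1, r, p.2.2) : Pt)) p.2.1 := by fun_prop
  filter_upwards [hc.preimage_mem_nhds (domain_mem_nhds hp)] with r hr using hfg hr

lemma dT_congr {f g : Pt → ℝ} (hfg : EqOn f g domain) : EqOn (dT f) (dT g) domain := fun p hp =>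
  congrArg (fun F : ℝ → ℝ => deriv F p.2.2.1)
    (funext fun r => hfg (show (p.1, p.2.1, r, p.2.2.2) ∈ domain from hp))

lemma dU_congr {f g : Pt → ℝ} (hfg : EqOn f g domain) : EqOn (dU f) (dU g) domain := fun p hp =>
  congrArg (fun F : ℝ → ℝ => deriv F p.2.2.2)
    (funext fun r => hfg (show (p.1, p.2.1, p.2.2.1, r) ∈ domain from hp))

section schwarz

variable {f : Pt → ℝ} {p : Pt}

/-- Symmetry of the second derivative. -/
lemma Smooth.fderiv_fderiv_comm (hf : Smooth f) (hp : p ∈ domain) (v w : Pt) :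
    fderiv ℝ (fun q => fderiv ℝ f q v) p w = fderiv ℝ (fun q => fderiv ℝ f q w) p v := by
  have hd : DifferentiableAt ℝ (fderiv ℝ f) p :=
    ((ContDiffOn.fderiv_of_isOpen hf isOpen_domain (m := ∞) (by simp)).contDiffAt
      (domain_mem_nhds hp)).differentiableAt (by simp)
  have h := ((hf.contDiffAt hp).isSymmSndFDerivAt (by
    simpa using WithTop.coe_le_coe.2 (le_top (a := (2 : ℕ∞))))).eq w v
  rw [fderiv_clm_apply hd (differentiableAt_const v),
    fderiv_clm_apply hd (differentiableAt_const w)]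
  simpa using h

lemma Smooth.dU_dX (hf : Smooth f) (hp : p ∈ domain) : dU (dX f) p
    = dX (dU f) p := by
  rw [dU_congr (fun q hq => dX_eq_fderiv (hf.differentiableAt hq)) hp,
    dX_congr (fun q hq => dU_eq_fderiv (hf.differentiableAt hq)) hp,
    dU_eq_fderiv ((hf.fderiv_apply _).differentiableAt hp),
    dX_eq_fderiv ((hf.fderiv_apply _).differentiableAt hp), hf.fderiv_fderiv_comm hp]

lemma Smooth.dU_dY (hf : Smooth f) (hp : p ∈ domain) : dU (dY f) p
    = dY (dU f) p := by
  rw [dU_congr (fun q hq => dY_eq_fderiv (hf.differentiableAt hq)) hp,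
    dY_congr (fun q hq => dU_eq_fderiv (hf.differentiableAt hq)) hp,
    dU_eq_fderiv ((hf.fderiv_apply _).differentiableAt hp),
    dY_eq_fderiv ((hf.fderiv_apply _).differentiableAt hp), hf.fderiv_fderiv_comm hp]

end schwarz

/-! ### Total derivatives on the jet space -/

namespace Jet

/-- The thirteen coordinates on the jets of order at most two. -/
inductive Coord
  | x | y | t | u | ux | uy | ut | uxx | uxy | uxt | uyy | uyt | utt

/-- The value of a coordinate at a jet. -/
def get (j : Jet) : Coord → ℝ
  | .x => j.x | .y => j.y | .t => j.t | .u => j.u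
  | .ux => j.ux | .uy => j.uy | .ut => j.ut
  | .uxx => j.uxx | .uxy => j.uxy | .uxt => j.uxt
  | .uyy => j.uyy | .uyt => j.uyt | .utt => j.utt

/-- The jet with one coordinate replaced. -/
def update (j : Jet) (r : ℝ) : Coord → Jet
  | .x => { j with x := r } | .y => { j with y := r } | .t => { j with t := r }
  | .u => { j with u := r } | .ux => { j with ux := r } | .uy => { j with uy := r }
  | .ut => { j with ut := r } | .uxx => { j with uxx := r } | .uxy => { j with uxy := r }
  | .uxt => { j with uxt := r } | .uyy => { j with uyy := r } | .uyt => { j with uyt := r }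
  | .utt => { j with utt := r }

@[simp] lemma update_get (j : Jet) (c : Coord) : j.update (j.get c) c = j := by
  cases c <;> rfl

/-- The function `P` of the second order jets has partial derivatives `D` at `j`. -/
def HasPartials (P : Jet → ℝ) (D : Coord → ℝ) (j : Jet) : Prop :=
  ∀ c, HasDerivAt (fun r => P (j.update r c)) (D c) (j.get c)

/-- `P` has partial derivatives at `j`, and `X, Y, T` are the values of its three total
derivatives there. -/
def HasTotal (P : Jet → ℝ) (X Y T : ℝ) (j : Jet) : Prop :=
  (∃ D, HasPartials P D j) ∧ totalX P j = X ∧ totalY P j = Y ∧ totalT P j = T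

variable {P Q : Jet → ℝ} {j : Jet} {D E : Coord → ℝ} {X Y T X' Y' T' : ℝ}

lemma HasPartials.totalX_eq (h : HasPartials P D j) : totalX P j =
    D .x + j.ux * D .u + j.uxx * D .ux + j.uxy * D .uy + j.uxt * D .ut
      + j.uxxx * D .uxx + j.uxxy * D .uxy + j.uxxt * D .uxt
      + j.uxyy * D .uyy + j.uxyt * D .uyt + j.uxtt * D .utt := by
  simp only [← fun c => (h c).deriv]; rfl

lemma HasPartials.totalY_eq (h : HasPartials P D j) : totalY P j =
    D .y + j.uy * D .u + j.uxy * D .ux + j.uyy * D .uy + j.uyt * D .ut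
      + j.uxxy * D .uxx + j.uxyy * D .uxy + j.uxyt * D .uxt
      + j.uyyy * D .uyy + j.uyyt * D .uyt + j.uytt * D .utt := by
  simp only [← fun c => (h c).deriv]; rfl

lemma HasPartials.totalT_eq (h : HasPartials P D j) : totalT P j =
    D .t + j.ut * D .u + j.uxt * D .ux + j.uyt * D .uy + j.utt * D .ut
      + j.uxxt * D .uxx + j.uxyt * D .uxy + j.uxtt * D .uxt
      + j.uyyt * D .uyy + j.uytt * D .uyt + j.uttt * D .utt := by
  simp only [← fun c => (h c).deriv]; rfl

lemma HasTotal.add (hP : HasTotal P X Y T j) (hQ : HasTotal Q X' Y' T' j) :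
    HasTotal (fun j => P j + Q j) (X + X') (Y + Y') (T + T') j := by
  obtain ⟨⟨D, hD⟩, rfl, rfl, rfl⟩ := hP
  obtain ⟨⟨E, hE⟩, rfl, rfl, rfl⟩ := hQ
  have h : HasPartials (fun j => P j + Q j) (fun c => D c + E c) j := fun c => (hD c).add (hE c)
  refine ⟨⟨_, h⟩, ?_, ?_, ?_⟩
  · rw [h.totalX_eq, hD.totalX_eq, hE.totalX_eq]; ring
  · rw [h.totalY_eq, hD.totalY_eq, hE.totalY_eq]; ring
  · rw [h.totalT_eq, hD.totalT_eq, hE.totalT_eq]; ring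

lemma HasTotal.sub (hP : HasTotal P X Y T j) (hQ : HasTotal Q X' Y' T' j) :
    HasTotal (fun j => P j - Q j) (X - X') (Y - Y') (T - T') j := by
  obtain ⟨⟨D, hD⟩, rfl, rfl, rfl⟩ := hP
  obtain ⟨⟨E, hE⟩, rfl, rfl, rfl⟩ := hQ
  have h : HasPartials (fun j => P j - Q j) (fun c => D c - E c) j := fun c => (hD c).sub (hE c)
  refine ⟨⟨_, h⟩, ?_, ?_, ?_⟩
  · rw [h.totalX_eq, hD.totalX_eq, hE.totalX_eq]; ring
  · rw [h.totalY_eq, hD.totalY_eq, hE.totalY_eq]; ring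
  · rw [h.totalT_eq, hD.totalT_eq, hE.totalT_eq]; ring

lemma HasTotal.mul (hP : HasTotal P X Y T j) (hQ : HasTotal Q X' Y' T' j) :
    HasTotal (fun j => P j * Q j) (X * Q j + P j * X') (Y * Q j + P j * Y')
      (T * Q j + P j * T') j := by
  obtain ⟨⟨D, hD⟩, rfl, rfl, rfl⟩ := hP
  obtain ⟨⟨E, hE⟩, rfl, rfl, rfl⟩ := hQ
  have h : HasPartials (fun j => P j * Q j) (fun c => D c * Q j + P j * E c) j := fun c => by
    have := (hD c).mul (hE c)
    simp only [update_get] at this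
    exact this
  refine ⟨⟨_, h⟩, ?_, ?_, ?_⟩
  · rw [h.totalX_eq, hD.totalX_eq, hE.totalX_eq]; ring
  · rw [h.totalY_eq, hD.totalY_eq, hE.totalY_eq]; ring
  · rw [h.totalT_eq, hD.totalT_eq, hE.totalT_eq]; ring

open Classical in
lemma hasPartials_get (c₀ : Coord) :
    HasPartials (fun j => j.get c₀) (fun c => if c = c₀ then 1 else 0) j := by
  intro c
  cases c <;> cases c₀ <;> simp [update, get, hasDerivAt_id', hasDerivAt_const]

lemma hasTotal_ux : HasTotal (fun j => j.ux) j.uxx j.uxy j.uxt j := by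
  have h := hasPartials_get (j := j) .ux
  exact ⟨⟨_, h⟩, h.totalX_eq.trans (by simp), h.totalY_eq.trans (by simp),
    h.totalT_eq.trans (by simp)⟩

lemma hasTotal_uy : HasTotal (fun j => j.uy) j.uxy j.uyy j.uyt j := by
  have h := hasPartials_get (j := j) .uy
  exact ⟨⟨_, h⟩, h.totalX_eq.trans (by simp), h.totalY_eq.trans (by simp),
    h.totalT_eq.trans (by simp)⟩

lemma hasTotal_ut : HasTotal (fun j => j.ut) j.uxt j.uyt j.utt j := by
  have h := hasPartials_get (j := j) .ut
  exact ⟨⟨_, h⟩, h.totalX_eq.trans (by simp), h.totalY_eq.trans (by simp),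
    h.totalT_eq.trans (by simp)⟩

lemma hasTotal_uxx : HasTotal (fun j => j.uxx) j.uxxx j.uxxy j.uxxt j := by
  have h := hasPartials_get (j := j) .uxx
  exact ⟨⟨_, h⟩, h.totalX_eq.trans (by simp), h.totalY_eq.trans (by simp),
    h.totalT_eq.trans (by simp)⟩

lemma hasTotal_uxy : HasTotal (fun j => j.uxy) j.uxxy j.uxyy j.uxyt j := by
  have h := hasPartials_get (j := j) .uxy
  exact ⟨⟨_, h⟩, h.totalX_eq.trans (by simp), h.totalY_eq.trans (by simp),
    h.totalT_eq.trans (by simp)⟩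

lemma hasTotal_uxt : HasTotal (fun j => j.uxt) j.uxxt j.uxyt j.uxtt j := by
  have h := hasPartials_get (j := j) .uxt
  exact ⟨⟨_, h⟩, h.totalX_eq.trans (by simp), h.totalY_eq.trans (by simp),
    h.totalT_eq.trans (by simp)⟩

lemma hasTotal_uyy : HasTotal (fun j => j.uyy) j.uxyy j.uyyy j.uyyt j := by
  have h := hasPartials_get (j := j) .uyy
  exact ⟨⟨_, h⟩, h.totalX_eq.trans (by simp), h.totalY_eq.trans (by simp),
    h.totalT_eq.trans (by simp)⟩

lemma hasTotal_uyt : HasTotal (fun j => j.uyt) j.uxyt j.uyyt j.uytt j := by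
  have h := hasPartials_get (j := j) .uyt
  exact ⟨⟨_, h⟩, h.totalX_eq.trans (by simp), h.totalY_eq.trans (by simp),
    h.totalT_eq.trans (by simp)⟩

/-- The total derivatives of a function of `(x, y, t, u)`. -/
lemma hasTotal_comp_pt {f : Pt → ℝ} (hf : DifferentiableAt ℝ f j.pt) :
    HasTotal (fun j => f j.pt) (dX f j.pt + j.ux * dU f j.pt) (dY f j.pt + j.uy * dU f j.pt)
      (dT f j.pt + j.ut * dU f j.pt) j := by
  have h : HasPartials (fun j => f j.pt) (fun c => match c with
      | .x => dX f j.pt | .y => dY f j.pt | .t => dT f j.pt | .u => dU f j.pt | _ => 0) j := by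
    intro c
    cases c
    case x => exact hasDerivAt_dX hf
    case y => exact hasDerivAt_dY hf
    case t => exact hasDerivAt_dT hf
    case u => exact hasDerivAt_dU hf
    all_goals exact hasDerivAt_const (F := ℝ) _ (f j.pt)
  exact ⟨⟨_, h⟩, h.totalX_eq.trans (by simp), h.totalY_eq.trans (by simp),
    h.totalT_eq.trans (by simp)⟩

/-- Partial derivatives at a jet over the domain depend only on the jets over the domain. -/
lemma deriv_update_congr (h : ∀ j, j.pt ∈ domain → P j = Q j) (hj : j.pt ∈ domain) (c : Coord) :
    deriv (fun r => P (j.update r c)) (j.get c) = deriv (fun r => Q (j.update r c)) (j.get c) := by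
  refine EventuallyEq.deriv_eq ?_
  have hc : ContinuousAt (fun r => (j.update r c).pt) (j.get c) := by
    cases c <;> simp only [update, pt] <;> fun_prop
  filter_upwards [hc.preimage_mem_nhds (domain_mem_nhds (by simpa using hj))] with r hr
  exact h _ hr

lemma totalX_congr (h : ∀ j, j.pt ∈ domain → P j = Q j) (hj : j.pt ∈ domain) :
    totalX P j = totalX Q j := by
  have h' := deriv_update_congr h hj
  have e : ∀ R : Jet → ℝ, totalX R j = _ := fun R => show totalX R j =
    deriv (fun r => R (j.update r .x)) (j.get .x)
    + j.ux * deriv (fun r => R (j.update r .u)) (j.get .u)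
    + j.uxx * deriv (fun r => R (j.update r .ux)) (j.get .ux)
    + j.uxy * deriv (fun r => R (j.update r .uy)) (j.get .uy)
    + j.uxt * deriv (fun r => R (j.update r .ut)) (j.get .ut)
    + j.uxxx * deriv (fun r => R (j.update r .uxx)) (j.get .uxx)
    + j.uxxy * deriv (fun r => R (j.update r .uxy)) (j.get .uxy)
    + j.uxxt * deriv (fun r => R (j.update r .uxt)) (j.get .uxt)
    + j.uxyy * deriv (fun r => R (j.update r .uyy)) (j.get .uyy)
    + j.uxyt * deriv (fun r => R (j.update r .uyt)) (j.get .uyt)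
    + j.uxtt * deriv (fun r => R (j.update r .utt)) (j.get .utt) from rfl
  rw [e, e]; simp only [h']

lemma totalY_congr (h : ∀ j, j.pt ∈ domain → P j = Q j) (hj : j.pt ∈ domain) :
    totalY P j = totalY Q j := by
  have h' := deriv_update_congr h hj
  have e : ∀ R : Jet → ℝ, totalY R j = _ := fun R => show totalY R j =
    deriv (fun r => R (j.update r .y)) (j.get .y)
    + j.uy * deriv (fun r => R (j.update r .u)) (j.get .u)
    + j.uxy * deriv (fun r => R (j.update r .ux)) (j.get .ux)
    + j.uyy * deriv (fun r => R (j.update r .uy)) (j.get .uy)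
    + j.uyt * deriv (fun r => R (j.update r .ut)) (j.get .ut)
    + j.uxxy * deriv (fun r => R (j.update r .uxx)) (j.get .uxx)
    + j.uxyy * deriv (fun r => R (j.update r .uxy)) (j.get .uxy)
    + j.uxyt * deriv (fun r => R (j.update r .uxt)) (j.get .uxt)
    + j.uyyy * deriv (fun r => R (j.update r .uyy)) (j.get .uyy)
    + j.uyyt * deriv (fun r => R (j.update r .uyt)) (j.get .uyt)
    + j.uytt * deriv (fun r => R (j.update r .utt)) (j.get .utt) from rfl
  rw [e, e]; simp only [h']

end Jet

open Jet

/-! ### The invariance condition in explicit form -/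

/-- The coefficient of `∂_x`, as a function of `(x, y, t, u)`. -/
def cξ (v : Field) (p : Pt) : ℝ := (v p).1

/-- The coefficient of `∂_y`, as a function of `(x, y, t, u)`. -/
def cγ (v : Field) (p : Pt) : ℝ := (v p).2.1

/-- The coefficient of `∂_t`, as a function of `(x, y, t, u)`. -/
def cτ (v : Field) (p : Pt) : ℝ := (v p).2.2.1

/-- The coefficient of `∂_u`, as a function of `(x, y, t, u)`. -/
def cφ (v : Field) (p : Pt) : ℝ := (v p).2.2.2

/-- All four components are smooth on the domain. -/
structure SmoothComponents (v : Field) : Prop where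
  ξ : Smooth (cξ v)
  γ : Smooth (cγ v)
  τ : Smooth (cτ v)
  φ : Smooth (cφ v)

lemma contDiffOn_iff_smoothComponents (v : Field) :
    ContDiffOn ℝ ∞ v domain ↔ SmoothComponents v :=
  ⟨fun h => ⟨h.fst, h.snd.fst, h.snd.snd.fst, h.snd.snd.snd⟩,
    fun h => h.ξ.prodMk (h.γ.prodMk (h.τ.prodMk h.φ))⟩

section prolongation

variable {v : Field} {j : Jet}

lemma hasTotal_charac (hv : SmoothComponents v) (hj : j.pt ∈ domain) :
    HasTotal (charac v)
      (dX (cφ v) j.pt + j.ux * dU (cφ v) j.pt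
        - ((dX (cξ v) j.pt + j.ux * dU (cξ v) j.pt) * j.ux + cξ v j.pt * j.uxx)
        - ((dX (cγ v) j.pt + j.ux * dU (cγ v) j.pt) * j.uy + cγ v j.pt * j.uxy)
        - ((dX (cτ v) j.pt + j.ux * dU (cτ v) j.pt) * j.ut + cτ v j.pt * j.uxt))
      (dY (cφ v) j.pt + j.uy * dU (cφ v) j.pt
        - ((dY (cξ v) j.pt + j.uy * dU (cξ v) j.pt) * j.ux + cξ v j.pt * j.uxy)
        - ((dY (cγ v) j.pt + j.uy * dU (cγ v) j.pt) * j.uy + cγ v j.pt * j.uyy)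
        - ((dY (cτ v) j.pt + j.uy * dU (cτ v) j.pt) * j.ut + cτ v j.pt * j.uyt))
      (dT (cφ v) j.pt + j.ut * dU (cφ v) j.pt
        - ((dT (cξ v) j.pt + j.ut * dU (cξ v) j.pt) * j.ux + cξ v j.pt * j.uxt)
        - ((dT (cγ v) j.pt + j.ut * dU (cγ v) j.pt) * j.uy + cγ v j.pt * j.uyt)
        - ((dT (cτ v) j.pt + j.ut * dU (cτ v) j.pt) * j.ut + cτ v j.pt * j.utt)) j :=
  (((hasTotal_comp_pt (hv.φ.differentiableAt hj)).sub
    ((hasTotal_comp_pt (hv.ξ.differentiableAt hj)).mul hasTotal_ux)).sub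
    ((hasTotal_comp_pt (hv.γ.differentiableAt hj)).mul hasTotal_uy)).sub
    ((hasTotal_comp_pt (hv.τ.differentiableAt hj)).mul hasTotal_ut)

lemma totalX_totalX_charac (hv : SmoothComponents v) (hj : j.pt ∈ domain) :
    totalX (totalX (charac v)) j =
      dX (dX (cφ v)) j.pt + 2 * j.ux * dX (dU (cφ v)) j.pt + j.ux ^ 2 * dU (dU (cφ v)) j.pt
        + j.uxx * dU (cφ v) j.pt
      - (dX (dX (cξ v)) j.pt + 2 * j.ux * dX (dU (cξ v)) j.pt + j.ux ^ 2 * dU (dU (cξ v)) j.pt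
        + j.uxx * dU (cξ v) j.pt) * j.ux
      - 2 * (dX (cξ v) j.pt + j.ux * dU (cξ v) j.pt) * j.uxx - cξ v j.pt * j.uxxx
      - (dX (dX (cγ v)) j.pt + 2 * j.ux * dX (dU (cγ v)) j.pt + j.ux ^ 2 * dU (dU (cγ v)) j.pt
        + j.uxx * dU (cγ v) j.pt) * j.uy
      - 2 * (dX (cγ v) j.pt + j.ux * dU (cγ v) j.pt) * j.uxy - cγ v j.pt * j.uxxy
      - (dX (dX (cτ v)) j.pt + 2 * j.ux * dX (dU (cτ v)) j.pt + j.ux ^ 2 * dU (dU (cτ v)) j.pt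
        + j.uxx * dU (cτ v) j.pt) * j.ut
      - 2 * (dX (cτ v) j.pt + j.ux * dU (cτ v) j.pt) * j.uxt - cτ v j.pt * j.uxxt := by
  rw [totalX_congr (fun i hi => (hasTotal_charac hv hi).2.1) hj]
  have h0 : ∀ f, Smooth f → HasTotal (fun j => f j.pt) _ _ _ j := fun f hf =>
    hasTotal_comp_pt (hf.differentiableAt hj)
  have h1 : ∀ f, Smooth f → HasTotal (fun j => dX f j.pt + j.ux * dU f j.pt) _ _ _ j :=
    fun f hf => (h0 _ hf.partialX).add (hasTotal_ux.mul (h0 _ hf.partialU))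
  have h := ((((h1 _ hv.φ).sub (((h1 _ hv.ξ).mul hasTotal_ux).add
    ((h0 _ hv.ξ).mul hasTotal_uxx))).sub (((h1 _ hv.γ).mul hasTotal_uy).add
    ((h0 _ hv.γ).mul hasTotal_uxy))).sub (((h1 _ hv.τ).mul hasTotal_ut).add
    ((h0 _ hv.τ).mul hasTotal_uxt))).2.1
  refine h.trans ?_
  rw [hv.φ.dU_dX hj, hv.ξ.dU_dX hj, hv.γ.dU_dX hj, hv.τ.dU_dX hj]
  ring

lemma totalY_totalY_charac (hv : SmoothComponents v) (hj : j.pt ∈ domain) :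
    totalY (totalY (charac v)) j =
      dY (dY (cφ v)) j.pt + 2 * j.uy * dY (dU (cφ v)) j.pt + j.uy ^ 2 * dU (dU (cφ v)) j.pt
        + j.uyy * dU (cφ v) j.pt
      - (dY (dY (cξ v)) j.pt + 2 * j.uy * dY (dU (cξ v)) j.pt + j.uy ^ 2 * dU (dU (cξ v)) j.pt
        + j.uyy * dU (cξ v) j.pt) * j.ux
      - 2 * (dY (cξ v) j.pt + j.uy * dU (cξ v) j.pt) * j.uxy - cξ v j.pt * j.uxyy
      - (dY (dY (cγ v)) j.pt + 2 * j.uy * dY (dU (cγ v)) j.pt + j.uy ^ 2 * dU (dU (cγ v)) j.pt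
        + j.uyy * dU (cγ v) j.pt) * j.uy
      - 2 * (dY (cγ v) j.pt + j.uy * dU (cγ v) j.pt) * j.uyy - cγ v j.pt * j.uyyy
      - (dY (dY (cτ v)) j.pt + 2 * j.uy * dY (dU (cτ v)) j.pt + j.uy ^ 2 * dU (dU (cτ v)) j.pt
        + j.uyy * dU (cτ v) j.pt) * j.ut
      - 2 * (dY (cτ v) j.pt + j.uy * dU (cτ v) j.pt) * j.uyt - cτ v j.pt * j.uyyt := by
  rw [totalY_congr (fun i hi => (hasTotal_charac hv hi).2.2.1) hj]
  have h0 : ∀ f, Smooth f → HasTotal (fun j => f j.pt) _ _ _ j := fun f hf =>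
    hasTotal_comp_pt (hf.differentiableAt hj)
  have h1 : ∀ f, Smooth f → HasTotal (fun j => dY f j.pt + j.uy * dU f j.pt) _ _ _ j :=
    fun f hf => (h0 _ hf.partialY).add (hasTotal_uy.mul (h0 _ hf.partialU))
  have h := ((((h1 _ hv.φ).sub (((h1 _ hv.ξ).mul hasTotal_ux).add
    ((h0 _ hv.ξ).mul hasTotal_uxy))).sub (((h1 _ hv.γ).mul hasTotal_uy).add
    ((h0 _ hv.γ).mul hasTotal_uyy))).sub (((h1 _ hv.τ).mul hasTotal_ut).add
    ((h0 _ hv.τ).mul hasTotal_uyt))).2.2.1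
  refine h.trans ?_
  rw [hv.φ.dU_dY hj, hv.ξ.dU_dY hj, hv.γ.dU_dY hj, hv.τ.dU_dY hj]
  ring

/-- The second prolongation of `v` applied to `Δ`; only five coefficients of the prolongation
enter. -/
lemma prolong_Delta (a b d e : ℝ) (v : Field) (j : Jet) :
    prolong v (Delta a b d e) j =
      cξ v j.pt * (j.uxx / 2 - b * j.ux) + cγ v j.pt * (j.uyy / 2 - e * j.uy)
        + phiX v j * (a - b * j.x) + phiY v j * (d - e * j.y) + phiT v j
        + j.x / 2 * phiXX v j + j.y / 2 * phiYY v j := by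
  have key : ∀ (F : ℝ → ℝ) (B K r₀ : ℝ), (∀ r, F r = B * r + K) → deriv F r₀ = B := by
    intro F B K r₀ h
    rw [funext h]
    simp
  have hx : pdx (Delta a b d e) j = j.uxx / 2 - b * j.ux :=
    key _ _ (a * j.ux + (d - e * j.y) * j.uy + j.y / 2 * j.uyy + j.ut) _ fun r => by
      simp only [Delta]; ring
  have hy : pdy (Delta a b d e) j = j.uyy / 2 - e * j.uy :=
    key _ _ ((a - b * j.x) * j.ux + d * j.uy + j.x / 2 * j.uxx + j.ut) _ fun r => by
      simp only [Delta]; ring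
  have ht : pdt (Delta a b d e) j = 0 := deriv_const _ (Delta a b d e j)
  have hu : pdu (Delta a b d e) j = 0 := deriv_const _ (Delta a b d e j)
  have hux : pdux (Delta a b d e) j = a - b * j.x := by simp [pdux, Delta]
  have huy : pduy (Delta a b d e) j = d - e * j.y := by simp [pduy, Delta]
  have hut : pdut (Delta a b d e) j = 1 := by simp [pdut, Delta]
  have huxx : pduxx (Delta a b d e) j = j.x / 2 := by simp [pduxx, Delta]
  have huyy : pduyy (Delta a b d e) j = j.y / 2 := by simp [pduyy, Delta]
  have huxy : pduxy (Delta a b d e) j = 0 := deriv_const _ (Delta a b d e j)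
  have huxt : pduxt (Delta a b d e) j = 0 := deriv_const _ (Delta a b d e j)
  have huyt : pduyt (Delta a b d e) j = 0 := deriv_const _ (Delta a b d e j)
  have hutt : pdutt (Delta a b d e) j = 0 := deriv_const _ (Delta a b d e j)
  rw [prolong, hx, hy, ht, hu, hux, huy, hut, huxx, huyy, huxy, huxt, huyt, hutt]
  change cξ v j.pt * _ + cγ v j.pt * _ + _ + _ + _ + _ + _ + _ + _ + _ + _ + _ + _ = _
  ring

end prolongation

/-! ### The determining equations -/

/-- The equations on the coefficients of `v` which result from splitting the invariance condition
by the monomials in the derivatives of `u`. -/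
structure DeterminingEquations (a b d e : ℝ) (v : Field) : Prop where
  τ_x : EqOn (dX (cτ v)) 0 domain
  τ_y : EqOn (dY (cτ v)) 0 domain
  τ_u : EqOn (dU (cτ v)) 0 domain
  ξ_u : EqOn (dU (cξ v)) 0 domain
  γ_u : EqOn (dU (cγ v)) 0 domain
  φ_uu : EqOn (dU (dU (cφ v))) 0 domain
  uxy_eq : ∀ p ∈ domain, p.1 * dX (cγ v) p + p.2.1 * dY (cξ v) p = 0
  uxx_eq : ∀ p ∈ domain, cξ v p - 2 * p.1 * dX (cξ v) p + p.1 * dT (cτ v) p = 0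
  uyy_eq : ∀ p ∈ domain, cγ v p - 2 * p.2.1 * dY (cγ v) p + p.2.1 * dT (cτ v) p = 0
  ux_eq : ∀ p ∈ domain, -b * cξ v p + (a - b * p.1) * (dT (cτ v) p - dX (cξ v) p)
    + p.1 * dX (dU (cφ v)) p - p.1 / 2 * dX (dX (cξ v)) p - dT (cξ v) p
    - (d - e * p.2.1) * dY (cξ v) p - p.2.1 / 2 * dY (dY (cξ v)) p = 0
  uy_eq : ∀ p ∈ domain, -e * cγ v p + (d - e * p.2.1) * (dT (cτ v) p - dY (cγ v) p)
    + p.2.1 * dY (dU (cφ v)) p - p.2.1 / 2 * dY (dY (cγ v)) p - dT (cγ v) p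
    - (a - b * p.1) * dX (cγ v) p - p.1 / 2 * dX (dX (cγ v)) p = 0
  one_eq : ∀ p ∈ domain, (a - b * p.1) * dX (cφ v) p + (d - e * p.2.1) * dY (cφ v) p
    + p.1 / 2 * dX (dX (cφ v)) p + p.2.1 / 2 * dY (dY (cφ v)) p + dT (cφ v) p = 0

lemma dX_eq_zero {f : Pt → ℝ} (h : EqOn f 0 domain) : EqOn (dX f) 0 domain :=
  (dX_congr h).trans fun _ _ => deriv_const _ (0 : ℝ)

lemma dY_eq_zero {f : Pt → ℝ} (h : EqOn f 0 domain) : EqOn (dY f) 0 domain :=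
  (dY_congr h).trans fun _ _ => deriv_const _ (0 : ℝ)

lemma dU_eq_zero {f : Pt → ℝ} (h : EqOn f 0 domain) : EqOn (dU f) 0 domain :=
  (dU_congr h).trans fun _ _ => deriv_const _ (0 : ℝ)

section

variable {a b d e : ℝ} {v : Field}

/-- Once `τ` depends on `t` only and `ξ, γ` do not depend on `u`, the invariance condition is a
combination of few monomials. -/
lemma prolong_Delta_reduced (hv : SmoothComponents v)
    (τ_x : EqOn (dX (cτ v)) 0 domain) (τ_y : EqOn (dY (cτ v)) 0 domain)
    (τ_u : EqOn (dU (cτ v)) 0 domain) (ξ_u : EqOn (dU (cξ v)) 0 domain)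
    (γ_u : EqOn (dU (cγ v)) 0 domain) {j : Jet} (hj : j.pt ∈ domain)
    (hΔ : Delta a b d e j = 0) :
    prolong v (Delta a b d e) j =
      (j.x * dX (cγ v) j.pt + j.y * dY (cξ v) j.pt) * (-j.uxy)
      + (cξ v j.pt - 2 * j.x * dX (cξ v) j.pt + j.x * dT (cτ v) j.pt) * (j.uxx / 2)
      + (cγ v j.pt - 2 * j.y * dY (cγ v) j.pt + j.y * dT (cτ v) j.pt) * (j.uyy / 2)
      + dU (dU (cφ v)) j.pt * (j.x / 2 * j.ux ^ 2 + j.y / 2 * j.uy ^ 2)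
      + (-b * cξ v j.pt + (a - b * j.x) * (dT (cτ v) j.pt - dX (cξ v) j.pt)
          + j.x * dX (dU (cφ v)) j.pt - j.x / 2 * dX (dX (cξ v)) j.pt - dT (cξ v) j.pt
          - (d - e * j.y) * dY (cξ v) j.pt - j.y / 2 * dY (dY (cξ v)) j.pt) * j.ux
      + (-e * cγ v j.pt + (d - e * j.y) * (dT (cτ v) j.pt - dY (cγ v) j.pt)
          + j.y * dY (dU (cφ v)) j.pt - j.y / 2 * dY (dY (cγ v)) j.pt - dT (cγ v) j.pt
          - (a - b * j.x) * dX (cγ v) j.pt - j.x / 2 * dX (dX (cγ v)) j.pt) * j.uy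
      + ((a - b * j.x) * dX (cφ v) j.pt + (d - e * j.y) * dY (cφ v) j.pt
          + j.x / 2 * dX (dX (cφ v)) j.pt + j.y / 2 * dY (dY (cφ v)) j.pt + dT (cφ v) j.pt) := by
  rw [prolong_Delta, phiX, phiY, phiT, phiXX, phiYY, (hasTotal_charac hv hj).2.1,
    (hasTotal_charac hv hj).2.2.1, (hasTotal_charac hv hj).2.2.2, totalX_totalX_charac hv hj,
    totalY_totalY_charac hv hj, τ_x hj, τ_y hj, τ_u hj, ξ_u hj, γ_u hj,
    dX_eq_zero τ_x hj, dX_eq_zero τ_u hj, dY_eq_zero τ_y hj, dY_eq_zero τ_u hj,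
    dU_eq_zero τ_u hj, dX_eq_zero ξ_u hj, dY_eq_zero ξ_u hj, dU_eq_zero ξ_u hj,
    dX_eq_zero γ_u hj, dY_eq_zero γ_u hj, dU_eq_zero γ_u hj]
  simp only [Pi.zero_apply]
  have hξ : xi v j = cξ v j.pt := rfl
  have hγ : gam v j = cγ v j.pt := rfl
  have hτ : tau v j = cτ v j.pt := rfl
  rw [hξ, hγ, hτ]
  rw [Delta] at hΔ
  linear_combination (dU (cφ v) j.pt - dT (cτ v) j.pt) * hΔ

/-- The jet over `p` which has the given derivatives, satisfies `Δ = 0` by the choice of `u_t`, and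
has all other coordinates `0`. -/
def solutionJet (a b d e : ℝ) (p : Pt) (ux uy uxx uxy uxt uyy uyt : ℝ) : Jet where
  x := p.1
  y := p.2.1
  t := p.2.2.1
  u := p.2.2.2
  ux := ux
  uy := uy
  ut := -((a - b * p.1) * ux + (d - e * p.2.1) * uy + p.1 / 2 * uxx + p.2.1 / 2 * uyy)
  uxx := uxx
  uxy := uxy
  uxt := uxt
  uyy := uyy
  uyt := uyt
  utt := 0
  uxxx := 0
  uxxy := 0
  uxxt := 0
  uxyy := 0
  uxyt := 0
  uxtt := 0
  uyyy := 0
  uyyt := 0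
  uytt := 0
  uttt := 0

lemma Delta_solutionJet (p : Pt) (ux uy uxx uxy uxt uyy uyt : ℝ) :
    Delta a b d e (solutionJet a b d e p ux uy uxx uxy uxt uyy uyt) = 0 := by
  simp only [Delta, solutionJet]; ring

/-- The mixed derivatives `u_xt, u_yt` force `τ` to depend on `t` only, and after that `u_xy`
forces `ξ` and `γ` not to depend on `u`. -/
lemma IsInfinitesimalSymmetry.first_equations (hs : IsInfinitesimalSymmetry a b d e v) :
    EqOn (dX (cτ v)) 0 domain ∧ EqOn (dY (cτ v)) 0 domain ∧ EqOn (dU (cτ v)) 0 domain ∧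
      EqOn (dU (cξ v)) 0 domain ∧ EqOn (dU (cγ v)) 0 domain := by
  have hv := (contDiffOn_iff_smoothComponents v).1 hs.smooth
  have hξ : ∀ j, xi v j = cξ v j.pt := fun _ => rfl
  have hγ : ∀ j, gam v j = cγ v j.pt := fun _ => rfl
  have hτ : ∀ j, tau v j = cτ v j.pt := fun _ => rfl
  have E : ∀ p ∈ domain, ∀ ux uy uxy uxt uyt : ℝ, _ := fun p hp ux uy uxy uxt uyt => by
    have hj : (solutionJet a b d e p ux uy 0 uxy uxt 0 uyt).pt ∈ domain := hp
    have h := hs.invariant _ hj (Delta_solutionJet p ux uy 0 uxy uxt 0 uyt)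
    rw [prolong_Delta, phiX, phiY, phiT, phiXX, phiYY, (hasTotal_charac hv hj).2.1,
      (hasTotal_charac hv hj).2.2.1, (hasTotal_charac hv hj).2.2.2, totalX_totalX_charac hv hj,
      totalY_totalY_charac hv hj, hξ, hγ, hτ] at h
    have hpt : (solutionJet a b d e p ux uy 0 uxy uxt 0 uyt).pt = p := rfl
    rw [hpt] at h
    simp only [solutionJet] at h
    exact h
  have hx0 : ∀ p ∈ domain, p.1 ≠ 0 := fun p hp => hp.1.ne'
  have hy0 : ∀ p ∈ domain, p.2.1 ≠ 0 := fun p hp => hp.2.ne'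
  have τx : EqOn (dX (cτ v)) 0 domain := fun p hp => by
    refine mul_left_cancel₀ (hx0 p hp) ?_
    simp only [Pi.zero_apply]
    linear_combination E p hp 0 0 0 0 0 - E p hp 0 0 0 1 0
  have τy : EqOn (dY (cτ v)) 0 domain := fun p hp => by
    refine mul_left_cancel₀ (hy0 p hp) ?_
    simp only [Pi.zero_apply]
    linear_combination E p hp 0 0 0 0 0 - E p hp 0 0 0 0 1
  have τu : EqOn (dU (cτ v)) 0 domain := fun p hp => by
    refine mul_left_cancel₀ (hx0 p hp) ?_
    have h := τx hp
    simp only [Pi.zero_apply] at h ⊢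
    linear_combination E p hp 1 0 0 0 0 - E p hp 1 0 0 1 0 - p.1 * h
  have hc : ∀ p ∈ domain, p.1 * dX (cγ v) p + p.2.1 * dY (cξ v) p = 0 := fun p hp => by
    linear_combination E p hp 0 0 0 0 0 - E p hp 0 0 1 0 0
  refine ⟨τx, τy, τu, fun p hp => ?_, fun p hp => ?_⟩
  · refine mul_left_cancel₀ (hy0 p hp) ?_
    simp only [Pi.zero_apply]
    linear_combination E p hp 0 1 0 0 0 - E p hp 0 1 1 0 0 - hc p hp
  · refine mul_left_cancel₀ (hx0 p hp) ?_
    simp only [Pi.zero_apply]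
    linear_combination E p hp 1 0 0 0 0 - E p hp 1 0 1 0 0 - hc p hp

/-- Infinitesimal invariance is equivalent to the determining equations. -/
lemma invariant_iff_determiningEquations (hv : SmoothComponents v)
    (h0 : ∀ p, p ∉ domain → v p = 0) :
    IsInfinitesimalSymmetry a b d e v ↔ DeterminingEquations a b d e v := by
  constructor
  · intro hs
    obtain ⟨τx, τy, τu, ξu, γu⟩ := hs.first_equations
    have E : ∀ p ∈ domain, ∀ ux uy uxx uxy uyy : ℝ, _ := fun p hp ux uy uxx uxy uyy => by
      have hj : (solutionJet a b d e p ux uy uxx uxy 0 uyy 0).pt ∈ domain := hp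
      have hΔ := Delta_solutionJet (a := a) (b := b) (d := d) (e := e) p ux uy uxx uxy 0 uyy 0
      have h := hs.invariant _ hj hΔ
      rw [prolong_Delta_reduced hv τx τy τu ξu γu hj hΔ] at h
      have hpt : (solutionJet a b d e p ux uy uxx uxy 0 uyy 0).pt = p := rfl
      rw [hpt] at h
      simp only [solutionJet] at h
      exact h
    have hφ : EqOn (dU (dU (cφ v))) 0 domain := fun p hp => by
      refine mul_left_cancel₀ hp.1.ne' ?_
      simp only [Pi.zero_apply]
      linear_combination E p hp 1 0 0 0 0 + E p hp (-1) 0 0 0 0 - 2 * E p hp 0 0 0 0 0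
    refine ⟨τx, τy, τu, ξu, γu, hφ, fun p hp => ?_, fun p hp => ?_, fun p hp => ?_, fun p hp => ?_,
      fun p hp => ?_, fun p hp => ?_⟩
    · linear_combination E p hp 0 0 0 0 0 - E p hp 0 0 0 1 0
    · linear_combination E p hp 0 0 2 0 0 - E p hp 0 0 0 0 0
    · linear_combination E p hp 0 0 0 0 2 - E p hp 0 0 0 0 0
    · linear_combination 1 / 2 * E p hp 1 0 0 0 0 - 1 / 2 * E p hp (-1) 0 0 0 0
    · linear_combination 1 / 2 * E p hp 0 1 0 0 0 - 1 / 2 * E p hp 0 (-1) 0 0 0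
    · linear_combination E p hp 0 0 0 0 0
  · intro h
    refine ⟨h0, (contDiffOn_iff_smoothComponents v).2 hv, fun j hj hΔ => ?_⟩
    rw [prolong_Delta_reduced hv h.τ_x h.τ_y h.τ_u h.ξ_u h.γ_u hj hΔ]
    have h1 := h.uxy_eq _ hj
    have h2 := h.uxx_eq _ hj
    have h3 := h.uyy_eq _ hj
    have h4 := h.φ_uu hj
    have h5 := h.ux_eq _ hj
    have h6 := h.uy_eq _ hj
    have h7 := h.one_eq _ hj
    simp only [Jet.pt, Pi.zero_apply] at h1 h2 h3 h4 h5 h6 h7 ⊢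
    rw [h1, h2, h3, h4, h5, h6, h7]
    ring

end

/-! ### Functions of one positive variable built from `√x` -/

lemma eqOn_Ioi_of_hasDerivAt {f g f' : ℝ → ℝ} (hf : ∀ x, 0 < x → HasDerivAt f (f' x) x)
    (hg : ∀ x, 0 < x → HasDerivAt g (f' x) x) {x x₀ : ℝ} (hx : 0 < x) (hx₀ : 0 < x₀) :
    f x - g x = f x₀ - g x₀ := by
  have h : ∀ x, 0 < x → HasDerivAt (fun x => f x - g x) 0 x := fun x hx => by
    simpa using (hf x hx).fun_sub (hg x hx)
  exact isOpen_Ioi.is_const_of_deriv_eq_zero isPreconnected_Ioi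
    (fun x hx => (h x hx).differentiableAt.differentiableWithinAt) (fun x hx => (h x hx).deriv)
    hx hx₀

section sqrt

variable (A B C D : ℝ) {x : ℝ}

lemma hasDerivAt_inv_sqrt (hx : 0 < x) : HasDerivAt (fun x => (√x)⁻¹) (-1 / (2 * x * √x)) x := by
  have hs := Real.sqrt_pos.2 hx
  refine ((Real.hasDerivAt_sqrt hx.ne').fun_inv hs.ne').congr_deriv ?_
  rw [Real.sq_sqrt hx.le]
  field_simp

lemma hasDerivAt_sqrtExpr (hx : 0 < x) :
    HasDerivAt (fun x => A * x + B * √x + C / √x + D)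
      (A + B / (2 * √x) - C / (2 * x * √x)) x := by
  have h := ((((hasDerivAt_id' x).const_mul A).add
    ((Real.hasDerivAt_sqrt hx.ne').const_mul B)).add
    ((hasDerivAt_inv_sqrt hx).const_mul C)).add_const D
  refine h.congr_deriv ?_
  have hs := Real.sqrt_pos.2 hx
  field_simp
  ring

lemma hasDerivAt_sqrtExpr_deriv (hx : 0 < x) :
    HasDerivAt (fun x => A + B / (2 * √x) - C / (2 * x * √x))
      (-B / (4 * x * √x) + 3 * C / (4 * x ^ 2 * √x)) x := by
  have hs := Real.sqrt_pos.2 hx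
  have h := (((hasDerivAt_inv_sqrt hx).const_mul (B / 2)).const_add A).sub
    (((hasDerivAt_inv hx.ne').mul (hasDerivAt_inv_sqrt hx)).const_mul (C / 2))
  refine (h.congr_deriv ?_).congr_of_eventuallyEq (Eventually.of_forall fun r => ?_)
  · field_simp
    ring
  · simp only [Pi.sub_apply, Pi.mul_apply, div_eq_mul_inv, mul_inv]
    ring

end sqrt

/-- The solutions of `f - 2 x f' + c x = 0` on `x > 0`. -/
lemma eq_of_sub_two_mul_deriv {f f' : ℝ → ℝ} {c : ℝ} (hf : ∀ x, 0 < x → HasDerivAt f (f' x) x)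
    (h : ∀ x, 0 < x → f x - 2 * x * f' x + x * c = 0) {x : ℝ} (hx : 0 < x) :
    f x = c * x + √x * (f 1 - c) := by
  have hd : ∀ x, 0 < x → HasDerivAt (fun x => f x * (√x)⁻¹) (c / (2 * √x)) x := fun x hx => by
    have hs := Real.sqrt_pos.2 hx
    refine ((hf x hx).mul (hasDerivAt_inv_sqrt hx)).congr_deriv ?_
    field_simp
    linear_combination -(h x hx)
  have hg : ∀ x, 0 < x → HasDerivAt (fun x => c * √x) (c / (2 * √x)) x := fun x hx =>
    ((Real.hasDerivAt_sqrt hx.ne').const_mul c).congr_deriv (by ring)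
  have := eqOn_Ioi_of_hasDerivAt hd hg hx one_pos
  have hs := Real.sqrt_pos.2 hx
  simp only [Real.sqrt_one, inv_one, mul_one] at this
  field_simp at this
  rw [Real.sq_sqrt hx.le] at this
  linear_combination this

/-- Integration of `A + B / (2√x) - C / (2x√x)` over `x > 0`. -/
lemma eq_of_hasDerivAt_sqrtExpr {f : ℝ → ℝ} {A B C : ℝ}
    (hf : ∀ x, 0 < x → HasDerivAt f (A + B / (2 * √x) - C / (2 * x * √x)) x) {x : ℝ} (hx : 0 < x) :
    f x = f 1 + A * (x - 1) + B * (√x - 1) + C * (1 / √x - 1) := by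
  have := eqOn_Ioi_of_hasDerivAt hf (fun x hx => hasDerivAt_sqrtExpr A B C 0 hx) hx one_pos
  simp only [Real.sqrt_one] at this
  linear_combination this

/-! ### Partial derivatives of functions built from square roots -/

section partials

variable {f : Pt → ℝ}

lemma partials_x_sqrtExpr (A B C D : ℝ × ℝ × ℝ → ℝ) (hf : ∀ p ∈ domain,
      f p = A p.2 * p.1 + B p.2 * √p.1 + C p.2 / √p.1 + D p.2) {p : Pt} (hp : p ∈ domain) :
    dX f p = A p.2 + B p.2 / (2 * √p.1) - C p.2 / (2 * p.1 * √p.1) ∧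
    dX (dX f) p = -B p.2 / (4 * p.1 * √p.1) + 3 * C p.2 / (4 * p.1 ^ 2 * √p.1) := by
  have h : EqOn (dX f) (fun p => A p.2 + B p.2 / (2 * √p.1) - C p.2 / (2 * p.1 * √p.1)) domain :=
    fun p hp => (dX_congr hf hp).trans
      (hasDerivAt_sqrtExpr (A p.2) (B p.2) (C p.2) (D p.2) hp.1).deriv
  exact ⟨h hp, (dX_congr h hp).trans
    (hasDerivAt_sqrtExpr_deriv (A p.2) (B p.2) (C p.2) hp.1).deriv⟩

lemma partials_y_sqrtExpr (A B C D : ℝ → ℝ × ℝ → ℝ) (hf : ∀ p ∈ domain,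
      f p = A p.1 p.2.2 * p.2.1 + B p.1 p.2.2 * √p.2.1 + C p.1 p.2.2 / √p.2.1 + D p.1 p.2.2)
    {p : Pt} (hp : p ∈ domain) :
    dY f p = A p.1 p.2.2 + B p.1 p.2.2 / (2 * √p.2.1) - C p.1 p.2.2 / (2 * p.2.1 * √p.2.1) ∧
    dY (dY f) p =
      -B p.1 p.2.2 / (4 * p.2.1 * √p.2.1) + 3 * C p.1 p.2.2 / (4 * p.2.1 ^ 2 * √p.2.1) := by
  have h : EqOn (dY f) (fun p => A p.1 p.2.2 + B p.1 p.2.2 / (2 * √p.2.1)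
      - C p.1 p.2.2 / (2 * p.2.1 * √p.2.1)) domain :=
    fun p hp => (dY_congr hf hp).trans
      (hasDerivAt_sqrtExpr (A p.1 p.2.2) (B p.1 p.2.2) (C p.1 p.2.2) (D p.1 p.2.2) hp.2).deriv
  exact ⟨h hp, (dY_congr h hp).trans
    (hasDerivAt_sqrtExpr_deriv (A p.1 p.2.2) (B p.1 p.2.2) (C p.1 p.2.2) hp.2).deriv⟩

lemma eq_of_dX_eq_zero (hf : Smooth f) (h : EqOn (dX f) 0 domain) {x x' y t u : ℝ} (hx : 0 < x)
    (hx' : 0 < x') (hy : 0 < y) : f (x, y, t, u) = f (x', y, t, u) := by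
  have hd : ∀ r, 0 < r → HasDerivAt (fun r => f (r, y, t, u)) 0 r := fun r hr => by
    have hp : ((r, y, t, u) : Pt) ∈ domain := ⟨hr, hy⟩
    exact (hasDerivAt_dX (hf.differentiableAt hp)).congr_deriv (h hp)
  simpa using eqOn_Ioi_of_hasDerivAt hd (fun r _ => hasDerivAt_const r (0 : ℝ)) hx hx'

lemma eq_of_dY_eq_zero (hf : Smooth f) (h : EqOn (dY f) 0 domain) {x y y' t u : ℝ} (hx : 0 < x)
    (hy : 0 < y) (hy' : 0 < y') : f (x, y, t, u) = f (x, y', t, u) := by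
  have hd : ∀ r, 0 < r → HasDerivAt (fun r => f (x, r, t, u)) 0 r := fun r hr => by
    have hp : ((x, r, t, u) : Pt) ∈ domain := ⟨hx, hr⟩
    exact (hasDerivAt_dY (hf.differentiableAt hp)).congr_deriv (h hp)
  simpa using eqOn_Ioi_of_hasDerivAt hd (fun r _ => hasDerivAt_const r (0 : ℝ)) hy hy'

lemma eq_of_dU_eq_zero (hf : Smooth f) (h : EqOn (dU f) 0 domain) {x y t : ℝ} (u u' : ℝ)
    (hx : 0 < x) (hy : 0 < y) : f (x, y, t, u) = f (x, y, t, u') := by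
  have hd : ∀ r, HasDerivAt (fun r => f (x, y, t, r)) 0 r := fun r => by
    have hp : ((x, y, t, r) : Pt) ∈ domain := ⟨hx, hy⟩
    exact (hasDerivAt_dU (hf.differentiableAt hp)).congr_deriv (h hp)
  exact is_const_of_deriv_eq_zero (fun r => (hd r).differentiableAt) (fun r => (hd r).deriv) u u'

lemma Smooth.contDiff_t (hf : Smooth f) {x y : ℝ} (u : ℝ) (hx : 0 < x) (hy : 0 < y) :
    ContDiff ℝ ∞ fun t => f (x, y, t, u) := by
  rw [← contDiffOn_univ]
  exact ContDiffOn.comp (t := domain) hf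
    (contDiff_const.prodMk (contDiff_const.prodMk (contDiff_id.prodMk contDiff_const))).contDiffOn
    fun t _ => ⟨hx, hy⟩

end partials

/-- The general form of the coefficients `ξ, γ, τ`. -/
structure CoefficientForm (v : Field) (τ h l k : ℝ → ℝ) : Prop where
  τ_eq : ∀ p ∈ domain, cτ v p = τ p.2.2.1
  ξ_eq : ∀ p ∈ domain, cξ v p = deriv τ p.2.2.1 * p.1 + √p.1 * (√p.2.1 * h p.2.2.1 + l p.2.2.1)
  γ_eq : ∀ p ∈ domain, cγ v p = deriv τ p.2.2.1 * p.2.1 + √p.2.1 * (-√p.1 * h p.2.2.1 + k p.2.2.1)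

lemma ContDiff.deriv_infty {f : ℝ → ℝ} (hf : ContDiff ℝ ∞ f) : ContDiff ℝ ∞ (deriv f) :=
  (contDiff_infty_iff_deriv.1 hf).2

/-- The equations for `u_xx` and `u_yy` are ordinary differential equations in `x` and in `y`; the
functions left free by them are determined by the equation for `u_xy`. -/
lemma DeterminingEquations.exists_coefficientForm {a b d e : ℝ} {v : Field}
    (hv : SmoothComponents v) (H : DeterminingEquations a b d e v) :
    ∃ τ h l k : ℝ → ℝ, ContDiff ℝ ∞ τ ∧ ContDiff ℝ ∞ h ∧ ContDiff ℝ ∞ l ∧ ContDiff ℝ ∞ k ∧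
      CoefficientForm v τ h l k := by
  set τ : ℝ → ℝ := fun t => cτ v (1, 1, t, 0) with hτ
  have τ_eq : ∀ p ∈ domain, cτ v p = τ p.2.2.1 := fun ⟨x, y, t, u⟩ hp =>
    (eq_of_dX_eq_zero hv.τ H.τ_x hp.1 one_pos hp.2).trans
      ((eq_of_dY_eq_zero hv.τ H.τ_y one_pos hp.2 one_pos).trans
        (eq_of_dU_eq_zero hv.τ H.τ_u u 0 one_pos one_pos))
  have dτ : ∀ p ∈ domain, dT (cτ v) p = deriv τ p.2.2.1 := fun p hp => dT_congr τ_eq hp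
  have hτs : ContDiff ℝ ∞ τ := hv.τ.contDiff_t 0 one_pos one_pos
  have hξ : ∀ x y t u, 0 < x → 0 < y → cξ v (x, y, t, u)
      = deriv τ t * x + √x * (cξ v (1, y, t, 0) - deriv τ t) := fun x y t u hx hy => by
    rw [eq_of_dU_eq_zero hv.ξ H.ξ_u u 0 hx hy]
    refine eq_of_sub_two_mul_deriv (f := fun x => cξ v (x, y, t, 0)) (fun r hr =>
      hasDerivAt_dX (hv.ξ.differentiableAt (p := (r, y, t, 0)) ⟨hr, hy⟩)) (fun r hr => ?_) hx
    have := H.uxx_eq (r, y, t, 0) ⟨hr, hy⟩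
    rwa [dτ _ ⟨hr, hy⟩] at this
  have hγ : ∀ x y t u, 0 < x → 0 < y → cγ v (x, y, t, u)
      = deriv τ t * y + √y * (cγ v (x, 1, t, 0) - deriv τ t) := fun x y t u hx hy => by
    rw [eq_of_dU_eq_zero hv.γ H.γ_u u 0 hx hy]
    refine eq_of_sub_two_mul_deriv (f := fun y => cγ v (x, y, t, 0)) (fun r hr =>
      hasDerivAt_dY (hv.γ.differentiableAt (p := (x, r, t, 0)) ⟨hx, hr⟩)) (fun r hr => ?_) hy
    have := H.uyy_eq (x, r, t, 0) ⟨hx, hr⟩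
    rwa [dτ _ ⟨hx, hr⟩] at this
  have hξy : ∀ x y t, 0 < x → 0 < y →
      dY (cξ v) (x, y, t, 0) = √x * dY (cξ v) (1, y, t, 0) := fun x y t hx hy => by
    have h1 : HasDerivAt (fun r => deriv τ t * x + √x * (cξ v (1, r, t, 0) - deriv τ t))
        (√x * dY (cξ v) (1, y, t, 0)) y := ((((hasDerivAt_dY
      (hv.ξ.differentiableAt (p := (1, y, t, 0)) ⟨one_pos, hy⟩)).sub_const _).const_mul _).const_add
        _)
    refine (h1.congr_of_eventuallyEq ?_).deriv
    filter_upwards [lt_mem_nhds hy] with r hr using hξ x r t 0 hx hr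
  have hγx : ∀ x y t, 0 < x → 0 < y →
      dX (cγ v) (x, y, t, 0) = √y * dX (cγ v) (x, 1, t, 0) := fun x y t hx hy => by
    have h1 : HasDerivAt (fun r => deriv τ t * y + √y * (cγ v (r, 1, t, 0) - deriv τ t))
        (√y * dX (cγ v) (x, 1, t, 0)) x := ((((hasDerivAt_dX
      (hv.γ.differentiableAt (p := (x, 1, t, 0)) ⟨hx, one_pos⟩)).sub_const _).const_mul _).const_add
        _)
    refine (h1.congr_of_eventuallyEq ?_).deriv
    filter_upwards [lt_mem_nhds hx] with r hr using hγ r y t 0 hr hy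
  -- `u_xy` separates the variables: `√x ∂_x γ(x, 1) = -√y ∂_y ξ(1, y)` is constant.
  set h : ℝ → ℝ := fun t => 2 * dY (cξ v) (1, 1, t, 0) with hh
  have hs : ∀ x y t, 0 < x → 0 < y →
      x * (√y * dX (cγ v) (x, 1, t, 0)) + y * (√x * dY (cξ v) (1, y, t, 0)) = 0 :=
    fun x y t hx hy => by
      have := H.uxy_eq (x, y, t, 0) ⟨hx, hy⟩
      rwa [hξy x y t hx hy, hγx x y t hx hy] at this
  have hA : ∀ y t, 0 < y → cξ v (1, y, t, 0) = cξ v (1, 1, t, 0) + h t * (√y - 1) :=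
    fun y t hy => by
      have := eq_of_hasDerivAt_sqrtExpr (f := fun y => cξ v (1, y, t, 0)) (A := 0) (B := h t)
        (C := 0) (fun r hr => ?_) hy
      · simpa using this
      · refine (hasDerivAt_dY (hv.ξ.differentiableAt (p := (1, r, t, 0))
          ⟨one_pos, hr⟩)).congr_deriv ?_
        have h1 := hs 1 r t one_pos hr
        have h2 := hs 1 1 t one_pos one_pos
        have hr' := Real.sqrt_pos.2 hr
        simp only [Real.sqrt_one, hh] at h1 h2 ⊢
        have h3 : √r * √r = r := Real.mul_self_sqrt hr.le
        rw [zero_div, zero_add, sub_zero, eq_div_iff (by positivity)]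
        refine mul_left_cancel₀ hr'.ne' ?_
        linear_combination 2 * h1 - 2 * √r * h2 + 2 * dY (cξ v) (1, r, t, 0) * h3
  have hB : ∀ x t, 0 < x → cγ v (x, 1, t, 0) = cγ v (1, 1, t, 0) - h t * (√x - 1) :=
    fun x t hx => by
      have := eq_of_hasDerivAt_sqrtExpr (f := fun x => cγ v (x, 1, t, 0)) (A := 0) (B := -h t)
        (C := 0) (fun r hr => ?_) hx
      · linear_combination this
      · refine (hasDerivAt_dX (hv.γ.differentiableAt (p := (r, 1, t, 0))
          ⟨hr, one_pos⟩)).congr_deriv ?_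
        have h1 := hs r 1 t hr one_pos
        have hr' := Real.sqrt_pos.2 hr
        simp only [Real.sqrt_one, hh] at h1 ⊢
        have h3 : √r * √r = r := Real.mul_self_sqrt hr.le
        rw [zero_div, zero_add, sub_zero, eq_div_iff (by positivity)]
        refine mul_left_cancel₀ hr'.ne' ?_
        linear_combination 2 * h1 + 2 * dX (cγ v) (r, 1, t, 0) * h3
  have hhs : ContDiff ℝ ∞ h := contDiff_const.mul (hv.ξ.partialY.contDiff_t 0 one_pos one_pos)
  refine ⟨τ, h, fun t => cξ v (1, 1, t, 0) - deriv τ t - h t,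
    fun t => cγ v (1, 1, t, 0) - deriv τ t + h t, hτs, hhs,
    ((hv.ξ.contDiff_t 0 one_pos one_pos).sub (ContDiff.deriv_infty hτs)).sub hhs,
    ((hv.γ.contDiff_t 0 one_pos one_pos).sub (ContDiff.deriv_infty hτs)).add hhs,
    τ_eq, fun ⟨x, y, t, u⟩ hp => ?_, fun ⟨x, y, t, u⟩ hp => ?_⟩
  · rw [hξ x y t u hp.1 hp.2, hA y t hp.2]; ring
  · rw [hγ x y t u hp.1 hp.2, hB x t hp.1]; ring

/-! ### The coefficient of `∂_u` and the backward operator -/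

/-- A function of `(x, y, t)` as a function of `(x, y, t, u)`. -/
def lift (G : ℝ → ℝ → ℝ → ℝ) : Pt → ℝ := fun p => G p.1 p.2.1 p.2.2.1

/-- The linear operator `(a - b x) ∂_x + (d - e y) ∂_y + (x/2) ∂_x² + (y/2) ∂_y² + ∂_t`. -/
def generator (a b d e : ℝ) (f : Pt → ℝ) (p : Pt) : ℝ :=
  (a - b * p.1) * dX f p + (d - e * p.2.1) * dY f p
    + p.1 / 2 * dX (dX f) p + p.2.1 / 2 * dY (dY f) p + dT f p

section affine

variable {F G : Pt → ℝ} {p : Pt}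

lemma dX_mul_u_add (hF : Smooth F) (hG : Smooth G) :
    EqOn (dX fun p => F p * p.2.2.2 + G p) (fun p => dX F p * p.2.2.2 + dX G p) domain :=
  fun p hp => (((hasDerivAt_dX (hF.differentiableAt hp)).mul_const p.2.2.2).add
    (hasDerivAt_dX (hG.differentiableAt hp))).deriv

lemma dY_mul_u_add (hF : Smooth F) (hG : Smooth G) :
    EqOn (dY fun p => F p * p.2.2.2 + G p) (fun p => dY F p * p.2.2.2 + dY G p) domain :=
  fun p hp => (((hasDerivAt_dY (hF.differentiableAt hp)).mul_const p.2.2.2).add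
    (hasDerivAt_dY (hG.differentiableAt hp))).deriv

lemma dT_mul_u_add (hF : Smooth F) (hG : Smooth G) :
    EqOn (dT fun p => F p * p.2.2.2 + G p) (fun p => dT F p * p.2.2.2 + dT G p) domain :=
  fun p hp => (((hasDerivAt_dT (hF.differentiableAt hp)).mul_const p.2.2.2).add
    (hasDerivAt_dT (hG.differentiableAt hp))).deriv

lemma dU_lift_mul_u_add (Λ μ : ℝ → ℝ → ℝ → ℝ) :
    dU (fun p => lift Λ p * p.2.2.2 + lift μ p) = lift Λ := funext fun p =>
  ((((hasDerivAt_id' p.2.2.2).const_mul (lift Λ p)).add_const (lift μ p)).congr_deriv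
    (mul_one _)).deriv

/-- The operator acts on `F u + G` as on `F` and `G` separately: `u` is a parameter. -/
lemma generator_mul_u_add {f : Pt → ℝ} (a b d e : ℝ) (hF : Smooth F) (hG : Smooth G)
    (hf : EqOn f (fun p => F p * p.2.2.2 + G p) domain) (hp : p ∈ domain) :
    generator a b d e f p = generator a b d e F p * p.2.2.2 + generator a b d e G p := by
  have hx := (dX_congr hf).trans (dX_mul_u_add hF hG)
  have hy := (dY_congr hf).trans (dY_mul_u_add hF hG)
  have ht := (dT_congr hf).trans (dT_mul_u_add hF hG)
  have hxx := (dX_congr hx).trans (dX_mul_u_add hF.partialX hG.partialX)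
  have hyy := (dY_congr hy).trans (dY_mul_u_add hF.partialY hG.partialY)
  simp only [generator, hx hp, hy hp, ht hp, hxx hp, hyy hp]
  ring

end affine

lemma smooth_lift_of_slice {f : Pt → ℝ} (hf : Smooth f) :
    Smooth (lift fun x y t => f (x, y, t, 0)) :=
  ContDiffOn.comp (t := domain) hf (f := fun p : Pt => ((p.1, p.2.1, p.2.2.1, 0) : Pt))
    (by fun_prop) fun _ hp => hp

lemma isSolution_iff {a b d e : ℝ} {μ : ℝ → ℝ → ℝ → ℝ} : IsSolution a b d e μ ↔
    Smooth (lift μ) ∧ ∀ p ∈ domain, generator a b d e (lift μ) p = 0 := by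
  constructor
  · refine fun h => ⟨?_, fun p hp => ?_⟩
    · exact ContDiffOn.comp h.smooth (f := fun p : Pt => (p.1, p.2.1, p.2.2.1))
        (by fun_prop) fun _ hp => hp
    · have := h.eqn p.1 p.2.1 p.2.2.1 hp.1 hp.2
      simp only [iteratedDeriv_succ, iteratedDeriv_zero] at this
      exact this
  · refine fun h => ⟨?_, fun x y t hx hy => ?_⟩
    · exact ContDiffOn.comp h.1 (f := fun q : ℝ × ℝ × ℝ => ((q.1, q.2.1, q.2.2, 0) : Pt))
        (by fun_prop) fun _ hp => hp
    · have := h.2 (x, y, t, 0) ⟨hx, hy⟩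
      simp only [iteratedDeriv_succ, iteratedDeriv_zero]
      exact this

lemma DeterminingEquations.exists_phi_eq {a b d e : ℝ} {v : Field}
    (hv : SmoothComponents v) (H : DeterminingEquations a b d e v) :
    ∃ Λ μ : ℝ → ℝ → ℝ → ℝ, Smooth (lift Λ) ∧ Smooth (lift μ) ∧
      EqOn (cφ v) (fun p => lift Λ p * p.2.2.2 + lift μ p) domain := by
  refine ⟨fun x y t => dU (cφ v) (x, y, t, 0), fun x y t => cφ v (x, y, t, 0),
    smooth_lift_of_slice hv.φ.partialU, smooth_lift_of_slice hv.φ, ?_⟩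
  rintro ⟨x, y, t, u⟩ hp
  have h1 : ∀ r, HasDerivAt (fun r => cφ v (x, y, t, r) - dU (cφ v) (x, y, t, 0) * r) 0 r :=
    fun r => by
      refine ((hasDerivAt_dU (hv.φ.differentiableAt (p := (x, y, t, r)) hp)).sub
        ((hasDerivAt_id' r).const_mul (dU (cφ v) (x, y, t, 0)))).congr_deriv ?_
      rw [eq_of_dU_eq_zero hv.φ.partialU H.φ_uu r 0 hp.1 hp.2]
      ring
  have h2 := is_const_of_deriv_eq_zero (fun r => (h1 r).differentiableAt)
    (fun r => (h1 r).deriv) u 0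
  simp only [lift]
  linear_combination h2

/-! ### The equations for `∂_x λ` and `∂_y λ` -/

section coefficientForm

variable {a b d e : ℝ} {v : Field} {τ h l k : ℝ → ℝ} {p : Pt}

lemma CoefficientForm.partials_ξ (H : CoefficientForm v τ h l k) (hτ : Differentiable ℝ (deriv τ))
    (hh : Differentiable ℝ h) (hl : Differentiable ℝ l) (hp : p ∈ domain) :
    dX (cξ v) p = deriv τ p.2.2.1 + (√p.2.1 * h p.2.2.1 + l p.2.2.1) / (2 * √p.1) ∧
    dX (dX (cξ v)) p = -(√p.2.1 * h p.2.2.1 + l p.2.2.1) / (4 * p.1 * √p.1) ∧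
    dY (cξ v) p = √p.1 * h p.2.2.1 / (2 * √p.2.1) ∧
    dY (dY (cξ v)) p = -(√p.1 * h p.2.2.1) / (4 * p.2.1 * √p.2.1) ∧
    dT (cξ v) p = deriv (deriv τ) p.2.2.1 * p.1
      + √p.1 * (√p.2.1 * deriv h p.2.2.1 + deriv l p.2.2.1) := by
  obtain ⟨hx, hxx⟩ := partials_x_sqrtExpr (f := cξ v) (fun q => deriv τ q.2.1)
    (fun q => √q.1 * h q.2.1 + l q.2.1) (fun _ => 0) (fun _ => 0)
    (fun p hp => by rw [H.ξ_eq p hp]; ring) hp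
  obtain ⟨hy, hyy⟩ := partials_y_sqrtExpr (f := cξ v) (fun _ _ => 0) (fun x q => √x * h q.1)
    (fun _ _ => 0) (fun x q => deriv τ q.1 * x + √x * l q.1)
    (fun p hp => by rw [H.ξ_eq p hp]; ring) hp
  refine ⟨by rw [hx]; ring, by rw [hxx]; ring, by rw [hy]; ring, by rw [hyy]; ring, ?_⟩
  refine (dT_congr H.ξ_eq hp).trans ?_
  exact (((hτ _).hasDerivAt.mul_const p.1).add ((((hh _).hasDerivAt.const_mul √p.2.1).add
      (hl _).hasDerivAt).const_mul √p.1)).deriv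

lemma CoefficientForm.partials_γ (H : CoefficientForm v τ h l k) (hτ : Differentiable ℝ (deriv τ))
    (hh : Differentiable ℝ h) (hk : Differentiable ℝ k) (hp : p ∈ domain) :
    dY (cγ v) p = deriv τ p.2.2.1 + (-√p.1 * h p.2.2.1 + k p.2.2.1) / (2 * √p.2.1) ∧
    dY (dY (cγ v)) p = -(-√p.1 * h p.2.2.1 + k p.2.2.1) / (4 * p.2.1 * √p.2.1) ∧
    dX (cγ v) p = -√p.2.1 * h p.2.2.1 / (2 * √p.1) ∧
    dX (dX (cγ v)) p = √p.2.1 * h p.2.2.1 / (4 * p.1 * √p.1) ∧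
    dT (cγ v) p = deriv (deriv τ) p.2.2.1 * p.2.1
      + √p.2.1 * (-√p.1 * deriv h p.2.2.1 + deriv k p.2.2.1) := by
  obtain ⟨hx, hxx⟩ := partials_x_sqrtExpr (f := cγ v) (fun _ => 0) (fun q => -√q.1 * h q.2.1)
    (fun _ => 0) (fun q => deriv τ q.2.1 * q.1 + √q.1 * k q.2.1)
    (fun p hp => by rw [H.γ_eq p hp]; ring) hp
  obtain ⟨hy, hyy⟩ := partials_y_sqrtExpr (f := cγ v) (fun _ q => deriv τ q.1)
    (fun x q => -√x * h q.1 + k q.1) (fun _ _ => 0) (fun _ _ => 0)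
    (fun p hp => by rw [H.γ_eq p hp]; ring) hp
  refine ⟨by rw [hy]; ring, by rw [hyy]; ring, by rw [hx]; ring, by rw [hxx]; ring, ?_⟩
  refine (dT_congr H.γ_eq hp).trans ?_
  exact (((hτ _).hasDerivAt.mul_const p.2.1).add ((((hh _).hasDerivAt.const_mul (-√p.1)).add
      (hk _).hasDerivAt).const_mul √p.2.1)).deriv

lemma CoefficientForm.dT_τ (H : CoefficientForm v τ h l k) (hp : p ∈ domain) :
    dT (cτ v) p = deriv τ p.2.2.1 := dT_congr H.τ_eq hp

/-- The coefficient of `u_x` in the invariance condition determines `∂_x λ`. -/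
lemma CoefficientForm.ux_eq_iff (H : CoefficientForm v τ h l k) (hτ : Differentiable ℝ (deriv τ))
    (hh : Differentiable ℝ h) (hl : Differentiable ℝ l) (hp : p ∈ domain) :
    -b * cξ v p + (a - b * p.1) * (dT (cτ v) p - dX (cξ v) p)
      + p.1 * dX (dU (cφ v)) p - p.1 / 2 * dX (dX (cξ v)) p - dT (cξ v) p
      - (d - e * p.2.1) * dY (cξ v) p - p.2.1 / 2 * dY (dY (cξ v)) p = 0 ↔
    dX (dU (cφ v)) p = (deriv (deriv τ) p.2.2.1 + b * deriv τ p.2.2.1)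
      + (b * (√p.2.1 * h p.2.2.1 + l p.2.2.1)
          + 2 * (√p.2.1 * deriv h p.2.2.1 + deriv l p.2.2.1)
          + (d - 1 / 4) * h p.2.2.1 / √p.2.1 - e * √p.2.1 * h p.2.2.1) / (2 * √p.1)
      - -((a - 1 / 4) * (√p.2.1 * h p.2.2.1 + l p.2.2.1)) / (2 * p.1 * √p.1) := by
  obtain ⟨h1, h2, h3, h4, h5⟩ := H.partials_ξ hτ hh hl hp
  rw [h1, h2, h3, h4, h5, H.dT_τ hp, H.ξ_eq p hp]
  have hx := hp.1
  have hy := hp.2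
  have hsx := Real.sqrt_pos.2 hx
  have hsy := Real.sqrt_pos.2 hy
  have ex : p.1 = √p.1 ^ 2 := (Real.sq_sqrt hx.le).symm
  have ey : p.2.1 = √p.2.1 ^ 2 := (Real.sq_sqrt hy.le).symm
  generalize √p.1 = q at *
  generalize √p.2.1 = r at *
  rw [ex, ey, ← sub_eq_zero (a := dX (dU (cφ v)) p)]
  generalize dX (dU (cφ v)) p = w
  refine Iff.trans (Eq.congr_left ?_) (mul_eq_zero_iff_left (a := q ^ 2) (by positivity))
  field_simp
  ring

/-- The coefficient of `u_y` in the invariance condition determines `∂_y λ`. -/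
lemma CoefficientForm.uy_eq_iff (H : CoefficientForm v τ h l k) (hτ : Differentiable ℝ (deriv τ))
    (hh : Differentiable ℝ h) (hk : Differentiable ℝ k) (hp : p ∈ domain) :
    -e * cγ v p + (d - e * p.2.1) * (dT (cτ v) p - dY (cγ v) p)
      + p.2.1 * dY (dU (cφ v)) p - p.2.1 / 2 * dY (dY (cγ v)) p - dT (cγ v) p
      - (a - b * p.1) * dX (cγ v) p - p.1 / 2 * dX (dX (cγ v)) p = 0 ↔
    dY (dU (cφ v)) p = (deriv (deriv τ) p.2.2.1 + e * deriv τ p.2.2.1)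
      + (e * (-√p.1 * h p.2.2.1 + k p.2.2.1)
          + 2 * (-√p.1 * deriv h p.2.2.1 + deriv k p.2.2.1)
          - (a - 1 / 4) * h p.2.2.1 / √p.1 + b * √p.1 * h p.2.2.1) / (2 * √p.2.1)
      - -((d - 1 / 4) * (-√p.1 * h p.2.2.1 + k p.2.2.1)) / (2 * p.2.1 * √p.2.1) := by
  obtain ⟨h1, h2, h3, h4, h5⟩ := H.partials_γ hτ hh hk hp
  rw [h1, h2, h3, h4, h5, H.dT_τ hp, H.γ_eq p hp]
  have hx := hp.1
  have hy := hp.2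
  have hsx := Real.sqrt_pos.2 hx
  have hsy := Real.sqrt_pos.2 hy
  have ex : p.1 = √p.1 ^ 2 := (Real.sq_sqrt hx.le).symm
  have ey : p.2.1 = √p.2.1 ^ 2 := (Real.sq_sqrt hy.le).symm
  generalize √p.1 = q at *
  generalize √p.2.1 = r at *
  rw [ex, ey, ← sub_eq_zero (a := dY (dU (cφ v)) p)]
  generalize dY (dU (cφ v)) p = w
  refine Iff.trans (Eq.congr_left ?_) (mul_eq_zero_iff_left (a := r ^ 2) (by positivity))
  field_simp
  ring

end coefficientForm

/-! ### Integration of the equations for `λ` -/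

lemma iteratedDeriv_two_eq (f : ℝ → ℝ) : iteratedDeriv 2 f = deriv (deriv f) := by
  rw [iteratedDeriv_succ, iteratedDeriv_one]

lemma iteratedDeriv_three_eq (f : ℝ → ℝ) : iteratedDeriv 3 f = deriv (deriv (deriv f)) := by
  rw [iteratedDeriv_succ, iteratedDeriv_two_eq]

/-- The part of `λ` which is unbounded at the boundary of the quadrant. -/
def singularPart (a d : ℝ) (h l k : ℝ → ℝ) (x y t : ℝ) : ℝ :=
  -((a - 1 / 4) * (√y * h t + l t)) / √x + (d - 1 / 4) * (√x * h t - k t) / √y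

section integration

variable {a b d e : ℝ} {τ h l k : ℝ → ℝ} {Λ : ℝ → ℝ → ℝ → ℝ}

/-- Integrating `∂_x λ` and `∂_y λ` along the two axes of the quadrant. -/
lemma exists_eq_lam_add_singularPart (hτ : ContDiff ℝ ∞ τ) (hh : ContDiff ℝ ∞ h)
    (hl : ContDiff ℝ ∞ l) (hk : ContDiff ℝ ∞ k) (hΛ : Smooth (lift Λ))
    (hX : ∀ p ∈ domain, dX (lift Λ) p = (deriv (deriv τ) p.2.2.1 + b * deriv τ p.2.2.1)
      + (b * (√p.2.1 * h p.2.2.1 + l p.2.2.1)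
          + 2 * (√p.2.1 * deriv h p.2.2.1 + deriv l p.2.2.1)
          + (d - 1 / 4) * h p.2.2.1 / √p.2.1 - e * √p.2.1 * h p.2.2.1) / (2 * √p.1)
      - -((a - 1 / 4) * (√p.2.1 * h p.2.2.1 + l p.2.2.1)) / (2 * p.1 * √p.1))
    (hY : ∀ p ∈ domain, dY (lift Λ) p = (deriv (deriv τ) p.2.2.1 + e * deriv τ p.2.2.1)
      + (e * (-√p.1 * h p.2.2.1 + k p.2.2.1)
          + 2 * (-√p.1 * deriv h p.2.2.1 + deriv k p.2.2.1)
          - (a - 1 / 4) * h p.2.2.1 / √p.1 + b * √p.1 * h p.2.2.1) / (2 * √p.2.1)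
      - -((d - 1 / 4) * (-√p.1 * h p.2.2.1 + k p.2.2.1)) / (2 * p.2.1 * √p.2.1)) :
    (∀ t, deriv h t = 0) ∧ ∃ s : ℝ → ℝ, ContDiff ℝ ∞ s ∧ ∀ x y t, 0 < x → 0 < y →
      Λ x y t = lam b e τ h l k s x y t + singularPart a d h l k x y t := by
  have IX := fun (x y t : ℝ) (hx : 0 < x) (hy : 0 < y) =>
    eq_of_hasDerivAt_sqrtExpr (f := fun x => Λ x y t) (A := deriv (deriv τ) t + b * deriv τ t)
      (B := b * (√y * h t + l t) + 2 * (√y * deriv h t + deriv l t)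
          + (d - 1 / 4) * h t / √y - e * √y * h t)
      (C := -((a - 1 / 4) * (√y * h t + l t))) (fun r hr =>
      (hasDerivAt_dX (hΛ.differentiableAt (p := (r, y, t, 0)) ⟨hr, hy⟩)).congr_deriv
        (hX (r, y, t, 0) ⟨hr, hy⟩)) hx
  have IY := fun (x y t : ℝ) (hx : 0 < x) (hy : 0 < y) =>
    eq_of_hasDerivAt_sqrtExpr (f := fun y => Λ x y t) (A := deriv (deriv τ) t + e * deriv τ t)
      (B := e * (-√x * h t + k t) + 2 * (-√x * deriv h t + deriv k t)
          - (a - 1 / 4) * h t / √x + b * √x * h t)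
      (C := -((d - 1 / 4) * (-√x * h t + k t))) (fun r hr =>
      (hasDerivAt_dY (hΛ.differentiableAt (p := (x, r, t, 0)) ⟨hx, hr⟩)).congr_deriv
        (hY (x, r, t, 0) ⟨hx, hr⟩)) hy
  -- The two ways from `(1, 1)` to `(4, 4)` differ by a multiple of `h'`.
  have h4 : √(4 : ℝ) = 2 := by
    rw [show (4 : ℝ) = 2 ^ 2 by norm_num]; exact Real.sqrt_sq (by norm_num)
  have hh' : ∀ t, deriv h t = 0 := fun t => by
    have e1 := IX 4 4 t (by norm_num) (by norm_num)
    have e2 := IX 4 1 t (by norm_num) (by norm_num)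
    have e3 := IY 4 4 t (by norm_num) (by norm_num)
    have e4 := IY 1 4 t (by norm_num) (by norm_num)
    simp only [h4, Real.sqrt_one] at e1 e2 e3 e4
    linear_combination -(e1 - e2 - e3 + e4) / 4
  have hτ1 := ContDiff.deriv_infty hτ
  have hτ2 := ContDiff.deriv_infty hτ1
  have hl1 := ContDiff.deriv_infty hl
  have hk1 := ContDiff.deriv_infty hk
  refine ⟨hh', fun t => Λ 1 1 t - ((deriv (deriv τ) t + b * deriv τ t) + h t * (b - e)
    + 2 * (deriv l t + b * l t / 2) + (deriv (deriv τ) t + e * deriv τ t)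
    + 2 * (deriv k t + e * k t / 2) - (a - 1 / 4) * (h t + l t) + (d - 1 / 4) * (h t - k t)),
    ?_, fun x y t hx hy => ?_⟩
  · have : ContDiff ℝ ∞ fun t => Λ 1 1 t := hΛ.contDiff_t 0 one_pos one_pos
    fun_prop
  -- From `(1, 1)` along `x = 1` to `(1, y)`, and from there to `(x, y)`.
  · have e1 := IX x y t hx hy
    have e2 := IY 1 y t one_pos hy
    have hx' := Real.sqrt_pos.2 hx
    have hy' := Real.sqrt_pos.2 hy
    simp only [Real.sqrt_one, hh'] at e1 e2
    simp only [lam, singularPart, iteratedDeriv_two_eq]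
    rw [e1, e2]
    field_simp
    ring

lemma eq_zero_of_forall_pos {A B C D E : ℝ}
    (H : ∀ q, 0 < q → A / q ^ 3 + B / q + C + D * q + E * q ^ 2 = 0) : A = 0 := by
  have h1 := H 1 (by norm_num)
  have h2 := H 2 (by norm_num)
  have h3 := H 3 (by norm_num)
  have h4 := H 4 (by norm_num)
  have h5 := H 5 (by norm_num)
  norm_num at h1 h2 h3 h4 h5
  linarith

lemma eq_zero_of_forall_pos_pos {A B C D E F : ℝ}
    (H : ∀ q r : ℝ, 0 < q → 0 < r →
      A * q ^ 2 + B * r ^ 2 + C * (q * r) + D * q + E * r + F = 0) :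
    A = 0 ∧ B = 0 ∧ C = 0 ∧ D = 0 ∧ E = 0 ∧ F = 0 := by
  have h1 := H 1 1 (by norm_num) (by norm_num)
  have h2 := H 2 1 (by norm_num) (by norm_num)
  have h3 := H 1 2 (by norm_num) (by norm_num)
  have h4 := H 2 2 (by norm_num) (by norm_num)
  have h5 := H 3 1 (by norm_num) (by norm_num)
  have h6 := H 1 3 (by norm_num) (by norm_num)
  refine ⟨?_, ?_, ?_, ?_, ?_, ?_⟩ <;> linarith

lemma hasDerivAt_lam {s : ℝ → ℝ} (hτ : ContDiff ℝ ∞ τ) (hh : Differentiable ℝ h)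
    (hl : ContDiff ℝ ∞ l) (hk : ContDiff ℝ ∞ k) (hs : Differentiable ℝ s) (x y t : ℝ) :
    HasDerivAt (lam b e τ h l k s x y)
      ((iteratedDeriv 3 τ t + b * iteratedDeriv 2 τ t) * x + deriv h t * (b - e) * √x * √y
        + 2 * (iteratedDeriv 2 l t + b * deriv l t / 2) * √x
        + (iteratedDeriv 3 τ t + e * iteratedDeriv 2 τ t) * y
        + 2 * (iteratedDeriv 2 k t + e * deriv k t / 2) * √y + deriv s t) t := by
  have hd : ∀ {f : ℝ → ℝ}, ContDiff ℝ ∞ f → ∀ t, HasDerivAt f (deriv f t) t := fun hf t =>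
    (hf.differentiable (by simp) t).hasDerivAt
  have h1 := hd (ContDiff.deriv_infty hτ) t
  have h2 := hd (ContDiff.deriv_infty (ContDiff.deriv_infty hτ)) t
  have hl1 := hd (ContDiff.deriv_infty hl) t
  have hk1 := hd (ContDiff.deriv_infty hk) t
  unfold lam
  simp only [iteratedDeriv_three_eq, iteratedDeriv_two_eq]
  exact ((((((h2.add (h1.const_mul b)).mul_const x).add
    ((((hh t).hasDerivAt.mul_const (b - e)).mul_const √x).mul_const √y)).add
    (((hl1.add (((hd hl t).const_mul b).div_const 2)).const_mul 2).mul_const √x)).add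
    ((h2.add (h1.const_mul e)).mul_const y)).add
    (((hk1.add (((hd hk t).const_mul e).div_const 2)).const_mul 2).mul_const √y)).add
    (hs t).hasDerivAt

/-- The coefficients of `x^{-3/2}` and `y^{-3/2}` in the equation for `λ` vanish. For fixed `t` and
`r = √y`, the equation is a combination of `q^{-3}, q^{-1}, 1, q, q²` in `q = √x`. -/
lemma singular_coefficients {s : ℝ → ℝ} (hτ : ContDiff ℝ ∞ τ) (hh : ContDiff ℝ ∞ h)
    (hl : ContDiff ℝ ∞ l) (hk : ContDiff ℝ ∞ k) (hs : ContDiff ℝ ∞ s) (hh' : ∀ t, deriv h t = 0)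
    (hΛ : EqOn (lift Λ) (lift fun x y t =>
      lam b e τ h l k s x y t + singularPart a d h l k x y t) domain)
    (hgen : ∀ p ∈ domain, generator a b d e (lift Λ) p = 0) (q r t : ℝ) (hq : 0 < q)
    (hr : 0 < r) :
    (a - 1 / 4) * (a - 3 / 4) * (r * h t + l t) = 0 ∧
      (d - 1 / 4) * (d - 3 / 4) * (-q * h t + k t) = 0 := by
  have key : ∀ q r : ℝ, 0 < q → 0 < r → _ := fun q r hq hr => by
    have hp : ((q ^ 2, r ^ 2, t, 0) : Pt) ∈ domain := ⟨by positivity, by positivity⟩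
    obtain ⟨hx, hxx⟩ := partials_x_sqrtExpr (f := lift Λ)
      (fun q => iteratedDeriv 2 τ q.2.1 + b * deriv τ q.2.1)
      (fun q => h q.2.1 * (b - e) * √q.1 + 2 * (deriv l q.2.1 + b * l q.2.1 / 2)
        + (d - 1 / 4) * h q.2.1 / √q.1) (fun q => -((a - 1 / 4) * (√q.1 * h q.2.1 + l q.2.1)))
      (fun q => (iteratedDeriv 2 τ q.2.1 + e * deriv τ q.2.1) * q.1
        + 2 * (deriv k q.2.1 + e * k q.2.1 / 2) * √q.1 + s q.2.1 - (d - 1 / 4) * k q.2.1 / √q.1)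
      (fun p hp => by rw [hΛ hp]; simp only [lift, lam, singularPart]; ring) hp
    obtain ⟨hy, hyy⟩ := partials_y_sqrtExpr (f := lift Λ)
      (fun _ q => iteratedDeriv 2 τ q.1 + e * deriv τ q.1)
      (fun x q => h q.1 * (b - e) * √x + 2 * (deriv k q.1 + e * k q.1 / 2)
        - (a - 1 / 4) * h q.1 / √x) (fun x q => (d - 1 / 4) * (√x * h q.1 - k q.1))
      (fun x q => (iteratedDeriv 2 τ q.1 + b * deriv τ q.1) * x
        + 2 * (deriv l q.1 + b * l q.1 / 2) * √x + s q.1 - (a - 1 / 4) * l q.1 / √x)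
      (fun p hp => by rw [hΛ hp]; simp only [lift, lam, singularPart]; ring) hp
    have ht := (dT_congr hΛ hp).trans ((hasDerivAt_lam hτ (hh.differentiable (by simp)) hl hk
      (hs.differentiable (by simp)) (q ^ 2) (r ^ 2) t).add
      (((((hh.differentiable (by simp) t).hasDerivAt.const_mul √(r ^ 2)).add
        (hl.differentiable (by simp) t).hasDerivAt).const_mul (a - 1 / 4)).neg.div_const √(q ^ 2)
        |>.add (((((hh.differentiable (by simp) t).hasDerivAt.const_mul √(q ^ 2)).sub
        (hk.differentiable (by simp) t).hasDerivAt).const_mul (d - 1 / 4)).div_const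
          √(r ^ 2)))).deriv
    have h0 := hgen _ hp
    rw [generator, hx, hxx, hy, hyy, ht] at h0
    simp only [Real.sqrt_sq hq.le, Real.sqrt_sq hr.le, hh'] at h0
    exact h0
  constructor
  · refine (mul_eq_zero_iff_left (a := (1 / 2 : ℝ)) (by norm_num)).1 (eq_zero_of_forall_pos
      (A := 1 / 2 * ((a - 1 / 4) * (a - 3 / 4) * (r * h t + l t)))
      (B := (h t * (b - e) * r + 2 * (deriv l t + b * l t / 2) + (d - 1 / 4) * h t / r)
          * (a - 1 / 4) / 2 - (a - 1 / 4) * (r * h t + l t) * b / 2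
          - (a - 1 / 4) * h t * ((d - 1 / 4) / (2 * r) - e * r / 2) - (a - 1 / 4) * deriv l t)
      (C := (iteratedDeriv 2 τ t + b * deriv τ t) * a
          + (iteratedDeriv 2 τ t + e * deriv τ t) * (d - e * r ^ 2)
          + 2 * (deriv k t + e * k t / 2) * ((d - 1 / 4) / (2 * r) - e * r / 2)
          - (d - 1 / 4) * k t * ((3 / 8 - d / 2) / r ^ 3 + e / (2 * r))
          + (iteratedDeriv 3 τ t + e * iteratedDeriv 2 τ t) * r ^ 2
          + 2 * (iteratedDeriv 2 k t + e * deriv k t / 2) * r + deriv s t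
          - (d - 1 / 4) * deriv k t / r)
      (D := -b / 2 * (h t * (b - e) * r + 2 * (deriv l t + b * l t / 2) + (d - 1 / 4) * h t / r)
          + h t * (b - e) * ((d - 1 / 4) / (2 * r) - e * r / 2)
          + (d - 1 / 4) * h t * ((3 / 8 - d / 2) / r ^ 3 + e / (2 * r))
          + 2 * (iteratedDeriv 2 l t + b * deriv l t / 2))
      (E := -b * (iteratedDeriv 2 τ t + b * deriv τ t)
          + (iteratedDeriv 3 τ t + b * iteratedDeriv 2 τ t)) fun q hq => ?_)
    rw [← key q r hq hr]
    field_simp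
    ring
  · refine (mul_eq_zero_iff_left (a := (1 / 2 : ℝ)) (by norm_num)).1 (eq_zero_of_forall_pos
      (A := 1 / 2 * ((d - 1 / 4) * (d - 3 / 4) * (-q * h t + k t)))
      (B := (h t * (b - e) * q + 2 * (deriv k t + e * k t / 2) - (a - 1 / 4) * h t / q)
          * (d - 1 / 4) / 2 - (d - 1 / 4) * (-q * h t + k t) * e / 2
          + (d - 1 / 4) * h t * ((a - 1 / 4) / (2 * q) - b * q / 2) - (d - 1 / 4) * deriv k t)
      (C := (iteratedDeriv 2 τ t + e * deriv τ t) * d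
          + (iteratedDeriv 2 τ t + b * deriv τ t) * (a - b * q ^ 2)
          + 2 * (deriv l t + b * l t / 2) * ((a - 1 / 4) / (2 * q) - b * q / 2)
          - (a - 1 / 4) * l t * ((3 / 8 - a / 2) / q ^ 3 + b / (2 * q))
          + (iteratedDeriv 3 τ t + b * iteratedDeriv 2 τ t) * q ^ 2
          + 2 * (iteratedDeriv 2 l t + b * deriv l t / 2) * q + deriv s t
          - (a - 1 / 4) * deriv l t / q)
      (D := -e / 2 * (h t * (b - e) * q + 2 * (deriv k t + e * k t / 2) - (a - 1 / 4) * h t / q)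
          + h t * (b - e) * ((a - 1 / 4) / (2 * q) - b * q / 2)
          - (a - 1 / 4) * h t * ((3 / 8 - a / 2) / q ^ 3 + b / (2 * q))
          + 2 * (iteratedDeriv 2 k t + e * deriv k t / 2))
      (E := -e * (iteratedDeriv 2 τ t + e * deriv τ t)
          + (iteratedDeriv 3 τ t + e * iteratedDeriv 2 τ t)) fun r hr => ?_)
    rw [← key q r hq hr]
    field_simp
    ring

end integration

/-! ### Behaviour at the boundary and the equation for `λ` -/

section boundary

variable {a b d e : ℝ} {τ h l k s : ℝ → ℝ} {v : Field}

lemma phiU_eq {Λ μ : ℝ → ℝ → ℝ → ℝ}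
    (hφ : EqOn (cφ v) (fun p => lift Λ p * p.2.2.2 + lift μ p) domain) {x y : ℝ} (t u : ℝ)
    (hx : 0 < x) (hy : 0 < y) : phiU v x y t u = Λ x y t := by
  have := (dU_congr hφ).trans (fun p _ => congrFun (dU_lift_mul_u_add Λ μ) p)
    (show ((x, y, t, u) : Pt) ∈ domain from ⟨hx, hy⟩)
  exact this

lemma tendsto_sqrt_mul_lam_x (y t : ℝ) :
    Tendsto (fun x => √x * lam b e τ h l k s x y t) (𝓝[>] 0) (𝓝 0) := by
  have : Continuous fun x => √x * lam b e τ h l k s x y t := by unfold lam; fun_prop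
  simpa using (this.tendsto 0).mono_left nhdsWithin_le_nhds

lemma tendsto_sqrt_mul_lam_y (x t : ℝ) :
    Tendsto (fun y => √y * lam b e τ h l k s x y t) (𝓝[>] 0) (𝓝 0) := by
  have : Continuous fun y => √y * lam b e τ h l k s x y t := by unfold lam; fun_prop
  simpa using (this.tendsto 0).mono_left nhdsWithin_le_nhds

lemma tendsto_sqrt_mul_singularPart_x (y t : ℝ) :
    Tendsto (fun x => √x * singularPart a d h l k x y t) (𝓝[>] 0)
      (𝓝 (-((a - 1 / 4) * (√y * h t + l t)))) := by
  have : Continuous fun x => -((a - 1 / 4) * (√y * h t + l t))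
      + √x * ((d - 1 / 4) * (√x * h t - k t) / √y) := by fun_prop
  have h0 := (this.tendsto 0).mono_left (nhdsWithin_le_nhds (s := Ioi 0))
  simp only [Real.sqrt_zero, zero_mul, add_zero] at h0
  refine h0.congr' ?_
  filter_upwards [self_mem_nhdsWithin] with x hx
  have := Real.sqrt_pos.2 hx
  rw [singularPart]
  field_simp

lemma tendsto_sqrt_mul_singularPart_y (x t : ℝ) :
    Tendsto (fun y => √y * singularPart a d h l k x y t) (𝓝[>] 0)
      (𝓝 ((d - 1 / 4) * (√x * h t - k t))) := by
  have : Continuous fun y => √y * (-((a - 1 / 4) * (√y * h t + l t)) / √x)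
      + (d - 1 / 4) * (√x * h t - k t) := by fun_prop
  have h0 := (this.tendsto 0).mono_left (nhdsWithin_le_nhds (s := Ioi 0))
  simp only [Real.sqrt_zero, zero_mul, zero_add] at h0
  refine h0.congr' ?_
  filter_upwards [self_mem_nhdsWithin] with y hy
  have := Real.sqrt_pos.2 hy
  rw [singularPart]
  field_simp

/-- For `a ≠ 3/4` and `d ≠ 3/4` the equation for `λ` excludes the singular part; at the two
exceptional values the regularity at the boundary does. -/
lemma singularPart_vanishes {Λ μ : ℝ → ℝ → ℝ → ℝ}
    (hφ : EqOn (cφ v) (fun p => lift Λ p * p.2.2.2 + lift μ p) domain)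
    (hΛ : ∀ x y t, 0 < x → 0 < y →
      Λ x y t = lam b e τ h l k s x y t + singularPart a d h l k x y t)
    (hsing : ∀ q r t : ℝ, 0 < q → 0 < r →
      (a - 1 / 4) * (a - 3 / 4) * (r * h t + l t) = 0 ∧
      (d - 1 / 4) * (d - 3 / 4) * (-q * h t + k t) = 0)
    (hb : BoundaryRegular a d v) (t : ℝ) :
    h t * (1 / 4 - a) = 0 ∧ h t * (1 / 4 - d) = 0 ∧ l t * (1 / 4 - a) = 0 ∧
      k t * (1 / 4 - d) = 0 := by
  have hA : ∀ r, 0 < r → (a - 1 / 4) * (r * h t + l t) = 0 := fun r hr => by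
    by_cases ha : a = 3 / 4
    · have h1 := hb.1 ha (r ^ 2) t 0 (by positivity)
      have h2 := (tendsto_sqrt_mul_lam_x (b := b) (e := e) (τ := τ) (h := h) (l := l) (k := k)
        (s := s) (r ^ 2) t).add (tendsto_sqrt_mul_singularPart_x (a := a) (d := d) (h := h)
          (l := l) (k := k) (r ^ 2) t)
      have h3 := tendsto_nhds_unique (h1.congr' ?_) h2
      · rw [Real.sqrt_sq hr.le] at h3
        linear_combination h3
      · filter_upwards [self_mem_nhdsWithin] with x hx
        rw [phiU_eq hφ t 0 hx (by positivity), hΛ x _ t hx (by positivity), mul_add]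
    · have h1 := (hsing 1 r t one_pos hr).1
      refine (mul_eq_zero.1 (?_ : (a - 3 / 4) * _ = 0)).resolve_left (sub_ne_zero.2 ha)
      linear_combination h1
  have hD : ∀ q, 0 < q → (d - 1 / 4) * (-q * h t + k t) = 0 := fun q hq => by
    by_cases hd : d = 3 / 4
    · have h1 := hb.2 hd (q ^ 2) t 0 (by positivity)
      have h2 := (tendsto_sqrt_mul_lam_y (b := b) (e := e) (τ := τ) (h := h) (l := l) (k := k)
        (s := s) (q ^ 2) t).add (tendsto_sqrt_mul_singularPart_y (a := a) (d := d) (h := h)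
          (l := l) (k := k) (q ^ 2) t)
      have h3 := tendsto_nhds_unique (h1.congr' ?_) h2
      · rw [Real.sqrt_sq hq.le] at h3
        linear_combination h3
      · filter_upwards [self_mem_nhdsWithin] with y hy
        rw [phiU_eq hφ t 0 (by positivity) hy, hΛ _ y t (by positivity) hy, mul_add]
    · have h1 := (hsing q 1 t hq one_pos).2
      refine (mul_eq_zero.1 (?_ : (d - 3 / 4) * _ = 0)).resolve_left (sub_ne_zero.2 hd)
      linear_combination h1
  have a1 := hA 1 one_pos
  have a2 := hA 2 two_pos
  have d1 := hD 1 one_pos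
  have d2 := hD 2 two_pos
  refine ⟨?_, ?_, ?_, ?_⟩
  · linear_combination a1 - a2
  · linear_combination d2 - d1
  · linear_combination a2 - 2 * a1
  · linear_combination d2 - 2 * d1

/-- The constraints on `h, l, k` remain valid for the derivatives. -/
lemma deriv_mul_eq_zero {f : ℝ → ℝ} {c : ℝ} (hf : ∀ t, f t * c = 0) (t : ℝ) :
    deriv f t * c = 0 := by
  rcases eq_or_ne c 0 with rfl | hc
  · simp
  · have : f = fun _ => 0 := funext fun t => (mul_eq_zero.1 (hf t)).resolve_right hc
    simp [this]

lemma partials_lam {f : Pt → ℝ} (hf : EqOn f (lift (lam b e τ h l k s)) domain) {p : Pt}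
    (hp : p ∈ domain) :
    dX f p = (iteratedDeriv 2 τ p.2.2.1 + b * deriv τ p.2.2.1)
      + (h p.2.2.1 * (b - e) * √p.2.1 + 2 * (deriv l p.2.2.1 + b * l p.2.2.1 / 2)) / (2 * √p.1) ∧
    dX (dX f) p = -(h p.2.2.1 * (b - e) * √p.2.1 + 2 * (deriv l p.2.2.1 + b * l p.2.2.1 / 2))
      / (4 * p.1 * √p.1) ∧
    dY f p = (iteratedDeriv 2 τ p.2.2.1 + e * deriv τ p.2.2.1)
      + (h p.2.2.1 * (b - e) * √p.1 + 2 * (deriv k p.2.2.1 + e * k p.2.2.1 / 2))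
        / (2 * √p.2.1) ∧
    dY (dY f) p = -(h p.2.2.1 * (b - e) * √p.1 + 2 * (deriv k p.2.2.1 + e * k p.2.2.1 / 2))
      / (4 * p.2.1 * √p.2.1) := by
  obtain ⟨hx, hxx⟩ := partials_x_sqrtExpr (f := f)
    (fun q => iteratedDeriv 2 τ q.2.1 + b * deriv τ q.2.1)
    (fun q => h q.2.1 * (b - e) * √q.1 + 2 * (deriv l q.2.1 + b * l q.2.1 / 2)) (fun _ => 0)
    (fun q => (iteratedDeriv 2 τ q.2.1 + e * deriv τ q.2.1) * q.1
      + 2 * (deriv k q.2.1 + e * k q.2.1 / 2) * √q.1 + s q.2.1)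
    (fun p hp => by rw [hf hp]; simp only [lift, lam]; ring) hp
  obtain ⟨hy, hyy⟩ := partials_y_sqrtExpr (f := f)
    (fun _ q => iteratedDeriv 2 τ q.1 + e * deriv τ q.1)
    (fun x q => h q.1 * (b - e) * √x + 2 * (deriv k q.1 + e * k q.1 / 2)) (fun _ _ => 0)
    (fun x q => (iteratedDeriv 2 τ q.1 + b * deriv τ q.1) * x
      + 2 * (deriv l q.1 + b * l q.1 / 2) * √x + s q.1)
    (fun p hp => by rw [hf hp]; simp only [lift, lam]; ring) hp
  exact ⟨by rw [hx]; ring, by rw [hxx]; ring, by rw [hy]; ring, by rw [hyy]; ring⟩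

/-- The equation for `λ` becomes a polynomial in `√x` and `√y`, whose coefficients are the ordinary
differential equations for `τ, l, k, s`. -/
lemma generator_lam (hτ : ContDiff ℝ ∞ τ) (hh : ContDiff ℝ ∞ h)
    (hl : ContDiff ℝ ∞ l) (hk : ContDiff ℝ ∞ k) (hs : ContDiff ℝ ∞ s) (hh' : ∀ t, deriv h t = 0)
    (ha : ∀ t, h t * (1 / 4 - a) = 0) (hd : ∀ t, h t * (1 / 4 - d) = 0)
    (hla : ∀ t, l t * (1 / 4 - a) = 0) (hkd : ∀ t, k t * (1 / 4 - d) = 0)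
    {f : Pt → ℝ} (hf : EqOn f (lift (lam b e τ h l k s)) domain) {p : Pt} (hp : p ∈ domain) :
    generator a b d e f p =
      (iteratedDeriv 3 τ p.2.2.1 - b ^ 2 * deriv τ p.2.2.1) * √p.1 ^ 2
      + (iteratedDeriv 3 τ p.2.2.1 - e ^ 2 * deriv τ p.2.2.1) * √p.2.1 ^ 2
      + (-((b ^ 2 - e ^ 2) * h p.2.2.1) / 2) * (√p.1 * √p.2.1)
      + 2 * (iteratedDeriv 2 l p.2.2.1 - b ^ 2 / 4 * l p.2.2.1) * √p.1
      + 2 * (iteratedDeriv 2 k p.2.2.1 - e ^ 2 / 4 * k p.2.2.1) * √p.2.1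
      + ((a + d) * iteratedDeriv 2 τ p.2.2.1 + (a * b + d * e) * deriv τ p.2.2.1
        + deriv s p.2.2.1) := by
  obtain ⟨h1, h2, h3, h4⟩ := partials_lam hf hp
  have ht : dT f p = _ := (dT_congr hf hp).trans (hasDerivAt_lam hτ (hh.differentiable (by simp))
    hl hk (hs.differentiable (by simp)) p.1 p.2.1 p.2.2.1).deriv
  rw [generator, h1, h2, h3, h4, ht, hh']
  have ha := ha p.2.2.1
  have hd := hd p.2.2.1
  have hla' := deriv_mul_eq_zero hla p.2.2.1
  have hkd' := deriv_mul_eq_zero hkd p.2.2.1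
  have hla := hla p.2.2.1
  have hkd := hkd p.2.2.1
  have hsx := Real.sqrt_pos.2 hp.1
  have hsy := Real.sqrt_pos.2 hp.2
  have ex : p.1 = √p.1 ^ 2 := (Real.sq_sqrt hp.1.le).symm
  have ey : p.2.1 = √p.2.1 ^ 2 := (Real.sq_sqrt hp.2.le).symm
  generalize √p.1 = q at *
  generalize √p.2.1 = r at *
  rw [ex, ey]
  field_simp
  linear_combination (-4 * r ^ 2 * (b - e)) * ha + (-4 * q ^ 2 * (b - e)) * hd
    - 8 * r * hla' - 4 * r * b * hla - 8 * q * hkd' - 4 * q * e * hkd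

end boundary

/-! ### The general form of the infinitesimal symmetries -/

section generalForm

variable {a b d e : ℝ} {v : Field}

/-- The coefficients of `v` on the domain are given by `τ, h, l, k, s` and `μ`. -/
def HasForm (b e : ℝ) (v : Field) (τ h l k s : ℝ → ℝ) (μ : ℝ → ℝ → ℝ → ℝ) : Prop :=
  ∀ x y t u : ℝ, 0 < x → 0 < y →
    v (x, y, t, u) =
      (deriv τ t * x + √x * (√y * h t + l t),
       deriv τ t * y + √y * (-√x * h t + k t),
       τ t,
       lam b e τ h l k s x y t * u + μ x y t)

lemma exists_hasForm_of_mem_symmetries (hv : v ∈ symmetries a b d e) :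
    ∃ (τ h l k s : ℝ → ℝ) (μ : ℝ → ℝ → ℝ → ℝ), IsAdmissible a b d e τ h l k s ∧
      IsSolution a b d e μ ∧ HasForm b e v τ h l k s μ := by
  obtain ⟨hsym, hbd⟩ := hv
  have hsm := (contDiffOn_iff_smoothComponents v).1 hsym.smooth
  have D := (invariant_iff_determiningEquations hsm hsym.zero_off).1 hsym
  obtain ⟨τ, h, l, k, hτ, hh, hl, hk, F⟩ := D.exists_coefficientForm hsm
  obtain ⟨Λ, μ, hΛ, hμ, hφ⟩ := D.exists_phi_eq hsm
  have hτ' := (ContDiff.deriv_infty hτ).differentiable (by simp)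
  have hU : EqOn (dU (cφ v)) (lift Λ) domain :=
    (dU_congr hφ).trans fun p _ => congrFun (dU_lift_mul_u_add Λ μ) p
  have hX := fun p hp => (dX_congr hU hp).symm.trans ((F.ux_eq_iff hτ'
    (hh.differentiable (by simp)) (hl.differentiable (by simp)) hp).1 (D.ux_eq p hp))
  have hY := fun p hp => (dY_congr hU hp).symm.trans ((F.uy_eq_iff hτ'
    (hh.differentiable (by simp)) (hk.differentiable (by simp)) hp).1 (D.uy_eq p hp))
  obtain ⟨hh', s, hs, hΛs⟩ := exists_eq_lam_add_singularPart hτ hh hl hk hΛ hX hY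
  have hgen : ∀ p ∈ domain, generator a b d e (lift Λ) p * p.2.2.2
      + generator a b d e (lift μ) p = 0 := fun p hp =>
    (generator_mul_u_add a b d e hΛ hμ hφ hp).symm.trans (D.one_eq p hp)
  have hgμ : ∀ p ∈ domain, generator a b d e (lift μ) p = 0 := fun p hp => by
    have := hgen (p.1, p.2.1, p.2.2.1, 0) hp
    rw [mul_zero, zero_add] at this
    exact this
  have hgΛ : ∀ p ∈ domain, generator a b d e (lift Λ) p = 0 := fun p hp => by
    have h1 : _ * (1 : ℝ) + _ = 0 := hgen (p.1, p.2.1, p.2.2.1, 1) hp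
    rw [hgμ (p.1, p.2.1, p.2.2.1, 1) hp, mul_one, add_zero] at h1
    exact h1
  have hvan := fun t => singularPart_vanishes hφ hΛs (fun q r t hq hr =>
    singular_coefficients hτ hh hl hk hs hh' (fun p hp => hΛs _ _ _ hp.1 hp.2) hgΛ q r t hq hr)
    hbd t
  have hΛlam : EqOn (lift Λ) (lift (lam b e τ h l k s)) domain := fun p hp => by
    obtain ⟨h1, h2, h3, h4⟩ := hvan p.2.2.1
    have e1 : (a - 1 / 4) * (√p.2.1 * h p.2.2.1 + l p.2.2.1) = 0 := by
      linear_combination -√p.2.1 * h1 - h3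
    have e2 : (d - 1 / 4) * (√p.1 * h p.2.2.1 - k p.2.2.1) = 0 := by
      linear_combination -√p.1 * h2 + h4
    rw [lift, hΛs _ _ _ hp.1 hp.2, singularPart, e1, e2]
    simp [lift]
  have hpoly := fun t => eq_zero_of_forall_pos_pos fun q r hq hr => by
    have hp : ((q ^ 2, r ^ 2, t, 0) : Pt) ∈ domain := ⟨by positivity, by positivity⟩
    have := (generator_lam hτ hh hl hk hs hh' (fun t => (hvan t).1) (fun t => (hvan t).2.1)
      (fun t => (hvan t).2.2.1) (fun t => (hvan t).2.2.2) hΛlam hp).symm.trans (hgΛ _ hp)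
    simp only [Real.sqrt_sq hq.le, Real.sqrt_sq hr.le] at this
    exact this
  refine ⟨τ, h, l, k, s, μ, ⟨hτ, hh, hl, hk, hs, fun t => (hvan t).1, fun t => (hvan t).2.1,
    fun t => (hvan t).2.2.1, fun t => (hvan t).2.2.2, hh', fun t => (hpoly t).1, fun t => ?_,
    fun t => ?_, fun t => ?_, fun t => ?_, fun t => (hpoly t).2.2.2.2.2⟩,
    isSolution_iff.2 ⟨hμ, hgμ⟩, fun x y t u hx hy => ?_⟩
  · linear_combination (hpoly t).2.1 - (hpoly t).1
  · linear_combination -2 * (hpoly t).2.2.1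
  · linear_combination (hpoly t).2.2.2.1 / 2
  · linear_combination (hpoly t).2.2.2.2.1 / 2
  · have hp : ((x, y, t, u) : Pt) ∈ domain := ⟨hx, hy⟩
    refine Prod.ext (F.ξ_eq _ hp) (Prod.ext (F.γ_eq _ hp) (Prod.ext (F.τ_eq _ hp) ?_))
    exact (hφ hp).trans (congrArg (fun z => z * u + μ x y t) (hΛlam hp))

lemma smooth_lift_lam {τ h l k s : ℝ → ℝ} (H : IsAdmissible a b d e τ h l k s) :
    Smooth (lift (lam b e τ h l k s)) := by
  have h1 := H.smooth_h
  have h2 := H.smooth_l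
  have h3 := H.smooth_k
  have h4 := H.smooth_s
  have h5 := ContDiff.deriv_infty H.smooth_tau
  have h6 := ContDiff.deriv_infty h5
  have h7 := ContDiff.deriv_infty h2
  have h8 := ContDiff.deriv_infty h3
  unfold lift lam
  simp only [Smooth, iteratedDeriv_two_eq]
  fun_prop (disch := first | exact fun _ hp => hp.1.ne' | exact fun _ hp => hp.2.ne')

lemma mem_symmetries_of_hasForm {τ h l k s : ℝ → ℝ} {μ : ℝ → ℝ → ℝ → ℝ}
    (h0 : ∀ p, p ∉ domain → v p = 0) (H : IsAdmissible a b d e τ h l k s)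
    (hμ : IsSolution a b d e μ) (hF : HasForm b e v τ h l k s μ) : v ∈ symmetries a b d e := by
  have F : CoefficientForm v τ h l k :=
    ⟨fun p hp => congrArg (fun z => z.2.2.1) (hF p.1 p.2.1 p.2.2.1 p.2.2.2 hp.1 hp.2),
      fun p hp => congrArg (fun z => z.1) (hF p.1 p.2.1 p.2.2.1 p.2.2.2 hp.1 hp.2),
      fun p hp => congrArg (fun z => z.2.1) (hF p.1 p.2.1 p.2.2.1 p.2.2.2 hp.1 hp.2)⟩
  have hφ : EqOn (cφ v) (fun p => lift (lam b e τ h l k s) p * p.2.2.2 + lift μ p) domain :=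
    fun p hp => congrArg (fun z => z.2.2.2) (hF p.1 p.2.1 p.2.2.1 p.2.2.2 hp.1 hp.2)
  obtain ⟨hμs, hμg⟩ := isSolution_iff.1 hμ
  have hΛ := smooth_lift_lam H
  have hU : EqOn (dU (cφ v)) (lift (lam b e τ h l k s)) domain :=
    (dU_congr hφ).trans fun p _ => congrFun (dU_lift_mul_u_add _ μ) p
  have hsm : SmoothComponents v := by
    have h1 := H.smooth_h
    have h2 := H.smooth_l
    have h3 := H.smooth_k
    have h4 := H.smooth_tau
    have h5 := ContDiff.deriv_infty H.smooth_tau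
    have hu : ContDiff ℝ ∞ fun p : Pt => p.2.2.2 := by fun_prop
    refine ⟨ContDiffOn.congr ?_ F.ξ_eq, ContDiffOn.congr ?_ F.γ_eq, ContDiffOn.congr ?_ F.τ_eq,
      ContDiffOn.congr ((hΛ.mul hu.contDiffOn).add hμs) hφ⟩ <;>
    fun_prop (disch := first | exact fun _ hp => hp.1.ne' | exact fun _ hp => hp.2.ne')
  have hτ' := (ContDiff.deriv_infty H.smooth_tau).differentiable (by simp)
  have hh := H.smooth_h.differentiable (by simp)
  have hl := H.smooth_l.differentiable (by simp)
  have hk := H.smooth_k.differentiable (by simp)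
  refine ⟨(invariant_iff_determiningEquations hsm h0).2
    ⟨?_, ?_, ?_, ?_, ?_, ?_, ?_, ?_, ?_, ?_, ?_, ?_⟩, ?_, ?_⟩
  · exact (dX_congr F.τ_eq).trans fun p _ => by simp [dX]
  · exact (dY_congr F.τ_eq).trans fun p _ => by simp [dY]
  · exact (dU_congr F.τ_eq).trans fun p _ => by simp [dU]
  · exact (dU_congr F.ξ_eq).trans fun p _ => by simp [dU]
  · exact (dU_congr F.γ_eq).trans fun p _ => by simp [dU]
  · exact (dU_congr hU).trans fun p _ => by simp [dU, lift]
  · intro p hp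
    rw [(F.partials_γ hτ' hh hk hp).2.2.1, (F.partials_ξ hτ' hh hl hp).2.2.1]
    have hsx := Real.sqrt_pos.2 hp.1
    have hsy := Real.sqrt_pos.2 hp.2
    have ex := Real.sq_sqrt hp.1.le
    have ey := Real.sq_sqrt hp.2.le
    field_simp
    linear_combination h p.2.2.1 * p.2.1 * ex - h p.2.2.1 * p.1 * ey
  · intro p hp
    rw [(F.partials_ξ hτ' hh hl hp).1, F.ξ_eq p hp, F.dT_τ hp]
    have hsx := Real.sqrt_pos.2 hp.1
    have ex := Real.sq_sqrt hp.1.le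
    field_simp
    linear_combination (√p.2.1 * h p.2.2.1 + l p.2.2.1) * ex
  · intro p hp
    rw [(F.partials_γ hτ' hh hk hp).1, F.γ_eq p hp, F.dT_τ hp]
    have hsx := Real.sqrt_pos.2 hp.2
    have ex := Real.sq_sqrt hp.2.le
    field_simp
    linear_combination (-√p.1 * h p.2.2.1 + k p.2.2.1) * ex
  · intro p hp
    rw [F.ux_eq_iff hτ' hh hl hp, (partials_lam hU hp).1, H.h_eq, iteratedDeriv_two_eq]
    have hsx := Real.sqrt_pos.2 hp.1
    have hsy := Real.sqrt_pos.2 hp.2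
    have h1 := H.h_a p.2.2.1
    have h2 := H.h_d p.2.2.1
    have h3 := H.l_a p.2.2.1
    have hx := hp.1
    field_simp
    linear_combination 4 * p.1 * h2 + 4 * √p.2.1 ^ 2 * h1 + 4 * √p.2.1 * h3
  · intro p hp
    rw [F.uy_eq_iff hτ' hh hk hp, (partials_lam hU hp).2.2.1, H.h_eq, iteratedDeriv_two_eq]
    have hsx := Real.sqrt_pos.2 hp.1
    have hsy := Real.sqrt_pos.2 hp.2
    have h1 := H.h_a p.2.2.1
    have h2 := H.h_d p.2.2.1
    have h3 := H.k_d p.2.2.1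
    have hx := hp.2
    field_simp
    linear_combination -4 * p.2.1 * h1 - 4 * √p.1 ^ 2 * h2 + 4 * √p.1 * h3
  · intro p hp
    have h1 := generator_mul_u_add a b d e hΛ hμs hφ hp
    have h2 := generator_lam (b := b) (e := e) H.smooth_tau H.smooth_h H.smooth_l H.smooth_k
      H.smooth_s H.h_eq H.h_a H.h_d H.l_a H.k_d (fun _ _ => rfl) hp
    rw [hμg p hp, h2] at h1
    refine Eq.trans (b := generator a b d e (cφ v) p) rfl (h1.trans ?_)
    have e1 := H.tau_eq p.2.2.1
    have e2 := H.tau_be p.2.2.1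
    have e3 := H.h_be p.2.2.1
    have e4 := H.l_eq p.2.2.1
    have e5 := H.k_eq p.2.2.1
    have e6 := H.s_eq p.2.2.1
    have e7 : iteratedDeriv 3 τ p.2.2.1 - e ^ 2 * deriv τ p.2.2.1 = 0 := by
      linear_combination e1 + e2
    rw [e1, e3, e4, e5, e6, e7]
    ring
  · intro _ y t u hy
    refine (tendsto_sqrt_mul_lam_x (b := b) (e := e) (τ := τ) (h := h) (l := l) (k := k)
      (s := s) y t).congr' ?_
    filter_upwards [self_mem_nhdsWithin] with x hx
    rw [phiU_eq hφ t u hx hy]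
  · intro _ x t u hx
    refine (tendsto_sqrt_mul_lam_y (b := b) (e := e) (τ := τ) (h := h) (l := l) (k := k)
      (s := s) x t).congr' ?_
    filter_upwards [self_mem_nhdsWithin] with y hy
    rw [phiU_eq hφ t u hx hy]

end generalForm

/-! ### The linear symmetries -/

section linear

variable {a b d e : ℝ} {v : Field}

lemma isSolution_zero : IsSolution a b d e fun _ _ _ => 0 :=
  ⟨contDiffOn_const, fun x y t _ _ => by simp⟩

lemma mem_linearSymmetries_iff_hasForm : v ∈ linearSymmetries a b d e ↔
    (∀ p, p ∉ domain → v p = 0) ∧ ∃ τ h l k s : ℝ → ℝ, IsAdmissible a b d e τ h l k s ∧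
      HasForm b e v τ h l k s fun _ _ _ => 0 := by
  constructor
  · rintro ⟨hv, h0⟩
    obtain ⟨τ, h, l, k, s, μ, H, -, hF⟩ := exists_hasForm_of_mem_symmetries hv
    refine ⟨hv.1.zero_off, τ, h, l, k, s, H, fun x y t u hx hy => ?_⟩
    have h1 := h0 x y t
    rw [hF x y t 0 hx hy] at h1
    have h2 : μ x y t = 0 := by simpa using h1
    rw [hF x y t u hx hy, h2]
  · rintro ⟨h0, τ, h, l, k, s, H, hF⟩
    refine ⟨mem_symmetries_of_hasForm h0 H isSolution_zero hF, fun x y t => ?_⟩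
    by_cases hp : ((x, y, t, 0) : Pt) ∈ domain
    · rw [hF x y t 0 hp.1 hp.2]; simp
    · rw [h0 _ hp]; rfl

lemma vMu_of_mem {μ : ℝ → ℝ → ℝ → ℝ} {p : Pt} (hp : p ∈ domain) :
    vMu μ p = (0, 0, 0, μ p.1 p.2.1 p.2.2.1) := indicator_of_mem hp _

lemma vMu_of_notMem {μ : ℝ → ℝ → ℝ → ℝ} {p : Pt} (hp : p ∉ domain) : vMu μ p = 0 :=
  indicator_of_notMem hp _

lemma mem_symmetries_iff_exists_add (v : Field) : v ∈ symmetries a b d e ↔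
    ∃ w ∈ linearSymmetries a b d e, ∃ μ, IsSolution a b d e μ ∧ v = w + vMu μ := by
  constructor
  · intro hv
    obtain ⟨τ, h, l, k, s, μ, H, hμ, hF⟩ := exists_hasForm_of_mem_symmetries hv
    refine ⟨v - vMu μ, mem_linearSymmetries_iff_hasForm.2 ⟨fun p hp => ?_, τ, h, l, k, s, H,
      fun x y t u hx hy => ?_⟩, μ, hμ, (sub_add_cancel v _).symm⟩
    · rw [Pi.sub_apply, hv.1.zero_off p hp, vMu_of_notMem hp, sub_zero]
    · rw [Pi.sub_apply, hF x y t u hx hy, vMu_of_mem (p := (x, y, t, u)) ⟨hx, hy⟩]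
      simp
  · rintro ⟨w, hw, μ, hμ, rfl⟩
    obtain ⟨h0, τ, h, l, k, s, H, hF⟩ := mem_linearSymmetries_iff_hasForm.1 hw
    refine mem_symmetries_of_hasForm (fun p hp => ?_) H hμ fun x y t u hx hy => ?_
    · rw [Pi.add_apply, h0 p hp, vMu_of_notMem hp, add_zero]
    · rw [Pi.add_apply, hF x y t u hx hy, vMu_of_mem (p := (x, y, t, u)) ⟨hx, hy⟩]
      simp

end linear

lemma field_of_mem {ξ γ τ Λ : ℝ → ℝ → ℝ → ℝ} {p : Pt} (hp : p ∈ domain) : field ξ γ τ Λ p =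
    (ξ p.1 p.2.1 p.2.2.1, γ p.1 p.2.1 p.2.2.1, τ p.1 p.2.1 p.2.2.1,
      Λ p.1 p.2.1 p.2.2.1 * p.2.2.2) := indicator_of_mem hp _

lemma field_of_notMem {ξ γ τ Λ : ℝ → ℝ → ℝ → ℝ} {p : Pt} (hp : p ∉ domain) :
    field ξ γ τ Λ p = 0 := indicator_of_notMem hp _

/-- The functions which determine a linear symmetry, together with their derivatives: `τ₁, τ₂` are
the first two derivatives of `τ₀`, and `l₁, k₁` are the derivatives of `l₀, k₀`. -/
structure Datum where
  (τ₀ τ₁ τ₂ l₀ l₁ k₀ k₁ s : ℝ → ℝ)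
  h : ℝ

namespace Datum

/-- The system of ordinary differential equations, in first order form. -/
structure Valid (a b d e : ℝ) (D : Datum) : Prop where
  τ₀' : ∀ t, HasDerivAt D.τ₀ (D.τ₁ t) t
  τ₁' : ∀ t, HasDerivAt D.τ₁ (D.τ₂ t) t
  τ₂' : ∀ t, HasDerivAt D.τ₂ (b ^ 2 * D.τ₁ t) t
  l₀' : ∀ t, HasDerivAt D.l₀ (D.l₁ t) t
  l₁' : ∀ t, HasDerivAt D.l₁ (b ^ 2 / 4 * D.l₀ t) t
  k₀' : ∀ t, HasDerivAt D.k₀ (D.k₁ t) t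
  k₁' : ∀ t, HasDerivAt D.k₁ (e ^ 2 / 4 * D.k₀ t) t
  s' : ∀ t, HasDerivAt D.s (-(a + d) * D.τ₂ t - (a * b + d * e) * D.τ₁ t) t
  h_a : D.h * (1 / 4 - a) = 0
  h_d : D.h * (1 / 4 - d) = 0
  l_a : ∀ t, D.l₀ t * (1 / 4 - a) = 0
  k_d : ∀ t, D.k₀ t * (1 / 4 - d) = 0
  τ_be : ∀ t, (b ^ 2 - e ^ 2) * D.τ₁ t = 0
  h_be : (b ^ 2 - e ^ 2) * D.h = 0

/-- The coefficient `λ` of the symmetry given by a datum. -/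
def coeff (b e : ℝ) (D : Datum) (x y t : ℝ) : ℝ :=
  (D.τ₂ t + b * D.τ₁ t) * x + D.h * (b - e) * √x * √y + 2 * (D.l₁ t + b * D.l₀ t / 2) * √x
    + (D.τ₂ t + e * D.τ₁ t) * y + 2 * (D.k₁ t + e * D.k₀ t / 2) * √y + D.s t

/-- The vector field given by a datum. -/
def toField (b e : ℝ) (D : Datum) : Field :=
  field (fun x y t => D.τ₁ t * x + √x * (√y * D.h + D.l₀ t))
    (fun x y t => D.τ₁ t * y + √y * (-√x * D.h + D.k₀ t)) (fun _ _ t => D.τ₀ t) (D.coeff b e)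

lemma toField_of_mem {b e : ℝ} {D : Datum} {p : Pt} (hp : p ∈ domain) : D.toField b e p =
    (D.τ₁ p.2.2.1 * p.1 + √p.1 * (√p.2.1 * D.h + D.l₀ p.2.2.1),
      D.τ₁ p.2.2.1 * p.2.1 + √p.2.1 * (-√p.1 * D.h + D.k₀ p.2.2.1), D.τ₀ p.2.2.1,
      D.coeff b e p.1 p.2.1 p.2.2.1 * p.2.2.2) := field_of_mem hp

lemma toField_of_notMem {b e : ℝ} {D : Datum} {p : Pt} (hp : p ∉ domain) :
    D.toField b e p = 0 := field_of_notMem hp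

/-- Bootstrapping: the solutions of `f'' = c f` are smooth. -/
lemma _root_.contDiff_of_hasDerivAt_hasDerivAt {f g : ℝ → ℝ} {c : ℝ}
    (hf : ∀ t, HasDerivAt f (g t) t) (hg : ∀ t, HasDerivAt g (c * f t) t) :
    ContDiff ℝ ∞ f ∧ ContDiff ℝ ∞ g := by
  have hf' : deriv f = g := funext fun t => (hf t).deriv
  have hg' : deriv g = fun t => c * f t := funext fun t => (hg t).deriv
  have h : ∀ n : ℕ, ContDiff ℝ n f ∧ ContDiff ℝ n g := by
    intro n
    induction n with
    | zero =>
      exact ⟨contDiff_zero.2 (continuous_iff_continuousAt.2 fun t => (hf t).continuousAt),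
        contDiff_zero.2 (continuous_iff_continuousAt.2 fun t => (hg t).continuousAt)⟩
    | succ n ih =>
      constructor
      · exact contDiff_succ_iff_deriv.2 ⟨fun t => (hf t).differentiableAt, by simp, hf' ▸ ih.2⟩
      · exact contDiff_succ_iff_deriv.2 ⟨fun t => (hg t).differentiableAt, by simp,
          hg' ▸ contDiff_const.mul ih.1⟩
  exact ⟨contDiff_infty.2 fun n => (h n).1, contDiff_infty.2 fun n => (h n).2⟩

lemma _root_.contDiff_infty_of_hasDerivAt {f g : ℝ → ℝ} (hf : ∀ t, HasDerivAt f (g t) t)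
    (hg : ContDiff ℝ ∞ g) : ContDiff ℝ ∞ f :=
  contDiff_infty_iff_deriv.2 ⟨fun t => (hf t).differentiableAt,
    (funext fun t => (hf t).deriv : deriv f = g) ▸ hg⟩

section

variable {a b d e : ℝ} {D : Datum}

namespace Valid

lemma deriv_τ₀ (V : D.Valid a b d e) : deriv D.τ₀ = D.τ₁ := funext fun t => (V.τ₀' t).deriv

lemma deriv_τ₁ (V : D.Valid a b d e) : deriv D.τ₁ = D.τ₂ := funext fun t => (V.τ₁' t).deriv

lemma deriv_l₀ (V : D.Valid a b d e) : deriv D.l₀ = D.l₁ := funext fun t => (V.l₀' t).deriv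

lemma deriv_k₀ (V : D.Valid a b d e) : deriv D.k₀ = D.k₁ := funext fun t => (V.k₀' t).deriv

lemma isAdmissible (V : D.Valid a b d e) :
    IsAdmissible a b d e D.τ₀ (fun _ => D.h) D.l₀ D.k₀ D.s := by
  have hτ := contDiff_of_hasDerivAt_hasDerivAt V.τ₁' V.τ₂'
  refine ⟨contDiff_infty_of_hasDerivAt V.τ₀' hτ.1, contDiff_const,
    (contDiff_of_hasDerivAt_hasDerivAt V.l₀' V.l₁').1,
    (contDiff_of_hasDerivAt_hasDerivAt V.k₀' V.k₁').1,
    contDiff_infty_of_hasDerivAt V.s' ((contDiff_const.mul hτ.2).sub (contDiff_const.mul hτ.1)),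
    fun _ => V.h_a, fun _ => V.h_d, V.l_a, V.k_d, fun t => deriv_const t _, fun t => ?_,
    fun t => ?_, fun _ => V.h_be, fun t => ?_, fun t => ?_, fun t => ?_⟩
  · rw [iteratedDeriv_three_eq, V.deriv_τ₀, V.deriv_τ₁, (V.τ₂' t).deriv, sub_self]
  · rw [V.deriv_τ₀, V.τ_be]
  · rw [iteratedDeriv_two_eq, V.deriv_l₀, (V.l₁' t).deriv, sub_self]
  · rw [iteratedDeriv_two_eq, V.deriv_k₀, (V.k₁' t).deriv, sub_self]
  · rw [iteratedDeriv_two_eq, V.deriv_τ₀, V.deriv_τ₁, (V.s' t).deriv]; ring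

lemma coeff_eq (V : D.Valid a b d e) :
    D.coeff b e = lam b e D.τ₀ (fun _ => D.h) D.l₀ D.k₀ D.s := by
  funext x y t
  simp only [coeff, lam, iteratedDeriv_two_eq, V.deriv_τ₀, V.deriv_τ₁, V.deriv_l₀, V.deriv_k₀]

lemma hasForm (V : D.Valid a b d e) :
    HasForm b e (D.toField b e) D.τ₀ (fun _ => D.h) D.l₀ D.k₀ D.s fun _ _ _ => 0 := by
  intro x y t u hx hy
  rw [toField_of_mem (p := (x, y, t, u)) ⟨hx, hy⟩, V.coeff_eq, V.deriv_τ₀, add_zero]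

lemma toField_mem (V : D.Valid a b d e) : D.toField b e ∈ linearSymmetries a b d e :=
  mem_linearSymmetries_iff_hasForm.2 ⟨fun _ hp => toField_of_notMem hp, _, _, _, _, _,
    V.isAdmissible, V.hasForm⟩

end Valid

end

lemma _root_.LongstaffSchwartz.mem_linearSymmetries_iff {a b d e : ℝ} {v : Field} :
    v ∈ linearSymmetries a b d e ↔ ∃ D : Datum, D.Valid a b d e ∧ v = D.toField b e := by
  constructor
  · intro hv
    obtain ⟨h0, τ, h, l, k, s, H, hF⟩ := mem_linearSymmetries_iff_hasForm.1 hv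
    have hd : ∀ {f : ℝ → ℝ}, ContDiff ℝ ∞ f → ∀ t, HasDerivAt f (deriv f t) t := fun hf t =>
      (hf.differentiable (by simp) t).hasDerivAt
    have hconst : ∀ t, h t = h 0 := fun t =>
      is_const_of_deriv_eq_zero (H.smooth_h.differentiable (by simp)) H.h_eq t 0
    have hτ1 := ContDiff.deriv_infty H.smooth_tau
    have hτ2 := ContDiff.deriv_infty hτ1
    refine ⟨⟨τ, deriv τ, deriv (deriv τ), l, deriv l, k, deriv k, s, h 0⟩,
      ⟨hd H.smooth_tau, hd hτ1, fun t => ?_, hd H.smooth_l, fun t => ?_, hd H.smooth_k,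
        fun t => ?_, fun t => ?_, H.h_a 0, H.h_d 0, H.l_a, H.k_d, H.tau_be, H.h_be 0⟩, ?_⟩
    · refine (hd hτ2 t).congr_deriv ?_
      have := H.tau_eq t
      rw [iteratedDeriv_three_eq] at this
      linear_combination this
    · refine (hd (ContDiff.deriv_infty H.smooth_l) t).congr_deriv ?_
      have := H.l_eq t
      rw [iteratedDeriv_two_eq] at this
      linear_combination this
    · refine (hd (ContDiff.deriv_infty H.smooth_k) t).congr_deriv ?_
      have := H.k_eq t
      rw [iteratedDeriv_two_eq] at this
      linear_combination this
    · refine (hd H.smooth_s t).congr_deriv ?_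
      have := H.s_eq t
      rw [iteratedDeriv_two_eq] at this
      linear_combination this
    · funext p
      by_cases hp : p ∈ domain
      · rw [toField_of_mem hp]
        refine (hF p.1 p.2.1 p.2.2.1 p.2.2.2 hp.1 hp.2).trans ?_
        simp only [coeff, lam, iteratedDeriv_two_eq, hconst p.2.2.1, add_zero]
      · rw [toField_of_notMem hp, h0 p hp]
  · rintro ⟨D, V, rfl⟩
    exact V.toField_mem

/-- The datum of `c • v + w`. -/
def smulAdd (c : ℝ) (A B : Datum) : Datum where
  τ₀ t := c * A.τ₀ t + B.τ₀ t
  τ₁ t := c * A.τ₁ t + B.τ₁ t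
  τ₂ t := c * A.τ₂ t + B.τ₂ t
  l₀ t := c * A.l₀ t + B.l₀ t
  l₁ t := c * A.l₁ t + B.l₁ t
  k₀ t := c * A.k₀ t + B.k₀ t
  k₁ t := c * A.k₁ t + B.k₁ t
  s t := c * A.s t + B.s t
  h := c * A.h + B.h

section combination

variable {a b d e c : ℝ} {A B : Datum}

lemma Valid.smulAdd (VA : A.Valid a b d e) (VB : B.Valid a b d e) :
    (smulAdd c A B).Valid a b d e where
  τ₀' t := ((VA.τ₀' t).const_mul c).add (VB.τ₀' t)
  τ₁' t := ((VA.τ₁' t).const_mul c).add (VB.τ₁' t)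
  τ₂' t := (((VA.τ₂' t).const_mul c).add (VB.τ₂' t)).congr_deriv (by
    simp only [Datum.smulAdd]; ring)
  l₀' t := ((VA.l₀' t).const_mul c).add (VB.l₀' t)
  l₁' t := (((VA.l₁' t).const_mul c).add (VB.l₁' t)).congr_deriv (by
    simp only [Datum.smulAdd]; ring)
  k₀' t := ((VA.k₀' t).const_mul c).add (VB.k₀' t)
  k₁' t := (((VA.k₁' t).const_mul c).add (VB.k₁' t)).congr_deriv (by
    simp only [Datum.smulAdd]; ring)
  s' t := (((VA.s' t).const_mul c).add (VB.s' t)).congr_deriv (by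
    simp only [Datum.smulAdd]; ring)
  h_a := by simp only [Datum.smulAdd]; linear_combination c * VA.h_a + VB.h_a
  h_d := by simp only [Datum.smulAdd]; linear_combination c * VA.h_d + VB.h_d
  l_a t := by simp only [Datum.smulAdd]; linear_combination c * VA.l_a t + VB.l_a t
  k_d t := by simp only [Datum.smulAdd]; linear_combination c * VA.k_d t + VB.k_d t
  τ_be t := by simp only [Datum.smulAdd]; linear_combination c * VA.τ_be t + VB.τ_be t
  h_be := by simp only [Datum.smulAdd]; linear_combination c * VA.h_be + VB.h_be

lemma toField_smulAdd : (smulAdd c A B).toField b e = c • A.toField b e + B.toField b e := by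
  funext p
  by_cases hp : p ∈ domain
  · simp only [Pi.add_apply, Pi.smul_apply, toField_of_mem hp, smulAdd, coeff, Prod.smul_mk,
      Prod.mk_add_mk, smul_eq_mul, Prod.mk.injEq, true_and]
    exact ⟨by ring, by ring, by ring⟩
  · simp only [Pi.add_apply, Pi.smul_apply, toField_of_notMem hp, smul_zero, add_zero]

end combination

/-- The datum of the zero field. -/
def zero : Datum := ⟨0, 0, 0, 0, 0, 0, 0, 0, 0⟩

lemma zero_valid (a b d e : ℝ) : zero.Valid a b d e := by
  constructor <;> simp [zero, hasDerivAt_zero]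

lemma toField_zero (b e : ℝ) : zero.toField b e = 0 := by
  funext p
  by_cases hp : p ∈ domain
  · simp [toField_of_mem hp, zero, coeff]
  · simp [toField_of_notMem hp]

end Datum

open Datum

/-- The linear symmetries as a linear subspace of the space of vector fields. -/
def linearSubmodule (a b d e : ℝ) : Submodule ℝ Field where
  carrier := linearSymmetries a b d e
  zero_mem' := mem_linearSymmetries_iff.2 ⟨zero, zero_valid a b d e, (toField_zero b e).symm⟩
  add_mem' := by
    intro v w hv hw
    obtain ⟨A, VA, rfl⟩ := mem_linearSymmetries_iff.1 hv
    obtain ⟨B, VB, rfl⟩ := mem_linearSymmetries_iff.1 hw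
    exact mem_linearSymmetries_iff.2 ⟨_, VA.smulAdd (c := 1) VB, by
      rw [toField_smulAdd, one_smul]⟩
  smul_mem' := by
    intro c v hv
    obtain ⟨A, VA, rfl⟩ := mem_linearSymmetries_iff.1 hv
    exact mem_linearSymmetries_iff.2 ⟨_, VA.smulAdd (c := c) (zero_valid a b d e), by
      rw [toField_smulAdd, toField_zero, add_zero]⟩

/-! ### The Lie bracket -/

namespace Datum

/-- The datum of the Lie bracket of two linear symmetries. -/
def bracket (a b d e : ℝ) (A B : Datum) : Datum where
  τ₀ t := A.τ₀ t * B.τ₁ t - B.τ₀ t * A.τ₁ t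
  τ₁ t := A.τ₀ t * B.τ₂ t - B.τ₀ t * A.τ₂ t
  τ₂ t := A.τ₁ t * B.τ₂ t - B.τ₁ t * A.τ₂ t + b ^ 2 * (A.τ₀ t * B.τ₁ t - B.τ₀ t * A.τ₁ t)
  l₀ t := A.τ₀ t * B.l₁ t - B.τ₀ t * A.l₁ t
    + (B.τ₁ t * A.l₀ t + B.h * A.k₀ t - A.τ₁ t * B.l₀ t - A.h * B.k₀ t) / 2
  l₁ t := (A.τ₁ t * B.l₁ t - B.τ₁ t * A.l₁ t) / 2
    + b ^ 2 / 4 * (A.τ₀ t * B.l₀ t - B.τ₀ t * A.l₀ t)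
    + (B.τ₂ t * A.l₀ t - A.τ₂ t * B.l₀ t + B.h * A.k₁ t - A.h * B.k₁ t) / 2
  k₀ t := A.τ₀ t * B.k₁ t - B.τ₀ t * A.k₁ t
    + (B.τ₁ t * A.k₀ t - B.h * A.l₀ t - A.τ₁ t * B.k₀ t + A.h * B.l₀ t) / 2
  k₁ t := (A.τ₁ t * B.k₁ t - B.τ₁ t * A.k₁ t) / 2
    + e ^ 2 / 4 * (A.τ₀ t * B.k₀ t - B.τ₀ t * A.k₀ t)
    + (B.τ₂ t * A.k₀ t - A.τ₂ t * B.k₀ t - B.h * A.l₁ t + A.h * B.l₁ t) / 2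
  s t := A.τ₀ t * (-(a + d) * B.τ₂ t - (a * b + d * e) * B.τ₁ t)
    - B.τ₀ t * (-(a + d) * A.τ₂ t - (a * b + d * e) * A.τ₁ t)
    + A.l₀ t * B.l₁ t - B.l₀ t * A.l₁ t + A.k₀ t * B.k₁ t - B.k₀ t * A.k₁ t
  h := 0

section

variable {a b d e : ℝ} {A B : Datum}

namespace Valid

lemma τ₂_be (V : A.Valid a b d e) (t : ℝ) : (b ^ 2 - e ^ 2) * A.τ₂ t = 0 := by
  have := deriv_mul_eq_zero (f := A.τ₁) (c := b ^ 2 - e ^ 2)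
    (fun t => by rw [mul_comm]; exact V.τ_be t) t
  rw [V.deriv_τ₁] at this
  rw [mul_comm]; exact this

lemma l₁_a (V : A.Valid a b d e) (t : ℝ) : A.l₁ t * (1 / 4 - a) = 0 := by
  have := deriv_mul_eq_zero V.l_a t
  rwa [V.deriv_l₀] at this

lemma k₁_d (V : A.Valid a b d e) (t : ℝ) : A.k₁ t * (1 / 4 - d) = 0 := by
  have := deriv_mul_eq_zero V.k_d t
  rwa [V.deriv_k₀] at this

lemma bracket (VA : A.Valid a b d e) (VB : B.Valid a b d e) :
    (A.bracket a b d e B).Valid a b d e where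
  τ₀' t := (((VA.τ₀' t).mul (VB.τ₁' t)).sub ((VB.τ₀' t).mul (VA.τ₁' t))).congr_deriv (by
    simp only [Datum.bracket]; ring)
  τ₁' t := (((VA.τ₀' t).mul (VB.τ₂' t)).sub ((VB.τ₀' t).mul (VA.τ₂' t))).congr_deriv (by
    simp only [Datum.bracket]; ring)
  τ₂' t := ((((VA.τ₁' t).mul (VB.τ₂' t)).sub ((VB.τ₁' t).mul (VA.τ₂' t))).add
    ((((VA.τ₀' t).mul (VB.τ₁' t)).sub ((VB.τ₀' t).mul (VA.τ₁' t))).const_mul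
      (b ^ 2))).congr_deriv (by simp only [Datum.bracket]; ring)
  l₀' t := ((((VA.τ₀' t).mul (VB.l₁' t)).sub ((VB.τ₀' t).mul (VA.l₁' t))).add
    ((((((VB.τ₁' t).mul (VA.l₀' t)).add ((VA.k₀' t).const_mul B.h)).sub
      ((VA.τ₁' t).mul (VB.l₀' t))).sub ((VB.k₀' t).const_mul A.h)).div_const 2)).congr_deriv (by
    simp only [Datum.bracket]; ring)
  l₁' t := ((((((VA.τ₁' t).mul (VB.l₁' t)).sub ((VB.τ₁' t).mul (VA.l₁' t))).div_const 2).add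
    ((((VA.τ₀' t).mul (VB.l₀' t)).sub ((VB.τ₀' t).mul (VA.l₀' t))).const_mul (b ^ 2 / 4))).add
    ((((((VB.τ₂' t).mul (VA.l₀' t)).sub ((VA.τ₂' t).mul (VB.l₀' t))).add
      ((VA.k₁' t).const_mul B.h)).sub ((VB.k₁' t).const_mul A.h)).div_const 2)).congr_deriv (by
    simp only [Datum.bracket]
    linear_combination -VB.h_be * A.k₀ t / 8 + VA.h_be * B.k₀ t / 8)
  k₀' t := ((((VA.τ₀' t).mul (VB.k₁' t)).sub ((VB.τ₀' t).mul (VA.k₁' t))).add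
    ((((((VB.τ₁' t).mul (VA.k₀' t)).sub ((VA.l₀' t).const_mul B.h)).sub
      ((VA.τ₁' t).mul (VB.k₀' t))).add ((VB.l₀' t).const_mul A.h)).div_const 2)).congr_deriv (by
    simp only [Datum.bracket]; ring)
  k₁' t := ((((((VA.τ₁' t).mul (VB.k₁' t)).sub ((VB.τ₁' t).mul (VA.k₁' t))).div_const 2).add
    ((((VA.τ₀' t).mul (VB.k₀' t)).sub ((VB.τ₀' t).mul (VA.k₀' t))).const_mul (e ^ 2 / 4))).add
    ((((((VB.τ₂' t).mul (VA.k₀' t)).sub ((VA.τ₂' t).mul (VB.k₀' t))).sub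
      ((VA.l₁' t).const_mul B.h)).add ((VB.l₁' t).const_mul A.h)).div_const 2)).congr_deriv (by
    simp only [Datum.bracket]
    linear_combination -VB.h_be * A.l₀ t / 8 + VA.h_be * B.l₀ t / 8
      + VB.τ_be t * A.k₀ t / 2 - VA.τ_be t * B.k₀ t / 2)
  s' t := ((((((((VA.τ₀' t).mul (((VB.τ₂' t).const_mul (-(a + d))).sub
      ((VB.τ₁' t).const_mul (a * b + d * e)))).sub
    ((VB.τ₀' t).mul (((VA.τ₂' t).const_mul (-(a + d))).sub
      ((VA.τ₁' t).const_mul (a * b + d * e))))).add ((VA.l₀' t).mul (VB.l₁' t))).sub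
    ((VB.l₀' t).mul (VA.l₁' t))).add ((VA.k₀' t).mul (VB.k₁' t))).sub
    ((VB.k₀' t).mul (VA.k₁' t)))).congr_deriv (by
    simp only [Datum.bracket, Pi.sub_apply]
    ring)
  h_a := by simp [Datum.bracket]
  h_d := by simp [Datum.bracket]
  l_a t := by
    simp only [Datum.bracket]
    linear_combination A.τ₀ t * VB.l₁_a t - B.τ₀ t * VA.l₁_a t + B.τ₁ t / 2 * VA.l_a t
      - A.τ₁ t / 2 * VB.l_a t + A.k₀ t / 2 * VB.h_a - B.k₀ t / 2 * VA.h_a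
  k_d t := by
    simp only [Datum.bracket]
    linear_combination A.τ₀ t * VB.k₁_d t - B.τ₀ t * VA.k₁_d t + B.τ₁ t / 2 * VA.k_d t
      - A.τ₁ t / 2 * VB.k_d t - A.l₀ t / 2 * VB.h_d + B.l₀ t / 2 * VA.h_d
  τ_be t := by
    simp only [Datum.bracket]
    linear_combination A.τ₀ t * VB.τ₂_be t - B.τ₀ t * VA.τ₂_be t
  h_be := by simp [Datum.bracket]

lemma coefficientForm (V : A.Valid a b d e) :
    CoefficientForm (A.toField b e) A.τ₀ (fun _ => A.h) A.l₀ A.k₀ where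
  τ_eq p hp := by simp only [cτ, toField_of_mem hp]
  ξ_eq p hp := by simp only [cξ, toField_of_mem hp, V.deriv_τ₀]
  γ_eq p hp := by simp only [cγ, toField_of_mem hp, V.deriv_τ₀]

lemma smoothComponents (V : A.Valid a b d e) : SmoothComponents (A.toField b e) :=
  (contDiffOn_iff_smoothComponents _).1 V.toField_mem.1.1.smooth

lemma hasDerivAt_coeff (V : A.Valid a b d e) (x y t : ℝ) : HasDerivAt (A.coeff b e x y)
    ((b ^ 2 * A.τ₁ t + b * A.τ₂ t) * x + 2 * (b ^ 2 / 4 * A.l₀ t + b * A.l₁ t / 2) * √x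
      + (b ^ 2 * A.τ₁ t + e * A.τ₂ t) * y + 2 * (e ^ 2 / 4 * A.k₀ t + e * A.k₁ t / 2) * √y
      + (-(a + d) * A.τ₂ t - (a * b + d * e) * A.τ₁ t)) t :=
  ((((((((V.τ₂' t).add ((V.τ₁' t).const_mul b)).mul_const x).add_const
    (A.h * (b - e) * √x * √y)).add
    (((V.l₁' t).add (((V.l₀' t).const_mul b).div_const 2)).const_mul 2 |>.mul_const √x)).add
    (((V.τ₂' t).add ((V.τ₁' t).const_mul e)).mul_const y)).add
    (((V.k₁' t).add (((V.k₀' t).const_mul e).div_const 2)).const_mul 2 |>.mul_const √y)).add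
    (V.s' t))

/-- The derivative of the field of a datum in the direction `w`, in components. -/
lemma fderiv_toField (V : A.Valid a b d e) {p : Pt} (hp : p ∈ domain) (w : Pt) :
    fderiv ℝ (A.toField b e) p w =
      (w.1 * (A.τ₁ p.2.2.1 + (√p.2.1 * A.h + A.l₀ p.2.2.1) / (2 * √p.1))
        + w.2.1 * (√p.1 * A.h / (2 * √p.2.1))
        + w.2.2.1 * (A.τ₂ p.2.2.1 * p.1 + √p.1 * A.l₁ p.2.2.1),
      w.1 * (-√p.2.1 * A.h / (2 * √p.1))
        + w.2.1 * (A.τ₁ p.2.2.1 + (-√p.1 * A.h + A.k₀ p.2.2.1) / (2 * √p.2.1))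
        + w.2.2.1 * (A.τ₂ p.2.2.1 * p.2.1 + √p.2.1 * A.k₁ p.2.2.1),
      w.2.2.1 * A.τ₁ p.2.2.1,
      (w.1 * ((A.τ₂ p.2.2.1 + b * A.τ₁ p.2.2.1)
          + (A.h * (b - e) * √p.2.1 + 2 * (A.l₁ p.2.2.1 + b * A.l₀ p.2.2.1 / 2)) / (2 * √p.1))
        + w.2.1 * ((A.τ₂ p.2.2.1 + e * A.τ₁ p.2.2.1)
          + (A.h * (b - e) * √p.1 + 2 * (A.k₁ p.2.2.1 + e * A.k₀ p.2.2.1 / 2)) / (2 * √p.2.1))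
        + w.2.2.1 * ((b ^ 2 * A.τ₁ p.2.2.1 + b * A.τ₂ p.2.2.1) * p.1
          + 2 * (b ^ 2 / 4 * A.l₀ p.2.2.1 + b * A.l₁ p.2.2.1 / 2) * √p.1
          + (b ^ 2 * A.τ₁ p.2.2.1 + e * A.τ₂ p.2.2.1) * p.2.1
          + 2 * (e ^ 2 / 4 * A.k₀ p.2.2.1 + e * A.k₁ p.2.2.1 / 2) * √p.2.1
          + (-(a + d) * A.τ₂ p.2.2.1 - (a * b + d * e) * A.τ₁ p.2.2.1))) * p.2.2.2
        + w.2.2.2 * A.coeff b e p.1 p.2.1 p.2.2.1) := by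
  have hs := V.smoothComponents
  have D := (invariant_iff_determiningEquations hs (fun _ hp => toField_of_notMem hp)).1
    V.toField_mem.1.1
  have F := V.coefficientForm
  have hτ : Differentiable ℝ (deriv A.τ₀) := V.deriv_τ₀ ▸ fun t => (V.τ₁' t).differentiableAt
  obtain ⟨x1, -, x3, -, x5⟩ := F.partials_ξ hτ (differentiable_const _)
    (fun t => (V.l₀' t).differentiableAt) hp
  obtain ⟨y1, -, y3, -, y5⟩ := F.partials_γ hτ (differentiable_const _)
    (fun t => (V.k₀' t).differentiableAt) hp
  have hL : lift (A.coeff b e) = lift (lam b e A.τ₀ (fun _ => A.h) A.l₀ A.k₀ A.s) := by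
    rw [V.coeff_eq]
  have hΛ : Smooth (lift (A.coeff b e)) := hL ▸ smooth_lift_lam V.isAdmissible
  have h0 : Smooth (lift fun _ _ _ => 0) := contDiffOn_const
  have hφ : EqOn (cφ (A.toField b e))
      (fun p => lift (A.coeff b e) p * p.2.2.2 + lift (fun _ _ _ => 0) p) domain := fun p hp => by
    simp only [cφ, toField_of_mem hp, lift, add_zero]
  obtain ⟨f1, -, f3, -⟩ := partials_lam (fun p _ => congrFun hL p) hp
  have fx := ((dX_congr hφ).trans (dX_mul_u_add hΛ h0)) hp
  have fy := ((dY_congr hφ).trans (dY_mul_u_add hΛ h0)) hp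
  have ft := ((dT_congr hφ).trans (dT_mul_u_add hΛ h0)) hp
  have fu := ((dU_congr hφ).trans fun p _ => congrFun (dU_lift_mul_u_add _ _) p) hp
  have ht : dT (lift (A.coeff b e)) p = _ := (V.hasDerivAt_coeff p.1 p.2.1 p.2.2.1).deriv
  have z1 : dX (lift fun _ _ _ => 0) p = 0 := deriv_const _ _
  have z2 : dY (lift fun _ _ _ => 0) p = 0 := deriv_const _ _
  have z3 : dT (lift fun _ _ _ => 0) p = 0 := deriv_const _ _
  have hd : HasFDerivAt (A.toField b e) _ p := (hs.ξ.differentiableAt hp).hasFDerivAt.prodMk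
    ((hs.γ.differentiableAt hp).hasFDerivAt.prodMk
      ((hs.τ.differentiableAt hp).hasFDerivAt.prodMk (hs.φ.differentiableAt hp).hasFDerivAt))
  rw [hd.fderiv]
  simp only [ContinuousLinearMap.prod_apply, fderiv_apply_eq_partials (hs.ξ.differentiableAt hp),
    fderiv_apply_eq_partials (hs.γ.differentiableAt hp),
    fderiv_apply_eq_partials (hs.τ.differentiableAt hp),
    fderiv_apply_eq_partials (hs.φ.differentiableAt hp), x1, x3, x5, y1, y3, y5, fx, fy, ft, fu,
    f1, f3, ht, z1, z2, z3, D.ξ_u hp, D.γ_u hp, D.τ_u hp, D.τ_x hp, D.τ_y hp, F.dT_τ hp,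
    V.deriv_τ₀, V.deriv_τ₁, V.deriv_l₀, V.deriv_k₀, deriv_const, iteratedDeriv_two_eq, lift,
    Prod.mk.injEq, Pi.zero_apply]
  refine ⟨?_, ?_, ?_, ?_⟩ <;> ring

lemma lieBracket_toField (VA : A.Valid a b d e) (VB : B.Valid a b d e) :
    VectorField.lieBracket ℝ (A.toField b e) (B.toField b e)
      = (A.bracket a b d e B).toField b e := by
  funext p
  rw [VectorField.lieBracket]
  by_cases hp : p ∈ domain
  · rw [VA.fderiv_toField hp, VB.fderiv_toField hp, toField_of_mem hp, toField_of_mem hp,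
      toField_of_mem hp]
    have hsx := Real.sqrt_pos.2 hp.1
    have hsy := Real.sqrt_pos.2 hp.2
    have ex : p.1 = √p.1 ^ 2 := (Real.sq_sqrt hp.1.le).symm
    have ey : p.2.1 = √p.2.1 ^ 2 := (Real.sq_sqrt hp.2.le).symm
    simp only [coeff, Prod.mk_sub_mk, Prod.mk.injEq, Datum.bracket]
    generalize √p.1 = q at *
    generalize √p.2.1 = r at *
    simp only [ex, ey]
    refine ⟨?_, ?_, ?_, ?_⟩
    · field_simp
      ring
    · field_simp
      ring
    · trivial
    · field_simp
      ring
  · simp [toField_of_notMem hp]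

end Valid

end

end Datum

lemma lieBracket_mem_linearSymmetries {a b d e : ℝ} {v w : Field}
    (hv : v ∈ linearSymmetries a b d e) (hw : w ∈ linearSymmetries a b d e) :
    VectorField.lieBracket ℝ v w ∈ linearSymmetries a b d e := by
  obtain ⟨A, VA, rfl⟩ := mem_linearSymmetries_iff.1 hv
  obtain ⟨B, VB, rfl⟩ := mem_linearSymmetries_iff.1 hw
  exact mem_linearSymmetries_iff.2 ⟨_, VA.bracket VB, VA.lieBracket_toField VB⟩

/-! ### Solutions of the ordinary differential equations -/

lemma eq_of_hasDerivAt_zero {f : ℝ → ℝ} (hf : ∀ t, HasDerivAt f 0 t) (t : ℝ) : f t = f 0 :=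
  is_const_of_deriv_eq_zero (fun t => (hf t).differentiableAt) (fun t => (hf t).deriv) t 0

lemma eq_mul_exp_of_hasDerivAt {f : ℝ → ℝ} {c : ℝ} (hf : ∀ t, HasDerivAt f (c * f t) t) (t : ℝ) :
    f t = f 0 * Real.exp (c * t) := by
  have h : ∀ t, HasDerivAt (fun t => f t * Real.exp (-c * t)) 0 t := fun t =>
    ((hf t).mul (((hasDerivAt_id' t).const_mul (-c)).exp)).congr_deriv (by ring)
  have h1 := eq_of_hasDerivAt_zero h t
  simp only [mul_zero, Real.exp_zero, mul_one] at h1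
  rw [← h1, mul_assoc, ← Real.exp_add]
  simp

/-- The solutions of `f'' = c² f` for `c ≠ 0`. -/
lemma exists_eq_exp {f g : ℝ → ℝ} {c : ℝ} (hc : c ≠ 0) (hf : ∀ t, HasDerivAt f (g t) t)
    (hg : ∀ t, HasDerivAt g (c ^ 2 * f t) t) : ∃ A B : ℝ, ∀ t,
      f t = A * Real.exp (c * t) + B * Real.exp (-c * t) ∧
      g t = c * A * Real.exp (c * t) - c * B * Real.exp (-c * t) := by
  have h1 := eq_mul_exp_of_hasDerivAt (f := fun t => g t + c * f t) (c := c) fun t =>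
    ((hg t).add ((hf t).const_mul c)).congr_deriv (by ring)
  have h2 := eq_mul_exp_of_hasDerivAt (f := fun t => g t - c * f t) (c := -c) fun t =>
    ((hg t).sub ((hf t).const_mul c)).congr_deriv (by ring)
  refine ⟨(g 0 + c * f 0) / (2 * c), -(g 0 - c * f 0) / (2 * c), fun t => ?_⟩
  have e1 := h1 t
  have e2 := h2 t
  generalize Real.exp (c * t) = E at *
  generalize Real.exp (-c * t) = E' at *
  constructor
  · field_simp
    linear_combination e1 - e2
  · field_simp
    linear_combination e1 + e2

lemma eq_affine_of_hasDerivAt {f g : ℝ → ℝ} (hf : ∀ t, HasDerivAt f (g t) t)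
    (hg : ∀ t, HasDerivAt g 0 t) (t : ℝ) : f t = f 0 + g 0 * t ∧ g t = g 0 := by
  have h : ∀ t, HasDerivAt (fun t => f t - g 0 * t) 0 t := fun t =>
    ((hf t).sub ((hasDerivAt_id' t).const_mul (g 0))).congr_deriv (by
      rw [eq_of_hasDerivAt_zero hg t]; ring)
  refine ⟨?_, eq_of_hasDerivAt_zero hg t⟩
  have := eq_of_hasDerivAt_zero h t
  linear_combination this

/-- The first fundamental solution of `f'' = (b²/4) f`: the exponential `e^{bt/2}`, and `t` in the
degenerate case `b = 0`. -/
def sol₁ (b t : ℝ) : ℝ := if b = 0 then t else Real.exp (b / 2 * t)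

/-- The derivative of `sol₁ b`. -/
def sol₁' (b t : ℝ) : ℝ := if b = 0 then 1 else b / 2 * Real.exp (b / 2 * t)

/-- The second fundamental solution `e^{-bt/2}` of `f'' = (b²/4) f`. -/
def sol₂ (b t : ℝ) : ℝ := Real.exp (-(b / 2) * t)

/-- The derivative of `sol₂ b`. -/
def sol₂' (b t : ℝ) : ℝ := -(b / 2) * Real.exp (-(b / 2) * t)

lemma hasDerivAt_exp_mul (c t : ℝ) :
    HasDerivAt (fun t => Real.exp (c * t)) (c * Real.exp (c * t)) t :=
  ((hasDerivAt_id' t).const_mul c).exp.congr_deriv (by ring)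

lemma hasDerivAt_sol₁ (b t : ℝ) : HasDerivAt (sol₁ b) (sol₁' b t) t := by
  rcases eq_or_ne b 0 with rfl | hb
  · have : sol₁ 0 = fun t => t := funext fun t => by simp [sol₁]
    rw [this]
    exact (hasDerivAt_id' t).congr_deriv (by simp [sol₁'])
  · have : sol₁ b = fun t => Real.exp (b / 2 * t) := funext fun t => by simp [sol₁, hb]
    rw [this]
    exact (hasDerivAt_exp_mul (b / 2) t).congr_deriv (by simp [sol₁', hb])

lemma hasDerivAt_sol₁' (b t : ℝ) : HasDerivAt (sol₁' b) (b ^ 2 / 4 * sol₁ b t) t := by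
  rcases eq_or_ne b 0 with rfl | hb
  · have : sol₁' 0 = fun _ => 1 := funext fun t => by simp [sol₁']
    rw [this]
    exact (hasDerivAt_const t (1 : ℝ)).congr_deriv (by simp)
  · have : sol₁' b = fun t => b / 2 * Real.exp (b / 2 * t) := funext fun t => by simp [sol₁', hb]
    rw [this]
    exact ((hasDerivAt_exp_mul (b / 2) t).const_mul (b / 2)).congr_deriv (by
      simp only [sol₁, if_neg hb]; ring)

lemma hasDerivAt_sol₂ (b t : ℝ) : HasDerivAt (sol₂ b) (sol₂' b t) t :=
  hasDerivAt_exp_mul (-(b / 2)) t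

lemma hasDerivAt_sol₂' (b t : ℝ) : HasDerivAt (sol₂' b) (b ^ 2 / 4 * sol₂ b t) t :=
  ((hasDerivAt_exp_mul (-(b / 2)) t).const_mul (-(b / 2))).congr_deriv (by
    simp only [sol₂]; ring)

lemma exists_eq_sol {b : ℝ} {f g : ℝ → ℝ} (hf : ∀ t, HasDerivAt f (g t) t)
    (hg : ∀ t, HasDerivAt g (b ^ 2 / 4 * f t) t) : ∃ A B : ℝ, ∀ t,
      f t = A * sol₁ b t + B * sol₂ b t ∧ g t = A * sol₁' b t + B * sol₂' b t := by
  rcases eq_or_ne b 0 with rfl | hb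
  · refine ⟨g 0, f 0, fun t => ?_⟩
    obtain ⟨h1, h2⟩ := eq_affine_of_hasDerivAt hf (fun t => by simpa using hg t) t
    refine ⟨by rw [h1]; simp [sol₁, sol₂]; ring, by rw [h2]; simp [sol₁', sol₂']⟩
  · obtain ⟨A, B, h⟩ := exists_eq_exp (c := b / 2) (by simpa using hb) hf fun t =>
      (hg t).congr_deriv (by ring)
    refine ⟨A, B, fun t => ⟨?_, ?_⟩⟩
    · rw [(h t).1]; simp [sol₁, sol₂, hb]
    · rw [(h t).2]; simp [sol₁', sol₂', hb]; ring

lemma sol_independent {b A B : ℝ} (h : ∀ t, A * sol₁ b t + B * sol₂ b t = 0) :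
    A = 0 ∧ B = 0 := by
  have h0 := h 0
  have h1 := h 1
  rcases eq_or_ne b 0 with rfl | hb
  · simp only [sol₁, sol₂] at h0 h1
    simp at h0 h1
    exact ⟨by linarith, h0⟩
  · simp only [sol₁, sol₂, if_neg hb, mul_zero, Real.exp_zero, mul_one] at h0 h1
    have hne : Real.exp (b / 2) - Real.exp (-(b / 2)) ≠ 0 := by
      rw [sub_ne_zero, Ne, Real.exp_eq_exp]
      intro h
      exact hb (by linarith)
    have hA : A = 0 := by
      refine (mul_eq_zero.1
        (?_ : A * (Real.exp (b / 2) - Real.exp (-(b / 2))) = 0)).resolve_right hne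
      linear_combination h1 - Real.exp (-(b / 2)) * h0
    exact ⟨hA, by linarith⟩

lemma exp_independent {b A B C : ℝ} (hb : b ≠ 0)
    (h : ∀ t, A * Real.exp (b * t) + B * Real.exp (-b * t) + C = 0) : A = 0 ∧ B = 0 ∧ C = 0 := by
  have h0 := h 0
  have h1 := h 1
  have h2 := h (-1)
  simp only [mul_zero, Real.exp_zero, mul_one, mul_neg, neg_neg] at h0 h1 h2
  have hpos := Real.exp_pos b
  have hinv : Real.exp b * Real.exp (-b) = 1 := by rw [← Real.exp_add]; simp
  have hne : Real.exp b - 1 ≠ 0 := by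
    rw [sub_ne_zero, Ne, Real.exp_eq_one_iff]; exact hb
  have hne' : Real.exp b + 1 ≠ 0 := by positivity
  -- With `E = exp b` the values at `0, ±1` give `(A - B) (E² - 1) = 0` and `A (E - 1)² = 0`.
  have hAB : A = B := by
    refine sub_eq_zero.1 ((mul_eq_zero.1 (?_ :
      (A - B) * ((Real.exp b - 1) * (Real.exp b + 1)) = 0)).resolve_right
        (mul_ne_zero hne hne'))
    linear_combination Real.exp b * (h1 - h2) + (A - B) * hinv
  have hA : A = 0 := by
    refine (mul_eq_zero.1 (?_ : A * (Real.exp b - 1) ^ 2 = 0)).resolve_right (pow_ne_zero 2 hne)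
    linear_combination Real.exp b * (h1 - h0) - B * hinv + (1 - Real.exp b) * hAB
  subst hAB
  exact ⟨hA, hA, by linarith⟩

lemma quadratic_independent {A B C : ℝ} (h : ∀ t : ℝ, A * t ^ 2 + B * t + C = 0) :
    A = 0 ∧ B = 0 ∧ C = 0 := by
  have h0 := h 0
  have h1 := h 1
  have h2 := h (-1)
  norm_num at h0 h1 h2
  exact ⟨by linarith, by linarith, h0⟩

/-! ### The generators -/

section generators

variable {a b d e : ℝ}

/-- A field in closed form is a linear symmetry if it is the field of a valid datum. -/
lemma field_mem_of_datum {ξ γ τ Λ : ℝ → ℝ → ℝ → ℝ} (D : Datum) (V : D.Valid a b d e)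
    (hξ : ∀ x y t, ξ x y t = D.τ₁ t * x + √x * (√y * D.h + D.l₀ t))
    (hγ : ∀ x y t, γ x y t = D.τ₁ t * y + √y * (-√x * D.h + D.k₀ t))
    (hτ : ∀ x y t, τ x y t = D.τ₀ t) (hΛ : ∀ x y t, Λ x y t = D.coeff b e x y t) :
    field ξ γ τ Λ ∈ linearSymmetries a b d e := by
  refine mem_linearSymmetries_iff.2 ⟨D, V, ?_⟩
  funext p
  by_cases hp : p ∈ domain
  · rw [field_of_mem hp, toField_of_mem hp, hξ, hγ, hτ, hΛ]
  · rw [field_of_notMem hp, toField_of_notMem hp]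

lemma vX₁_eq (b : ℝ) : vX₁ b = field (fun x _ t => √x * sol₁ b t) (fun _ _ _ => 0)
    (fun _ _ _ => 0) (fun x _ t => 2 * (sol₁' b t + b * sol₁ b t / 2) * √x) := by
  rcases eq_or_ne b 0 with rfl | hb
  · simp only [vX₁, if_pos, sol₁, sol₁']
    congr 1 <;> (funext x y t; ring)
  · simp only [vX₁, if_neg hb, sol₁, sol₁']
    congr 1; funext x y t; ring

lemma vX₂_eq (b : ℝ) : vX₂ b = field (fun x _ t => √x * sol₂ b t) (fun _ _ _ => 0)
    (fun _ _ _ => 0) (fun x _ t => 2 * (sol₂' b t + b * sol₂ b t / 2) * √x) := by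
  simp only [vX₂, sol₂, sol₂']
  congr 1; funext x y t; ring

lemma vY₁_eq (e : ℝ) : vY₁ e = field (fun _ _ _ => 0) (fun _ y t => √y * sol₁ e t)
    (fun _ _ _ => 0) (fun _ y t => 2 * (sol₁' e t + e * sol₁ e t / 2) * √y) := by
  rcases eq_or_ne e 0 with rfl | he
  · simp only [vY₁, if_pos, sol₁, sol₁']
    congr 1 <;> (funext x y t; ring)
  · simp only [vY₁, if_neg he, sol₁, sol₁']
    congr 1; funext x y t; ring

lemma vY₂_eq (e : ℝ) : vY₂ e = field (fun _ _ _ => 0) (fun _ y t => √y * sol₂ e t)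
    (fun _ _ _ => 0) (fun _ y t => 2 * (sol₂' e t + e * sol₂ e t / 2) * √y) := by
  simp only [vY₂, sol₂, sol₂']
  congr 1; funext x y t; ring

lemma vU_mem : vU ∈ linearSymmetries a b d e := by
  refine field_mem_of_datum ⟨0, 0, 0, 0, 0, 0, 0, fun _ => 1, 0⟩ ?_ ?_ ?_ ?_ ?_
  · constructor <;> simp [hasDerivAt_zero, hasDerivAt_const]
  all_goals simp [coeff]

lemma vT_mem (c : ℝ) : vT c ∈ linearSymmetries a b d e := by
  refine field_mem_of_datum ⟨fun _ => 1, 0, 0, 0, 0, 0, 0, fun _ => c, 0⟩ ?_ ?_ ?_ ?_ ?_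
  · constructor <;> simp [hasDerivAt_zero, hasDerivAt_const]
  all_goals simp [coeff]

lemma vX₁_mem (ha : a = 1 / 4) : vX₁ b ∈ linearSymmetries a b d e := by
  rw [vX₁_eq]
  refine field_mem_of_datum ⟨0, 0, 0, sol₁ b, sol₁' b, 0, 0, 0, 0⟩ ?_ ?_ ?_ ?_ ?_
  · constructor <;> simp [hasDerivAt_zero, ha, hasDerivAt_sol₁, hasDerivAt_sol₁']
  all_goals simp [coeff]

lemma vX₂_mem (ha : a = 1 / 4) : vX₂ b ∈ linearSymmetries a b d e := by
  rw [vX₂_eq]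
  refine field_mem_of_datum ⟨0, 0, 0, sol₂ b, sol₂' b, 0, 0, 0, 0⟩ ?_ ?_ ?_ ?_ ?_
  · constructor <;> simp [hasDerivAt_zero, ha, hasDerivAt_sol₂, hasDerivAt_sol₂']
  all_goals simp [coeff]

lemma vY₁_mem (hd : d = 1 / 4) : vY₁ e ∈ linearSymmetries a b d e := by
  rw [vY₁_eq]
  refine field_mem_of_datum ⟨0, 0, 0, 0, 0, sol₁ e, sol₁' e, 0, 0⟩ ?_ ?_ ?_ ?_ ?_
  · constructor <;> simp [hasDerivAt_zero, hd, hasDerivAt_sol₁, hasDerivAt_sol₁']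
  all_goals simp [coeff]

lemma vY₂_mem (hd : d = 1 / 4) : vY₂ e ∈ linearSymmetries a b d e := by
  rw [vY₂_eq]
  refine field_mem_of_datum ⟨0, 0, 0, 0, 0, sol₂ e, sol₂' e, 0, 0⟩ ?_ ?_ ?_ ?_ ?_
  · constructor <;> simp [hasDerivAt_zero, hd, hasDerivAt_sol₂, hasDerivAt_sol₂']
  all_goals simp [coeff]

lemma vR_mem {c : ℝ} (ha : a = 1 / 4) (hd : d = 1 / 4) (hbe : b ^ 2 = e ^ 2) (hc : c = b - e) :
    vR c ∈ linearSymmetries a b d e := by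
  refine field_mem_of_datum ⟨0, 0, 0, 0, 0, 0, 0, 0, 1⟩ ?_ ?_ ?_ ?_ ?_
  · constructor <;> simp [hasDerivAt_zero, ha, hd, hbe]
  all_goals simp [coeff, hc, mul_comm]

lemma vP₁_mem (hbe : b = e) : vP₁ a b d ∈ linearSymmetries a b d e := by
  subst hbe
  have h := hasDerivAt_exp_mul b
  refine field_mem_of_datum ⟨fun t => Real.exp (b * t), fun t => b * Real.exp (b * t),
    fun t => b ^ 2 * Real.exp (b * t), 0, 0, 0, 0,
    fun t => -2 * b * (a + d) * Real.exp (b * t), 0⟩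
    ⟨h, fun t => ((h t).const_mul b).congr_deriv (by ring),
      fun t => ((h t).const_mul (b ^ 2)).congr_deriv (by ring), ?_, ?_, ?_, ?_,
      fun t => ((h t).const_mul (-2 * b * (a + d))).congr_deriv (by ring), ?_, ?_, ?_, ?_, ?_,
      ?_⟩ ?_ ?_ ?_ ?_
  any_goals simp [hasDerivAt_zero]
  intro x y t
  simp only [coeff, Pi.zero_apply]
  ring

lemma vP₂_mem (hbe : b = e) : vP₂ b ∈ linearSymmetries a b d e := by
  subst hbe
  have h := hasDerivAt_exp_mul (-b)
  refine field_mem_of_datum ⟨fun t => Real.exp (-b * t), fun t => -b * Real.exp (-b * t),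
    fun t => b ^ 2 * Real.exp (-b * t), 0, 0, 0, 0, 0, 0⟩
    ⟨h, fun t => ((h t).const_mul (-b)).congr_deriv (by ring),
      fun t => ((h t).const_mul (b ^ 2)).congr_deriv (by ring), ?_, ?_, ?_, ?_,
      fun t => (hasDerivAt_const t (0 : ℝ)).congr_deriv (by ring), ?_, ?_, ?_, ?_, ?_,
      ?_⟩ ?_ ?_ ?_ ?_
  any_goals simp [hasDerivAt_zero]
  intro x y t
  simp only [coeff, Pi.zero_apply]
  ring

lemma vN₁_mem (hbe : b = -e) : vN₁ a b ∈ linearSymmetries a b d e := by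
  obtain rfl : e = -b := by linarith
  have h := hasDerivAt_exp_mul b
  refine field_mem_of_datum ⟨fun t => Real.exp (b * t), fun t => b * Real.exp (b * t),
    fun t => b ^ 2 * Real.exp (b * t), 0, 0, 0, 0, fun t => -2 * b * a * Real.exp (b * t), 0⟩
    ⟨h, fun t => ((h t).const_mul b).congr_deriv (by ring),
      fun t => ((h t).const_mul (b ^ 2)).congr_deriv (by ring), ?_, ?_, ?_, ?_,
      fun t => ((h t).const_mul (-2 * b * a)).congr_deriv (by ring), ?_, ?_, ?_, ?_, ?_,
      ?_⟩ ?_ ?_ ?_ ?_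
  any_goals simp [hasDerivAt_zero]
  intro x y t
  simp only [coeff, Pi.zero_apply]
  ring

lemma vN₂_mem (hbe : b = -e) : vN₂ b d ∈ linearSymmetries a b d e := by
  obtain rfl : e = -b := by linarith
  have h := hasDerivAt_exp_mul (-b)
  refine field_mem_of_datum ⟨fun t => Real.exp (-b * t), fun t => -b * Real.exp (-b * t),
    fun t => b ^ 2 * Real.exp (-b * t), 0, 0, 0, 0, fun t => 2 * b * d * Real.exp (-b * t), 0⟩
    ⟨h, fun t => ((h t).const_mul (-b)).congr_deriv (by ring),
      fun t => ((h t).const_mul (b ^ 2)).congr_deriv (by ring), ?_, ?_, ?_, ?_,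
      fun t => ((h t).const_mul (2 * b * d)).congr_deriv (by ring), ?_, ?_, ?_, ?_, ?_,
      ?_⟩ ?_ ?_ ?_ ?_
  any_goals simp [hasDerivAt_zero]
  intro x y t
  simp only [coeff, Pi.zero_apply]
  ring

lemma vZ₁_mem (hb : b = 0) (he : e = 0) : vZ₁ a d ∈ linearSymmetries a b d e := by
  subst hb he
  refine field_mem_of_datum ⟨fun t => t ^ 2, fun t => 2 * t, fun _ => 2, 0, 0, 0, 0,
    fun t => -2 * (a + d) * t, 0⟩
    ⟨fun t => (hasDerivAt_pow 2 t).congr_deriv (by simp),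
      fun t => ((hasDerivAt_id' t).const_mul 2).congr_deriv (by ring),
      fun t => (hasDerivAt_const t (2 : ℝ)).congr_deriv (by ring), ?_, ?_, ?_, ?_,
      fun t => ((hasDerivAt_id' t).const_mul (-2 * (a + d))).congr_deriv (by ring),
      ?_, ?_, ?_, ?_, ?_, ?_⟩ ?_ ?_ ?_ ?_
  any_goals simp [hasDerivAt_zero]
  intro x y t
  simp only [coeff, Pi.zero_apply]
  ring

lemma vZ₂_mem (hb : b = 0) (he : e = 0) : vZ₂ ∈ linearSymmetries a b d e := by
  subst hb he
  refine field_mem_of_datum ⟨fun t => t, fun _ => 1, 0, 0, 0, 0, 0, 0, 0⟩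
    ⟨hasDerivAt_id', fun t => hasDerivAt_const t 1, fun t => by simp [hasDerivAt_zero],
      ?_, ?_, ?_, ?_, fun t => by simp [hasDerivAt_zero], ?_, ?_, ?_, ?_, ?_, ?_⟩ ?_ ?_ ?_ ?_
  all_goals simp [hasDerivAt_zero, coeff]

end generators

/-! ### Spanning families -/

section spanning

variable {a b d e : ℝ} {D : Datum} {S : Submodule ℝ Field}

/-- The symmetry with the time component `τ` of a given one and no other parameters. -/
def Datum.timePart (a b d e : ℝ) (D : Datum) : Datum where
  τ₀ := D.τ₀
  τ₁ := D.τ₁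
  τ₂ := D.τ₂
  l₀ := 0
  l₁ := 0
  k₀ := 0
  k₁ := 0
  s t := -(a + d) * D.τ₁ t - (a * b + d * e) * D.τ₀ t
  h := 0

lemma Datum.Valid.s_eq (V : D.Valid a b d e) :
    ∃ c, ∀ t, D.s t = -(a + d) * D.τ₁ t - (a * b + d * e) * D.τ₀ t + c := by
  have h : ∀ t, HasDerivAt
      (fun t => D.s t - (-(a + d) * D.τ₁ t - (a * b + d * e) * D.τ₀ t)) 0 t := fun t =>
    ((V.s' t).sub (((V.τ₁' t).const_mul _).sub ((V.τ₀' t).const_mul _))).congr_deriv (sub_self _)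
  refine ⟨D.s 0 - (-(a + d) * D.τ₁ 0 - (a * b + d * e) * D.τ₀ 0), fun t => ?_⟩
  linear_combination eq_of_hasDerivAt_zero h t

/-- Every linear symmetry is its time part plus a combination of `R`, `X₁, X₂`, `Y₁, Y₂` and `U`,
where `X₁, X₂` occur only for `a = 1/4`, `Y₁, Y₂` only for `d = 1/4`, and `R` only if both hold and
`b² = e²`. -/
lemma mem_of_generators_mem {cR : ℝ} (hcR : cR = b - e)
    (hτ : ∀ D : Datum, D.Valid a b d e → (D.timePart a b d e).toField b e ∈ S)
    (hR : a = 1 / 4 → d = 1 / 4 → b ^ 2 = e ^ 2 → vR cR ∈ S)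
    (hX : a = 1 / 4 → vX₁ b ∈ S ∧ vX₂ b ∈ S) (hY : d = 1 / 4 → vY₁ e ∈ S ∧ vY₂ e ∈ S)
    (hU : vU ∈ S) {v : Field} (hv : v ∈ linearSymmetries a b d e) : v ∈ S := by
  obtain ⟨D, V, rfl⟩ := mem_linearSymmetries_iff.1 hv
  obtain ⟨c, hc⟩ := V.s_eq
  obtain ⟨A, B, hl⟩ := exists_eq_sol V.l₀' V.l₁'
  obtain ⟨A', B', hk⟩ := exists_eq_sol V.k₀' V.k₁'
  have key : D.toField b e = (D.timePart a b d e).toField b e + D.h • vR cR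
      + (A • vX₁ b + B • vX₂ b) + (A' • vY₁ e + B' • vY₂ e) + c • vU := by
    funext p
    rw [vX₁_eq, vX₂_eq, vY₁_eq, vY₂_eq, vR, vU]
    by_cases hp : p ∈ domain
    · simp only [Pi.add_apply, Pi.smul_apply, field_of_mem hp, toField_of_mem hp, timePart, coeff,
        Prod.smul_mk, Prod.mk_add_mk, smul_eq_mul, Prod.mk.injEq, Pi.zero_apply, (hl p.2.2.1).1,
        (hl p.2.2.1).2, (hk p.2.2.1).1, (hk p.2.2.1).2, hc p.2.2.1, hcR]
      refine ⟨?_, ?_, ?_, ?_⟩ <;> ring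
    · simp only [Pi.add_apply, Pi.smul_apply, field_of_notMem hp, toField_of_notMem hp, smul_zero,
        add_zero]
  have h1 : D.h • vR cR ∈ S := by
    rcases eq_or_ne D.h 0 with h0 | h0
    · rw [h0, zero_smul]; exact S.zero_mem
    · refine S.smul_mem _ (hR ?_ ?_ ?_)
      · linarith [(mul_eq_zero.1 V.h_a).resolve_left h0]
      · linarith [(mul_eq_zero.1 V.h_d).resolve_left h0]
      · linarith [(mul_eq_zero.1 V.h_be).resolve_right h0]
  have h2 : A • vX₁ b + B • vX₂ b ∈ S := by
    rcases eq_or_ne a (1 / 4) with ha | ha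
    · exact S.add_mem (S.smul_mem _ (hX ha).1) (S.smul_mem _ (hX ha).2)
    · obtain ⟨rfl, rfl⟩ := sol_independent fun t => (hl t).1.symm.trans
        ((mul_eq_zero.1 (V.l_a t)).resolve_right (sub_ne_zero.2 ha.symm))
      simp
  have h3 : A' • vY₁ e + B' • vY₂ e ∈ S := by
    rcases eq_or_ne d (1 / 4) with hd | hd
    · exact S.add_mem (S.smul_mem _ (hY hd).1) (S.smul_mem _ (hY hd).2)
    · obtain ⟨rfl, rfl⟩ := sol_independent fun t => (hk t).1.symm.trans
        ((mul_eq_zero.1 (V.k_d t)).resolve_right (sub_ne_zero.2 hd.symm))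
      simp
  rw [key]
  exact S.add_mem (S.add_mem (S.add_mem (S.add_mem (hτ D V) h1) h2) h3) (S.smul_mem _ hU)

lemma timePart_mem_of_sq_ne (hbe : b ^ 2 ≠ e ^ 2) (hT : vT 0 ∈ S) (hU : vU ∈ S)
    (V : D.Valid a b d e) : (D.timePart a b d e).toField b e ∈ S := by
  have h1 : ∀ t, D.τ₁ t = 0 := fun t =>
    (mul_eq_zero.1 (V.τ_be t)).resolve_left (sub_ne_zero.2 hbe)
  have h2 : ∀ t, D.τ₂ t = 0 := fun t =>
    (mul_eq_zero.1 (V.τ₂_be t)).resolve_left (sub_ne_zero.2 hbe)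
  have h0 := eq_of_hasDerivAt_zero fun t => (V.τ₀' t).congr_deriv (h1 t)
  have key : (D.timePart a b d e).toField b e =
      D.τ₀ 0 • vT 0 + (-(a * b + d * e) * D.τ₀ 0) • vU := by
    funext p
    rw [vT, vU]
    by_cases hp : p ∈ domain
    · simp only [Pi.add_apply, Pi.smul_apply, field_of_mem hp, toField_of_mem hp, timePart, coeff,
        Prod.smul_mk, Prod.mk_add_mk, smul_eq_mul, Prod.mk.injEq, Pi.zero_apply, h1, h2,
        h0 p.2.2.1]
      refine ⟨?_, ?_, ?_, ?_⟩ <;> ring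
    · simp only [Pi.add_apply, Pi.smul_apply, field_of_notMem hp, toField_of_notMem hp, smul_zero,
        add_zero]
  rw [key]
  exact S.add_mem (S.smul_mem _ hT) (S.smul_mem _ hU)

lemma exists_time_eq_exp (hb : b ≠ 0) (V : D.Valid a b d e) : ∃ A B C : ℝ, ∀ t,
    D.τ₀ t = A * Real.exp (b * t) + B * Real.exp (-b * t) + C ∧
    D.τ₁ t = b * A * Real.exp (b * t) - b * B * Real.exp (-b * t) ∧
    D.τ₂ t = b ^ 2 * A * Real.exp (b * t) + b ^ 2 * B * Real.exp (-b * t) := by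
  obtain ⟨A, B, h⟩ := exists_eq_exp hb V.τ₁' V.τ₂'
  have h0 : ∀ t, HasDerivAt (fun t => D.τ₀ t
      - (A / b * Real.exp (b * t) + -B / b * Real.exp (-b * t))) 0 t := fun t => by
    refine ((V.τ₀' t).sub (((hasDerivAt_exp_mul b t).const_mul _).add
      ((hasDerivAt_exp_mul (-b) t).const_mul _))).congr_deriv ?_
    rw [(h t).1]
    generalize Real.exp (b * t) = E at *
    generalize Real.exp (-b * t) = E' at *
    field_simp
    ring
  refine ⟨A / b, -B / b, D.τ₀ 0 - (A / b * Real.exp (b * 0) + -B / b * Real.exp (-b * 0)),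
    fun t => ⟨?_, ?_, ?_⟩⟩
  · linear_combination eq_of_hasDerivAt_zero h0 t
  · rw [(h t).1]
    generalize Real.exp (b * t) = E at *
    generalize Real.exp (-b * t) = E' at *
    field_simp
    ring
  · rw [(h t).2]
    generalize Real.exp (b * t) = E at *
    generalize Real.exp (-b * t) = E' at *
    field_simp
    ring

lemma timePart_mem_of_eq {c : ℝ} (hbe : b = e) (hb : b ≠ 0) (h1 : vP₁ a b d ∈ S) (h2 : vP₂ b ∈ S)
    (hT : vT c ∈ S) (hU : vU ∈ S) (V : D.Valid a b d e) :
    (D.timePart a b d e).toField b e ∈ S := by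
  subst hbe
  obtain ⟨A, B, C, h⟩ := exists_time_eq_exp hb V
  have key : (D.timePart a b d b).toField b b = A • vP₁ a b d + B • vP₂ b + C • vT c
      + (-(a + d) * b * C - C * c) • vU := by
    funext p
    rw [vT, vU, vP₁, vP₂]
    by_cases hp : p ∈ domain
    · simp only [Pi.add_apply, Pi.smul_apply, field_of_mem hp, toField_of_mem hp, timePart, coeff,
        Prod.smul_mk, Prod.mk_add_mk, smul_eq_mul, Prod.mk.injEq, Pi.zero_apply, (h p.2.2.1).1,
        (h p.2.2.1).2.1, (h p.2.2.1).2.2]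
      refine ⟨?_, ?_, ?_, ?_⟩ <;> ring
    · simp only [Pi.add_apply, Pi.smul_apply, field_of_notMem hp, toField_of_notMem hp, smul_zero,
        add_zero]
  rw [key]
  exact S.add_mem (S.add_mem (S.add_mem (S.smul_mem _ h1) (S.smul_mem _ h2)) (S.smul_mem _ hT))
    (S.smul_mem _ hU)

lemma timePart_mem_of_eq_neg {c : ℝ} (hbe : b = -e) (hb : b ≠ 0) (h1 : vN₁ a b ∈ S)
    (h2 : vN₂ b d ∈ S) (hT : vT c ∈ S) (hU : vU ∈ S) (V : D.Valid a b d e) :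
    (D.timePart a b d e).toField b e ∈ S := by
  obtain rfl : e = -b := by linarith
  obtain ⟨A, B, C, h⟩ := exists_time_eq_exp hb V
  have key : (D.timePart a b d (-b)).toField b (-b) = A • vN₁ a b + B • vN₂ b d + C • vT c
      + (-(a - d) * b * C - C * c) • vU := by
    funext p
    rw [vT, vU, vN₁, vN₂]
    by_cases hp : p ∈ domain
    · simp only [Pi.add_apply, Pi.smul_apply, field_of_mem hp, toField_of_mem hp, timePart, coeff,
        Prod.smul_mk, Prod.mk_add_mk, smul_eq_mul, Prod.mk.injEq, Pi.zero_apply, (h p.2.2.1).1,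
        (h p.2.2.1).2.1, (h p.2.2.1).2.2]
      refine ⟨?_, ?_, ?_, ?_⟩ <;> ring
    · simp only [Pi.add_apply, Pi.smul_apply, field_of_notMem hp, toField_of_notMem hp, smul_zero,
        add_zero]
  rw [key]
  exact S.add_mem (S.add_mem (S.add_mem (S.smul_mem _ h1) (S.smul_mem _ h2)) (S.smul_mem _ hT))
    (S.smul_mem _ hU)

lemma timePart_mem_of_eq_zero (hb : b = 0) (he : e = 0) (h1 : vZ₁ a d ∈ S)
    (h2 : vZ₂ ∈ S) (hT : vT 0 ∈ S) (hU : vU ∈ S) (V : D.Valid a b d e) :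
    (D.timePart a b d e).toField b e ∈ S := by
  subst hb he
  have hA := eq_affine_of_hasDerivAt V.τ₁' fun t => by simpa using V.τ₂' t
  have h0 : ∀ t, HasDerivAt (fun t => D.τ₀ t - (D.τ₁ 0 * t + D.τ₂ 0 / 2 * t ^ 2)) 0 t := fun t =>
    ((V.τ₀' t).sub (((hasDerivAt_id' t).const_mul (D.τ₁ 0)).add
      ((hasDerivAt_pow 2 t).const_mul (D.τ₂ 0 / 2)))).congr_deriv (by
        rw [(hA t).1]; simp; ring)
  have hC : ∀ t, D.τ₀ t = D.τ₀ 0 + D.τ₁ 0 * t + D.τ₂ 0 / 2 * t ^ 2 := fun t => by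
    linear_combination eq_of_hasDerivAt_zero h0 t
  have key : (D.timePart a 0 d 0).toField 0 0 = (D.τ₂ 0 / 2) • vZ₁ a d + D.τ₁ 0 • vZ₂
      + D.τ₀ 0 • vT 0 + (-(a + d) * D.τ₁ 0) • vU := by
    funext p
    rw [vT, vU, vZ₁, vZ₂]
    by_cases hp : p ∈ domain
    · simp only [Pi.add_apply, Pi.smul_apply, field_of_mem hp, toField_of_mem hp, timePart, coeff,
        Prod.smul_mk, Prod.mk_add_mk, smul_eq_mul, Prod.mk.injEq, Pi.zero_apply, hC p.2.2.1,
        (hA p.2.2.1).1, (hA p.2.2.1).2]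
      refine ⟨?_, ?_, ?_, ?_⟩ <;> ring
    · simp only [Pi.add_apply, Pi.smul_apply, field_of_notMem hp, toField_of_notMem hp, smul_zero,
        add_zero]
  rw [key]
  exact S.add_mem (S.add_mem (S.add_mem (S.smul_mem _ h1) (S.smul_mem _ h2)) (S.smul_mem _ hT))
    (S.smul_mem _ hU)

end spanning

/-! ### Linear independence -/

/-- Three fields with linearly independent time components, together with `R`, `X₁, X₂`, `Y₁, Y₂`
and `U`, are linearly independent. -/
lemma linearIndependent_nine (W₁ W₂ W₃ : Field) (c b e : ℝ)
    (hW : ∀ A B C : ℝ, (∀ t, A * cτ W₁ (1, 1, t, 1) + B * cτ W₂ (1, 1, t, 1)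
      + C * cτ W₃ (1, 1, t, 1) = 0) → A = 0 ∧ B = 0 ∧ C = 0) :
    LinearIndependent ℝ ![W₁, W₂, W₃, vR c, vX₁ b, vX₂ b, vY₁ e, vY₂ e, vU] := by
  rw [Fintype.linearIndependent_iff]
  intro g hg
  rw [Fin.sum_univ_castSucc, Fin.sum_univ_eight] at hg
  change g 0 • W₁ + g 1 • W₂ + g 2 • W₃ + g 3 • vR c + g 4 • vX₁ b + g 5 • vX₂ b + g 6 • vY₁ e
    + g 7 • vY₂ e + g 8 • vU = 0 at hg
  have dom : ∀ x y t : ℝ, 0 < x → 0 < y → ((x, y, t, 1) : Pt) ∈ domain :=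
    fun x y t hx hy => ⟨hx, hy⟩
  rw [vX₁_eq, vX₂_eq, vY₁_eq, vY₂_eq, vR, vU] at hg
  obtain ⟨g0, g1, g2⟩ := hW (g 0) (g 1) (g 2) fun t => by
    have h := congrArg (fun q : Pt => q.2.2.1) (congrFun hg (1, 1, t, 1))
    simp only [Pi.add_apply, Pi.smul_apply, Pi.zero_apply,
      field_of_mem (dom 1 1 t one_pos one_pos), Prod.snd_add, Prod.fst_add, Prod.smul_snd,
      Prod.smul_fst, smul_eq_mul, mul_zero, add_zero, Prod.snd_zero, Prod.fst_zero] at h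
    exact h
  rw [g0, g1, g2, zero_smul, zero_smul, zero_smul, zero_add, zero_add, zero_add] at hg
  have key : ∀ x y t : ℝ, 0 < x → 0 < y → _ := fun x y t hx hy => by
    have h := congrFun hg (x, y, t, 1)
    simp only [Pi.add_apply, Pi.smul_apply, Pi.zero_apply, field_of_mem (dom x y t hx hy),
      Prod.smul_mk, Prod.mk_add_mk, smul_eq_mul, mul_zero, add_zero, mul_one,
      Prod.ext_iff, Prod.fst_zero, Prod.snd_zero] at h
    exact h
  have h4 : √(4 : ℝ) = 2 := by
    rw [show (4 : ℝ) = 2 ^ 2 by norm_num, Real.sqrt_sq zero_le_two]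
  -- The first components at `y = 1` and `y = 4` separate `R` from `X₁` and `X₂`.
  have g3 : g 3 = 0 := by
    have h1 := (key 1 1 0 one_pos one_pos).1
    have h2 := (key 1 4 0 one_pos four_pos).1
    rw [h4] at h2
    rw [Real.sqrt_one] at h1 h2
    linear_combination h2 - h1
  obtain ⟨g4, g5⟩ := sol_independent (A := g 4) (B := g 5) fun t => by
    have h1 := (key 1 1 t one_pos one_pos).1
    rw [g3, Real.sqrt_one] at h1
    linear_combination h1
  obtain ⟨g6, g7⟩ := sol_independent (A := g 6) (B := g 7) fun t => by
    have h1 := (key 1 1 t one_pos one_pos).2.1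
    rw [g3, Real.sqrt_one] at h1
    linear_combination h1
  have g8 : g 8 = 0 := by
    have h1 := (key 1 1 0 one_pos one_pos).2.2.2
    rw [g3, g4, g5, g6, g7] at h1
    linear_combination h1
  intro i
  fin_cases i
  exacts [g0, g1, g2, g3, g4, g5, g6, g7, g8]

lemma linearIndependent_exp {W₁ W₂ : Field} {b : ℝ} (hb : b ≠ 0) (c c' b' e : ℝ)
    (h₁ : ∀ t, cτ W₁ (1, 1, t, 1) = Real.exp (b * t))
    (h₂ : ∀ t, cτ W₂ (1, 1, t, 1) = Real.exp (-b * t)) :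
    LinearIndependent ℝ ![W₁, W₂, vT c, vR c', vX₁ b', vX₂ b', vY₁ e, vY₂ e, vU] := by
  refine linearIndependent_nine _ _ _ _ _ _ fun A B C h => exp_independent hb fun t => ?_
  have h3 := h t
  rw [h₁, h₂, cτ, vT, field_of_mem ⟨one_pos, one_pos⟩, mul_one] at h3
  exact h3

lemma cτ_field (ξ γ τ Λ : ℝ → ℝ → ℝ → ℝ) (t : ℝ) :
    cτ (field ξ γ τ Λ) (1, 1, t, 1) = τ 1 1 t := by
  rw [cτ, field_of_mem ⟨one_pos, one_pos⟩]

lemma linearIndependent_P {b : ℝ} (hb : b ≠ 0) (a d c c' e : ℝ) : LinearIndependent ℝ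
    ![vP₁ a b d, vP₂ b, vT c, vR c', vX₁ b, vX₂ b, vY₁ e, vY₂ e, vU] :=
  linearIndependent_exp hb _ _ _ _ (fun _ => cτ_field _ _ _ _ _) fun _ => cτ_field _ _ _ _ _

lemma linearIndependent_N {b : ℝ} (hb : b ≠ 0) (a d c c' e : ℝ) : LinearIndependent ℝ
    ![vN₁ a b, vN₂ b d, vT c, vR c', vX₁ b, vX₂ b, vY₁ e, vY₂ e, vU] :=
  linearIndependent_exp hb _ _ _ _ (fun _ => cτ_field _ _ _ _ _) fun _ => cτ_field _ _ _ _ _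

lemma linearIndependent_Z (a d c' b e : ℝ) : LinearIndependent ℝ
    ![vZ₁ a d, vZ₂, vT 0, vR c', vX₁ b, vX₂ b, vY₁ e, vY₂ e, vU] :=
  linearIndependent_nine _ _ _ _ _ _ fun A B C h => quadratic_independent fun t => by
    have h3 := h t
    rw [vZ₁, vZ₂, vT, cτ_field, cτ_field, cτ_field, mul_one] at h3
    exact h3

/-! ### Bases and dimensions -/

section bases

variable {a b d e : ℝ}

/-- A subfamily of a linearly independent family is a basis as soon as it generates. -/
lemma isBasisOf_linearSymmetries {m n : ℕ} {N : Fin m → Field} {w : Fin n → Field}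
    (hN : LinearIndependent ℝ N) (f : Fin n → Fin m) (hf : Function.Injective f)
    (hw : ∀ i, N (f i) = w i) (hmem : ∀ i, w i ∈ linearSymmetries a b d e)
    (hsub : ∀ v ∈ linearSymmetries a b d e, v ∈ Submodule.span ℝ (range w)) :
    IsBasisOf w (linearSymmetries a b d e) := by
  obtain rfl : N ∘ f = w := funext hw
  refine ⟨hN.comp f hf, Subset.antisymm ?_ hsub⟩
  have h : Submodule.span ℝ (range (N ∘ f)) ≤ linearSubmodule a b d e :=
    Submodule.span_le.2 (range_subset_iff.2 hmem)
  exact h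

lemma mem_span_range {n : ℕ} (w : Fin n → Field) (i : Fin n) :
    w i ∈ Submodule.span ℝ (range w) := Submodule.subset_span ⟨i, rfl⟩

/-- The bases for `b ≠ ± e`. -/
lemma isBasisOf_of_ne (h₁ : b ≠ e) (h₂ : b ≠ -e) :
    (a = 1 / 4 → d = 1 / 4 → IsBasisOf ![vT 0, vU, vX₁ b, vX₂ b, vY₁ e, vY₂ e]
      (linearSymmetries a b d e)) ∧
    (a ≠ 1 / 4 → d ≠ 1 / 4 → IsBasisOf ![vT 0, vU] (linearSymmetries a b d e)) ∧
    (a = 1 / 4 → d ≠ 1 / 4 → IsBasisOf ![vT 0, vU, vX₁ b, vX₂ b] (linearSymmetries a b d e)) ∧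
    (a ≠ 1 / 4 → d = 1 / 4 → IsBasisOf ![vT 0, vU, vY₁ e, vY₂ e] (linearSymmetries a b d e)) := by
  have hbe : b ^ 2 ≠ e ^ 2 := fun h => (sq_eq_sq_iff_eq_or_eq_neg.1 h).elim h₁ h₂
  have hN := linearIndependent_Z 0 0 0 b e
  refine ⟨fun ha hd => ?_, fun ha hd => ?_, fun ha hd => ?_, fun ha hd => ?_⟩
  · refine isBasisOf_linearSymmetries hN ![2, 8, 4, 5, 6, 7] (by decide)
      (fun i => by fin_cases i <;> rfl)
      (fun i => ?_) fun v hv => mem_of_generators_mem rfl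
        (fun D => timePart_mem_of_sq_ne hbe (mem_span_range _ 0) (mem_span_range _ 1))
        (fun _ _ h => absurd h hbe) (fun _ => ⟨mem_span_range _ 2, mem_span_range _ 3⟩)
        (fun _ => ⟨mem_span_range _ 4, mem_span_range _ 5⟩) (mem_span_range _ 1) hv
    fin_cases i
    exacts [vT_mem _, vU_mem, vX₁_mem ha, vX₂_mem ha, vY₁_mem hd, vY₂_mem hd]
  · refine isBasisOf_linearSymmetries hN ![2, 8] (by decide)
      (fun i => by fin_cases i <;> rfl)
      (fun i => ?_) fun v hv => mem_of_generators_mem rfl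
        (fun D => timePart_mem_of_sq_ne hbe (mem_span_range _ 0) (mem_span_range _ 1))
        (fun h => absurd h ha) (fun h => absurd h ha)
        (fun h => absurd h hd) (mem_span_range _ 1) hv
    fin_cases i
    exacts [vT_mem _, vU_mem]
  · refine isBasisOf_linearSymmetries hN ![2, 8, 4, 5] (by decide)
      (fun i => by fin_cases i <;> rfl)
      (fun i => ?_) fun v hv => mem_of_generators_mem rfl
        (fun D => timePart_mem_of_sq_ne hbe (mem_span_range _ 0) (mem_span_range _ 1))
        (fun _ h => absurd h hd) (fun _ => ⟨mem_span_range _ 2, mem_span_range _ 3⟩)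
        (fun h => absurd h hd) (mem_span_range _ 1) hv
    fin_cases i
    exacts [vT_mem _, vU_mem, vX₁_mem ha, vX₂_mem ha]
  · refine isBasisOf_linearSymmetries hN ![2, 8, 6, 7] (by decide)
      (fun i => by fin_cases i <;> rfl)
      (fun i => ?_) fun v hv => mem_of_generators_mem rfl
        (fun D => timePart_mem_of_sq_ne hbe (mem_span_range _ 0) (mem_span_range _ 1))
        (fun h => absurd h ha) (fun h => absurd h ha)
        (fun _ => ⟨mem_span_range _ 2, mem_span_range _ 3⟩) (mem_span_range _ 1) hv
    fin_cases i
    exacts [vT_mem _, vU_mem, vY₁_mem hd, vY₂_mem hd]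

/-- The bases for `b = e ≠ 0`. -/
lemma isBasisOf_of_eq (hbe : b = e) (hb : b ≠ 0) (c : ℝ) :
    (a = 1 / 4 → d = 1 / 4 → IsBasisOf
      ![vP₁ a b d, vP₂ b, vT c, vR 0, vX₁ b, vX₂ b, vY₁ b, vY₂ b, vU]
      (linearSymmetries a b d e)) ∧
    (a ≠ 1 / 4 → d ≠ 1 / 4 → IsBasisOf ![vP₁ a b d, vP₂ b, vT c, vU] (linearSymmetries a b d e)) ∧
    (a = 1 / 4 → d ≠ 1 / 4 → IsBasisOf ![vP₁ a b d, vP₂ b, vT c, vX₁ b, vX₂ b, vU]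
      (linearSymmetries a b d e)) ∧
    (a ≠ 1 / 4 → d = 1 / 4 → IsBasisOf ![vP₁ a b d, vP₂ b, vT c, vY₁ b, vY₂ b, vU]
      (linearSymmetries a b d e)) := by
  subst hbe
  have hN := linearIndependent_P hb a d c 0 b
  refine ⟨fun ha hd => ?_, fun ha hd => ?_, fun ha hd => ?_, fun ha hd => ?_⟩
  · refine isBasisOf_linearSymmetries hN id Function.injective_id (fun _ => rfl)
      (fun i => ?_) fun v hv => mem_of_generators_mem (sub_self b).symm
        (fun D => timePart_mem_of_eq rfl hb (mem_span_range _ 0) (mem_span_range _ 1)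
          (mem_span_range _ 2) (mem_span_range _ 8))
        (fun _ _ _ => mem_span_range _ 3) (fun _ => ⟨mem_span_range _ 4, mem_span_range _ 5⟩)
        (fun _ => ⟨mem_span_range _ 6, mem_span_range _ 7⟩) (mem_span_range _ 8) hv
    fin_cases i
    exacts [vP₁_mem rfl, vP₂_mem rfl, vT_mem _, vR_mem ha hd rfl (sub_self b).symm, vX₁_mem ha,
        vX₂_mem ha, vY₁_mem hd, vY₂_mem hd, vU_mem]
  · refine isBasisOf_linearSymmetries hN ![0, 1, 2, 8] (by decide)
      (fun i => by fin_cases i <;> rfl)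
      (fun i => ?_) fun v hv => mem_of_generators_mem (sub_self b).symm
        (fun D => timePart_mem_of_eq rfl hb (mem_span_range _ 0) (mem_span_range _ 1)
          (mem_span_range _ 2) (mem_span_range _ 3))
        (fun h => absurd h ha) (fun h => absurd h ha)
        (fun h => absurd h hd) (mem_span_range _ 3) hv
    fin_cases i
    exacts [vP₁_mem rfl, vP₂_mem rfl, vT_mem _, vU_mem]
  · refine isBasisOf_linearSymmetries hN ![0, 1, 2, 4, 5, 8] (by decide)
      (fun i => by fin_cases i <;> rfl)
      (fun i => ?_) fun v hv => mem_of_generators_mem (sub_self b).symm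
        (fun D => timePart_mem_of_eq rfl hb (mem_span_range _ 0) (mem_span_range _ 1)
          (mem_span_range _ 2) (mem_span_range _ 5))
        (fun _ h => absurd h hd) (fun _ => ⟨mem_span_range _ 3, mem_span_range _ 4⟩)
        (fun h => absurd h hd) (mem_span_range _ 5) hv
    fin_cases i
    exacts [vP₁_mem rfl, vP₂_mem rfl, vT_mem _, vX₁_mem ha, vX₂_mem ha, vU_mem]
  · refine isBasisOf_linearSymmetries hN ![0, 1, 2, 6, 7, 8] (by decide)
      (fun i => by fin_cases i <;> rfl)
      (fun i => ?_) fun v hv => mem_of_generators_mem (sub_self b).symm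
        (fun D => timePart_mem_of_eq rfl hb (mem_span_range _ 0) (mem_span_range _ 1)
          (mem_span_range _ 2) (mem_span_range _ 5))
        (fun h => absurd h ha) (fun h => absurd h ha)
        (fun _ => ⟨mem_span_range _ 3, mem_span_range _ 4⟩) (mem_span_range _ 5) hv
    fin_cases i
    exacts [vP₁_mem rfl, vP₂_mem rfl, vT_mem _, vY₁_mem hd, vY₂_mem hd, vU_mem]

/-- The bases for `b = -e ≠ 0`. -/
lemma isBasisOf_of_eq_neg (hbe : b = -e) (hb : b ≠ 0) (c : ℝ) :
    (a = 1 / 4 → d = 1 / 4 → IsBasisOf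
      ![vN₁ a b, vN₂ b d, vT c, vR (2 * b), vX₁ b, vX₂ b, vY₁ (-b), vY₂ (-b), vU]
      (linearSymmetries a b d e)) ∧
    (a ≠ 1 / 4 → d ≠ 1 / 4 → IsBasisOf ![vN₁ a b, vN₂ b d, vT c, vU] (linearSymmetries a b d e)) ∧
    (a = 1 / 4 → d ≠ 1 / 4 → IsBasisOf ![vN₁ a b, vN₂ b d, vT c, vX₁ b, vX₂ b, vU]
      (linearSymmetries a b d e)) ∧
    (a ≠ 1 / 4 → d = 1 / 4 → IsBasisOf ![vN₁ a b, vN₂ b d, vT c, vY₁ (-b), vY₂ (-b), vU]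
      (linearSymmetries a b d e)) := by
  obtain rfl : e = -b := by linarith
  have hN := linearIndependent_N hb a d c (2 * b) (-b)
  have hR : 2 * b = b - -b := by ring
  refine ⟨fun ha hd => ?_, fun ha hd => ?_, fun ha hd => ?_, fun ha hd => ?_⟩
  · refine isBasisOf_linearSymmetries hN id Function.injective_id (fun _ => rfl)
      (fun i => ?_) fun v hv => mem_of_generators_mem hR
        (fun D => timePart_mem_of_eq_neg hbe hb (mem_span_range _ 0) (mem_span_range _ 1)
          (mem_span_range _ 2) (mem_span_range _ 8))
        (fun _ _ _ => mem_span_range _ 3) (fun _ => ⟨mem_span_range _ 4, mem_span_range _ 5⟩)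
        (fun _ => ⟨mem_span_range _ 6, mem_span_range _ 7⟩) (mem_span_range _ 8) hv
    fin_cases i
    exacts [vN₁_mem hbe, vN₂_mem hbe, vT_mem _, vR_mem ha hd (neg_sq b).symm hR, vX₁_mem ha,
        vX₂_mem ha, vY₁_mem hd, vY₂_mem hd, vU_mem]
  · refine isBasisOf_linearSymmetries hN ![0, 1, 2, 8] (by decide)
      (fun i => by fin_cases i <;> rfl)
      (fun i => ?_) fun v hv => mem_of_generators_mem hR
        (fun D => timePart_mem_of_eq_neg hbe hb (mem_span_range _ 0) (mem_span_range _ 1)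
          (mem_span_range _ 2) (mem_span_range _ 3))
        (fun h => absurd h ha) (fun h => absurd h ha)
        (fun h => absurd h hd) (mem_span_range _ 3) hv
    fin_cases i
    exacts [vN₁_mem hbe, vN₂_mem hbe, vT_mem _, vU_mem]
  · refine isBasisOf_linearSymmetries hN ![0, 1, 2, 4, 5, 8] (by decide)
      (fun i => by fin_cases i <;> rfl)
      (fun i => ?_) fun v hv => mem_of_generators_mem hR
        (fun D => timePart_mem_of_eq_neg hbe hb (mem_span_range _ 0) (mem_span_range _ 1)
          (mem_span_range _ 2) (mem_span_range _ 5))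
        (fun _ h => absurd h hd) (fun _ => ⟨mem_span_range _ 3, mem_span_range _ 4⟩)
        (fun h => absurd h hd) (mem_span_range _ 5) hv
    fin_cases i
    exacts [vN₁_mem hbe, vN₂_mem hbe, vT_mem _, vX₁_mem ha, vX₂_mem ha, vU_mem]
  · refine isBasisOf_linearSymmetries hN ![0, 1, 2, 6, 7, 8] (by decide)
      (fun i => by fin_cases i <;> rfl)
      (fun i => ?_) fun v hv => mem_of_generators_mem hR
        (fun D => timePart_mem_of_eq_neg hbe hb (mem_span_range _ 0) (mem_span_range _ 1)
          (mem_span_range _ 2) (mem_span_range _ 5))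
        (fun h => absurd h ha) (fun h => absurd h ha)
        (fun _ => ⟨mem_span_range _ 3, mem_span_range _ 4⟩) (mem_span_range _ 5) hv
    fin_cases i
    exacts [vN₁_mem hbe, vN₂_mem hbe, vT_mem _, vY₁_mem hd, vY₂_mem hd, vU_mem]

/-- The bases for `b = e = 0`. -/
lemma isBasisOf_of_eq_zero (hb : b = 0) (he : e = 0) :
    (a = 1 / 4 → d = 1 / 4 → IsBasisOf ![vZ₁ a d, vZ₂, vT 0, vR 0, vX₁ 0, vX₂ 0, vY₁ 0, vY₂ 0, vU]
      (linearSymmetries a b d e)) ∧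
    (a ≠ 1 / 4 → d ≠ 1 / 4 → IsBasisOf ![vZ₁ a d, vZ₂, vT 0, vU] (linearSymmetries a b d e)) ∧
    (a = 1 / 4 → d ≠ 1 / 4 → IsBasisOf ![vZ₁ a d, vZ₂, vT 0, vX₁ 0, vX₂ 0, vU]
      (linearSymmetries a b d e)) ∧
    (a ≠ 1 / 4 → d = 1 / 4 → IsBasisOf ![vZ₁ a d, vZ₂, vT 0, vY₁ 0, vY₂ 0, vU]
      (linearSymmetries a b d e)) := by
  subst hb he
  have hN := linearIndependent_Z a d 0 0 0
  refine ⟨fun ha hd => ?_, fun ha hd => ?_, fun ha hd => ?_, fun ha hd => ?_⟩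
  · refine isBasisOf_linearSymmetries hN id Function.injective_id (fun _ => rfl)
      (fun i => ?_) fun v hv => mem_of_generators_mem (sub_self 0).symm
        (fun D => timePart_mem_of_eq_zero rfl rfl (mem_span_range _ 0)
          (mem_span_range _ 1) (mem_span_range _ 2) (mem_span_range _ 8))
        (fun _ _ _ => mem_span_range _ 3) (fun _ => ⟨mem_span_range _ 4, mem_span_range _ 5⟩)
        (fun _ => ⟨mem_span_range _ 6, mem_span_range _ 7⟩) (mem_span_range _ 8) hv
    fin_cases i
    exacts [vZ₁_mem rfl rfl, vZ₂_mem rfl rfl, vT_mem _, vR_mem ha hd rfl (sub_self 0).symm,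
        vX₁_mem ha, vX₂_mem ha, vY₁_mem hd, vY₂_mem hd, vU_mem]
  · refine isBasisOf_linearSymmetries hN ![0, 1, 2, 8] (by decide)
      (fun i => by fin_cases i <;> rfl)
      (fun i => ?_) fun v hv => mem_of_generators_mem (sub_self 0).symm
        (fun D => timePart_mem_of_eq_zero rfl rfl (mem_span_range _ 0)
          (mem_span_range _ 1) (mem_span_range _ 2) (mem_span_range _ 3))
        (fun h => absurd h ha) (fun h => absurd h ha)
        (fun h => absurd h hd) (mem_span_range _ 3) hv
    fin_cases i
    exacts [vZ₁_mem rfl rfl, vZ₂_mem rfl rfl, vT_mem _, vU_mem]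
  · refine isBasisOf_linearSymmetries hN ![0, 1, 2, 4, 5, 8] (by decide)
      (fun i => by fin_cases i <;> rfl)
      (fun i => ?_) fun v hv => mem_of_generators_mem (sub_self 0).symm
        (fun D => timePart_mem_of_eq_zero rfl rfl (mem_span_range _ 0)
          (mem_span_range _ 1) (mem_span_range _ 2) (mem_span_range _ 5))
        (fun _ h => absurd h hd) (fun _ => ⟨mem_span_range _ 3, mem_span_range _ 4⟩)
        (fun h => absurd h hd) (mem_span_range _ 5) hv
    fin_cases i
    exacts [vZ₁_mem rfl rfl, vZ₂_mem rfl rfl, vT_mem _, vX₁_mem ha, vX₂_mem ha, vU_mem]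
  · refine isBasisOf_linearSymmetries hN ![0, 1, 2, 6, 7, 8] (by decide)
      (fun i => by fin_cases i <;> rfl)
      (fun i => ?_) fun v hv => mem_of_generators_mem (sub_self 0).symm
        (fun D => timePart_mem_of_eq_zero rfl rfl (mem_span_range _ 0)
          (mem_span_range _ 1) (mem_span_range _ 2) (mem_span_range _ 5))
        (fun h => absurd h ha) (fun h => absurd h ha)
        (fun _ => ⟨mem_span_range _ 3, mem_span_range _ 4⟩) (mem_span_range _ 5) hv
    fin_cases i
    exacts [vZ₁_mem rfl rfl, vZ₂_mem rfl rfl, vT_mem _, vY₁_mem hd, vY₂_mem hd, vU_mem]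

/-- `Set.finrank` is the dimension of the span. -/
lemma IsBasisOf.finrank_eq {n : ℕ} {w : Fin n → Field} {S : Set Field} (h : IsBasisOf w S) :
    Set.finrank ℝ S = n := by
  rw [Set.finrank, ← h.2, Submodule.span_eq, finrank_span_eq_card h.1, Fintype.card_fin]

/-- The dimensions for `b = ± e`. -/
lemma finrank_of_eq_or_eq_neg (h : b = e ∨ b = -e) :
    (a = 1 / 4 → d = 1 / 4 → Set.finrank ℝ (linearSymmetries a b d e) = 9) ∧
    (a ≠ 1 / 4 → d ≠ 1 / 4 → Set.finrank ℝ (linearSymmetries a b d e) = 4) ∧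
    (a = 1 / 4 → d ≠ 1 / 4 → Set.finrank ℝ (linearSymmetries a b d e) = 6) ∧
    (a ≠ 1 / 4 → d = 1 / 4 → Set.finrank ℝ (linearSymmetries a b d e) = 6) := by
  rcases eq_or_ne b 0 with hb | hb
  · have he : e = 0 := h.elim (fun h => h.symm.trans hb) fun h => neg_eq_zero.1 (h.symm.trans hb)
    obtain ⟨h1, h2, h3, h4⟩ := isBasisOf_of_eq_zero (a := a) (d := d) hb he
    exact ⟨fun ha hd => (h1 ha hd).finrank_eq, fun ha hd => (h2 ha hd).finrank_eq,
      fun ha hd => (h3 ha hd).finrank_eq, fun ha hd => (h4 ha hd).finrank_eq⟩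
  · rcases h with h | h
    · obtain ⟨h1, h2, h3, h4⟩ := isBasisOf_of_eq (a := a) (d := d) h hb 0
      exact ⟨fun ha hd => (h1 ha hd).finrank_eq, fun ha hd => (h2 ha hd).finrank_eq,
        fun ha hd => (h3 ha hd).finrank_eq, fun ha hd => (h4 ha hd).finrank_eq⟩
    · obtain ⟨h1, h2, h3, h4⟩ := isBasisOf_of_eq_neg (a := a) (d := d) h hb 0
      exact ⟨fun ha hd => (h1 ha hd).finrank_eq, fun ha hd => (h2 ha hd).finrank_eq,
        fun ha hd => (h3 ha hd).finrank_eq, fun ha hd => (h4 ha hd).finrank_eq⟩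

lemma finrank_linearSymmetries (a b d e : ℝ) :
    Set.finrank ℝ (linearSymmetries a b d e) ∈ ({2, 4, 6, 9} : Set ℕ) ∧
    (Set.finrank ℝ (linearSymmetries a b d e) = 9 ↔
      a = 1 / 4 ∧ d = 1 / 4 ∧ (b = e ∨ b = -e)) ∧
    (Set.finrank ℝ (linearSymmetries a b d e) = 2 ↔
      a ≠ 1 / 4 ∧ d ≠ 1 / 4 ∧ b ≠ e ∧ b ≠ -e) := by
  by_cases h : b = e ∨ b = -e
  · obtain ⟨h1, h2, h3, h4⟩ := finrank_of_eq_or_eq_neg (a := a) (d := d) h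
    by_cases ha : a = 1 / 4 <;> by_cases hd : d = 1 / 4
    · rw [h1 ha hd]
      exact ⟨by simp, iff_of_true rfl (by tauto),
        iff_of_false (by decide) (by tauto)⟩
    · rw [h3 ha hd]
      exact ⟨by simp, iff_of_false (by decide) (by tauto),
        iff_of_false (by decide) (by tauto)⟩
    · rw [h4 ha hd]
      exact ⟨by simp, iff_of_false (by decide) (by tauto),
        iff_of_false (by decide) (by tauto)⟩
    · rw [h2 ha hd]
      exact ⟨by simp, iff_of_false (by decide) (by tauto),
        iff_of_false (by decide) (by tauto)⟩
  · obtain ⟨h1, h2, h3, h4⟩ := isBasisOf_of_ne (a := a) (d := d) (not_or.1 h).1 (not_or.1 h).2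
    by_cases ha : a = 1 / 4 <;> by_cases hd : d = 1 / 4
    · rw [(h1 ha hd).finrank_eq]
      exact ⟨by simp, iff_of_false (by decide) (by tauto),
        iff_of_false (by decide) (by tauto)⟩
    · rw [(h3 ha hd).finrank_eq]
      exact ⟨by simp, iff_of_false (by decide) (by tauto),
        iff_of_false (by decide) (by tauto)⟩
    · rw [(h4 ha hd).finrank_eq]
      exact ⟨by simp, iff_of_false (by decide) (by tauto),
        iff_of_false (by decide) (by tauto)⟩
    · rw [(h2 ha hd).finrank_eq]
      exact ⟨by simp, iff_of_false (by decide) (by tauto),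
        iff_of_true rfl (by tauto)⟩

end bases

end LongstaffSchwartz

end

open LongstaffSchwartz in
theorem mainTheorem1 (a b d e : ℝ) :
    -- the general form of the infinitesimal symmetries
    (∀ v : Field, v ∈ symmetries a b d e ↔
      (∀ p, p ∉ domain → v p = 0) ∧
      ∃ (τ h l k s : ℝ → ℝ) (μ : ℝ → ℝ → ℝ → ℝ),
        IsAdmissible a b d e τ h l k s ∧ IsSolution a b d e μ ∧
        ∀ x y t u : ℝ, 0 < x → 0 < y →
          v (x, y, t, u) =
            (deriv τ t * x + √x * (√y * h t + l t),
             deriv τ t * y + √y * (-√x * h t + k t),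
             τ t,
             lam b e τ h l k s x y t * u + μ x y t)) ∧
    -- the finite-dimensional part and the part coming from linearity
    (∀ v : Field, v ∈ symmetries a b d e ↔
      ∃ w ∈ linearSymmetries a b d e, ∃ μ, IsSolution a b d e μ ∧ v = w + vMu μ) ∧
    (∀ v ∈ linearSymmetries a b d e, ∀ w ∈ linearSymmetries a b d e,
      VectorField.lieBracket ℝ v w ∈ linearSymmetries a b d e) ∧
    -- a = d = 1/4
    (a = 1 / 4 → d = 1 / 4 →
      (b ≠ e → b ≠ -e → IsBasisOf ![vT 0, vU, vX₁ b, vX₂ b, vY₁ e, vY₂ e]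
        (linearSymmetries a b d e)) ∧
      (b = e → b ≠ 0 → IsBasisOf
        ![vP₁ a b d, vP₂ b, vT (-(b / 2)), vR 0, vX₁ b, vX₂ b, vY₁ b, vY₂ b, vU]
        (linearSymmetries a b d e)) ∧
      (b = -e → b ≠ 0 → IsBasisOf
        ![vN₁ a b, vN₂ b d, vT 0, vR (2 * b), vX₁ b, vX₂ b, vY₁ (-b), vY₂ (-b), vU]
        (linearSymmetries a b d e)) ∧
      (b = 0 → e = 0 → IsBasisOf
        ![vZ₁ a d, vZ₂, vT 0, vR 0, vX₁ 0, vX₂ 0, vY₁ 0, vY₂ 0, vU]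
        (linearSymmetries a b d e))) ∧
    -- a ≠ 1/4 and d ≠ 1/4
    (a ≠ 1 / 4 → d ≠ 1 / 4 →
      (b ≠ e → b ≠ -e → IsBasisOf ![vT 0, vU] (linearSymmetries a b d e)) ∧
      (b = e → b ≠ 0 → IsBasisOf ![vP₁ a b d, vP₂ b, vT (-b * (a + d)), vU]
        (linearSymmetries a b d e)) ∧
      (b = -e → b ≠ 0 → IsBasisOf ![vN₁ a b, vN₂ b d, vT (b * (d - a)), vU]
        (linearSymmetries a b d e)) ∧
      (b = 0 → e = 0 → IsBasisOf ![vZ₁ a d, vZ₂, vT 0, vU] (linearSymmetries a b d e))) ∧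
    -- a = 1/4 and d ≠ 1/4
    (a = 1 / 4 → d ≠ 1 / 4 →
      (b ≠ e → b ≠ -e → IsBasisOf ![vT 0, vU, vX₁ b, vX₂ b] (linearSymmetries a b d e)) ∧
      (b = e → b ≠ 0 → IsBasisOf
        ![vP₁ a b d, vP₂ b, vT (-b * (1 / 4 + d)), vX₁ b, vX₂ b, vU]
        (linearSymmetries a b d e)) ∧
      (b = -e → b ≠ 0 → IsBasisOf
        ![vN₁ a b, vN₂ b d, vT (-b * (1 / 4 - d)), vX₁ b, vX₂ b, vU]
        (linearSymmetries a b d e)) ∧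
      (b = 0 → e = 0 → IsBasisOf ![vZ₁ a d, vZ₂, vT 0, vX₁ 0, vX₂ 0, vU]
        (linearSymmetries a b d e))) ∧
    -- a ≠ 1/4 and d = 1/4
    (a ≠ 1 / 4 → d = 1 / 4 →
      (b ≠ e → b ≠ -e → IsBasisOf ![vT 0, vU, vY₁ e, vY₂ e] (linearSymmetries a b d e)) ∧
      (b = e → b ≠ 0 → IsBasisOf
        ![vP₁ a b d, vP₂ b, vT (-b * (1 / 4 + a)), vY₁ b, vY₂ b, vU]
        (linearSymmetries a b d e)) ∧
      (b = -e → b ≠ 0 → IsBasisOf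
        ![vN₁ a b, vN₂ b d, vT (b * (1 / 4 - a)), vY₁ (-b), vY₂ (-b), vU]
        (linearSymmetries a b d e)) ∧
      (b = 0 → e = 0 → IsBasisOf ![vZ₁ a d, vZ₂, vT 0, vY₁ 0, vY₂ 0, vU]
        (linearSymmetries a b d e))) ∧
    -- the possible dimensions, the largest one and the smallest one
    Set.finrank ℝ (linearSymmetries a b d e) ∈ ({2, 4, 6, 9} : Set ℕ) ∧
    (Set.finrank ℝ (linearSymmetries a b d e) = 9 ↔
      a = 1 / 4 ∧ d = 1 / 4 ∧ (b = e ∨ b = -e)) ∧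
    (Set.finrank ℝ (linearSymmetries a b d e) = 2 ↔
      a ≠ 1 / 4 ∧ d ≠ 1 / 4 ∧ b ≠ e ∧ b ≠ -e) := by
  refine ⟨fun v => ⟨fun hv => ?_, ?_⟩, fun v => mem_symmetries_iff_exists_add v,
    fun v hv w hw => lieBracket_mem_linearSymmetries hv hw,
    fun ha hd => ⟨fun h₁ h₂ => (isBasisOf_of_ne h₁ h₂).1 ha hd,
      fun h hb => (isBasisOf_of_eq h hb _).1 ha hd,
      fun h hb => (isBasisOf_of_eq_neg h hb _).1 ha hd,
      fun hb he => (isBasisOf_of_eq_zero hb he).1 ha hd⟩,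
    fun ha hd => ⟨fun h₁ h₂ => (isBasisOf_of_ne h₁ h₂).2.1 ha hd,
      fun h hb => (isBasisOf_of_eq h hb _).2.1 ha hd,
      fun h hb => (isBasisOf_of_eq_neg h hb _).2.1 ha hd,
      fun hb he => (isBasisOf_of_eq_zero hb he).2.1 ha hd⟩,
    fun ha hd => ⟨fun h₁ h₂ => (isBasisOf_of_ne h₁ h₂).2.2.1 ha hd,
      fun h hb => (isBasisOf_of_eq h hb _).2.2.1 ha hd,
      fun h hb => (isBasisOf_of_eq_neg h hb _).2.2.1 ha hd,
      fun hb he => (isBasisOf_of_eq_zero hb he).2.2.1 ha hd⟩,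
    fun ha hd => ⟨fun h₁ h₂ => (isBasisOf_of_ne h₁ h₂).2.2.2 ha hd,
      fun h hb => (isBasisOf_of_eq h hb _).2.2.2 ha hd,
      fun h hb => (isBasisOf_of_eq_neg h hb _).2.2.2 ha hd,
      fun hb he => (isBasisOf_of_eq_zero hb he).2.2.2 ha hd⟩,
    finrank_linearSymmetries a b d e⟩
  · exact ⟨hv.1.zero_off, exists_hasForm_of_mem_symmetries hv⟩
  · rintro ⟨h0, τ, h, l, k, s, μ, H, hμ, hF⟩
    exact mem_symmetries_of_hasForm h0 H hμ hF
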